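/- **Setting.** Let $c>0$, $\alpha\in\mathbb R$, $C_\lambda,C_\mu>0$, and let $\beta:\mathbb Z\to(0,\infty)$ satisfy $\sup_n\beta(n)<\infty$. For real numbers $L,M$ put $$\lambda_n(L)=\beta(n)e^{-c(n-L)},\qquad \mu_n(M)=\beta(n-1)e^{c(n-M)}.$$ Let $\mathbf B$ be the Banach space of real sequences $p=(p_n)_{n\in\mathbb Z}$ with $\|p\|=\sum_n|p_n|\exp(\tfrac{c n^2}{2}+\alpha|n|)<\infty$. Consider, for $X(t)=(L(t),M(t),p_n(t),n\in\mathbb Z)$, $t\ge0$, with $\lambda_n(t)=\lambda_n(L(t))$ and $\mu_n(t)=\mu_n(M(t))$, the system $$p_n'=\lambda_{n-1}p_{n-1}-(\lambda_n+\mu_n)p_n+\mu_{n+1}p_{n+1},\qquad L'=-\sum_n p_n\lambda_n+C_\lambda,\qquad M'=\sum_n p_n\mu_n-C_\mu .$$ Given functions $L(\cdot),M(\cdot)$ continuous on $[0,\infty)$, let $H_0(t)$ be the diagonal and $V(t)$ the off-diagonal part of the infinitesimal matrix with jump rates $\lambda_n(t)$ ($n\to n+1$) and $\mu_n(t)$ ($n\to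 n-1$), and for $0\le t\le s$ let $P(n,s\,|\,m,t)$ be the $(m,n)$ entry of $$e^{\int_t^sH_0(u)du}+\sum_{k\ge1}\ \int_{t\le s_k\le\dots\le s_1\le s}e^{\int_t^{s_k}H_0(u)du}\,V(s_k)\,e^{\int_{s_k}^{s_{k-1}}H_0(u)du}\cdots V(s_1)\,e^{\int_{s_1}^{s}H_0(u)du}\,ds_k\cdots ds_1 .$$ **Theorem 5.** Let $X(0)=(L_0,M_0,p(0))$ be any initial condition for which $p(0)\in\mathbf B$ is a probability measure on $\mathbb Z$. Then the system has a unique solution $X(t)$ on $[0,\infty)$ with $p(\cdot)$ continuous in $\mathbf B$. For its functions $L(\cdot),M(\cdot)$ the series above converges entrywise, and the kernels $P_{X(0)}(n,s\,|\,m,t)$ that it defines are stochastic matrices with the semigroup (Chapman–Kolmogorov) property. There is a random process $\xi(t)\in\mathbb Z$, $t\in[0,\infty)$, given by a probability measure $P_{X(0)}$ on the set of trajectories $[0,\infty)\to\mathbb Z$, such that $P_{X(0)}(\xi(t)=n)=p_n(t)$ for all $t\ge 0$, $n\in\mathbb Z$, and, for all $k\ge1$, $0\le t_1\le\dots\le t_k$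 and $n_1,\dots,n_k\in\mathbb Z$, $$P_{X(0)}(\xi(t_1)=n_1,\dots,\xi(t_k)=n_k)=p_{n_1}(t_1)\,P_{X(0)}(n_2,t_2|n_1,t_1)\cdots P_{X(0)}(n_k,t_k|n_{k-1},t_{k-1}).$$ Suppose moreover that $C_\lambda=C_\mu$, that $\inf_n\beta(n)>0$, and that for some $C>0$ and all $n$ one has $e^{-c}\beta(n+1)-\beta(n)<-C$ and $e^{-c}\beta(n-1)-\beta(n)<-C$. Then there are real numbers $L_*,M_*$ such that, with $s=\frac{L_*+M_*}{2}$ and the discrete Gaussian law $\pi_s(n)=e^{-c(n-s)^2}/\sum_k e^{-c(k-s)^2}$, the triple $(L_*,M_*,\pi_s)$ is a fixed point of the system with $$L_*+M_*+\sum_n n\,\pi_s(n)=L_0+M_0+\sum_n n\,p_n(0),$$ and, for every $k$ and all $0\le t_1\le\dots\le t_k$, the joint distribution of $(\xi(t_1+\tau),\dots,\xi(t_k+\tau))$ converges, as $\tau\to\infty$, on every subset of $\mathbb Z^k$, to that of $(\eta_{t_1},\dots,\eta_{t_k})$, where $\eta_t$ is the stationary continuous-time random walk on $\mathbb Z$ with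 the constant jump rates $\lambda_n(L_*)$ ($n\to n+1$) and $\mu_n(M_*)$ ($n\to n-1$) and stationary law $\pi_s$. -/

import Mathlib

open MeasureTheory Filter Topology
open scoped NNReal

noncomputable section

namespace NonlinearWalk

/-- Intensity of the jump `n → n + 1`: `λ_n = β(n) e^{-c(n - L)}`. -/
def rateUp (c : ℝ) (β : ℤ → ℝ) (L : ℝ) (n : ℤ) : ℝ :=
  β n * Real.exp (-c * ((n : ℝ) - L))

/-- Intensity of the jump `n → n - 1`: `μ_n = β(n - 1) e^{c(n - M)}`. -/
def rateDown (c : ℝ) (β : ℤ → ℝ) (M : ℝ) (n : ℤ) : ℝ :=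
  β (n - 1) * Real.exp (c * ((n : ℝ) - M))

/-- The `n`-th component of the right-hand side of the Kolmogorov equations,
`λ_{n-1} p_{n-1} - (λ_n + μ_n) p_n + μ_{n+1} p_{n+1}`. -/
def kolmogorovRHS (c : ℝ) (β : ℤ → ℝ) (L M : ℝ) (p : ℤ → ℝ) (n : ℤ) : ℝ :=
  rateUp c β L (n - 1) * p (n - 1) - (rateUp c β L n + rateDown c β M n) * p n
    + rateDown c β M (n + 1) * p (n + 1)

/-- The weight of the Banach space of admissible measures. -/
def weight (c α : ℝ) (n : ℤ) : ℝ :=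
  Real.exp (c * (n : ℝ) ^ 2 / 2 + α * |(n : ℝ)|)

/-- Membership in the Banach space `B` with norm
`‖p‖ = ∑ |p_n| exp (c n² / 2 + α |n|)`. -/
def MemB (c α : ℝ) (p : ℤ → ℝ) : Prop :=
  Summable fun n : ℤ => |p n| * weight c α n

/-- The norm of `B`. -/
def normB (c α : ℝ) (p : ℤ → ℝ) : ℝ :=
  ∑' n : ℤ, |p n| * weight c α n

/-- A probability vector on `ℤ`. -/
def IsProbVector (p : ℤ → ℝ) : Prop :=
  (∀ n, 0 ≤ p n) ∧ HasSum p 1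

/-- `(L, M, p)` is a solution on `[0, ∞)`, continuous in time with values in the Banach space,
of the infinite system
`p_n' = λ_{n-1} p_{n-1} - (λ_n + μ_n) p_n + μ_{n+1} p_{n+1}`,
`L' = - ∑ p_n λ_n + C_λ`, `M' = ∑ p_n μ_n - C_μ`, with initial data `(L0, M0, p0)`.
Derivatives at time `0` are one-sided; values at negative times play no role. -/
structure IsSolution (c α : ℝ) (β : ℤ → ℝ) (Cl Cm L0 M0 : ℝ) (p0 : ℤ → ℝ)
    (L M : ℝ → ℝ) (p : ℝ → ℤ → ℝ) : Prop where
  init_L : L 0 = L0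
  init_M : M 0 = M0
  init_p : p 0 = p0
  memB : ∀ t, 0 ≤ t → MemB c α (p t)
  continuous_p : ∀ t, 0 ≤ t →
    Tendsto (fun u => normB c α (fun n => p u n - p t n)) (𝓝[Set.Ici 0] t) (𝓝 0)
  deriv_p : ∀ t, 0 ≤ t → ∀ n : ℤ,
    HasDerivWithinAt (fun u => p u n) (kolmogorovRHS c β (L t) (M t) (p t) n) (Set.Ici 0) t
  deriv_L : ∀ t, 0 ≤ t →
    HasDerivWithinAt L (-(∑' n : ℤ, p t n * rateUp c β (L t) n) + Cl) (Set.Ici 0) t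
  deriv_M : ∀ t, 0 ≤ t →
    HasDerivWithinAt M ((∑' n : ℤ, p t n * rateDown c β (M t) n) - Cm) (Set.Ici 0) t

/-- Diagonal entry `exp (∫_t^s H₀)` at `n`: the probability of not leaving `n` between the
times `t` and `s`. -/
def holdProb (c : ℝ) (β : ℤ → ℝ) (L M : ℝ → ℝ) (n : ℤ) (t s : ℝ) : ℝ :=
  Real.exp (-∫ u in t..s, (rateUp c β (L u) n + rateDown c β (M u) n))

/-- The entry `(m, n)` of the `k`-th term of the series
`P(t,s) = e^{∫_t^s H₀} + ∑_k ∫_{t ≤ s_k ≤ … ≤ s_1 ≤ s}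
  e^{∫_t^{s_k} H₀} V(s_k) e^{∫_{s_k}^{s_{k-1}} H₀} ⋯ V(s_1) e^{∫_{s_1}^s H₀} ds_k ⋯ ds_1`,
where `H₀` and `V` are the diagonal and the off-diagonal part of the infinitesimal matrix with the
rates given by `L(·)`, `M(·)`. The outermost variable `u` is `s_1`, the time of the last jump. -/
def jumpTerm (c : ℝ) (β : ℤ → ℝ) (L M : ℝ → ℝ) : ℕ → ℤ → ℝ → ℤ → ℝ → ℝ
  | 0, m, t, n, s => if n = m then holdProb c β L M n t s else 0
  | k + 1, m, t, n, s =>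
      ∫ u in t..s,
        (jumpTerm c β L M k m t (n - 1) u * rateUp c β (L u) (n - 1)
          + jumpTerm c β L M k m t (n + 1) u * rateDown c β (M u) (n + 1))
        * holdProb c β L M n u s

/-- The transition kernel `P(n, s | m, t)`, from the state `m` at time `t` to the state `n` at
time `s ≥ t`, of the walk with the rates given by `L(·)`, `M(·)`. -/
def transitionProb (c : ℝ) (β : ℤ → ℝ) (L M : ℝ → ℝ) (n : ℤ) (s : ℝ) (m : ℤ) (t : ℝ) : ℝ :=
  ∑' k : ℕ, jumpTerm c β L M k m t n s

/-- `κ n s m t`, `0 ≤ t ≤ s`, is a family of stochastic matrices with the semigroup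
(Chapman–Kolmogorov) property. -/
structure IsStochasticSemigroup (κ : ℤ → ℝ → ℤ → ℝ → ℝ) : Prop where
  nonneg : ∀ n s m t, 0 ≤ t → t ≤ s → 0 ≤ κ n s m t
  sum_one : ∀ s m t, 0 ≤ t → t ≤ s → HasSum (fun n => κ n s m t) 1
  diag : ∀ n m t, 0 ≤ t → κ n t m t = if n = m then 1 else 0
  chapman_kolmogorov : ∀ n s u m t, 0 ≤ t → t ≤ u → u ≤ s →
    HasSum (fun l => κ l u m t * κ n s l u) (κ n s m t)

/-- The probability measure `P` on the set of trajectories `[0, ∞) → ℤ` has, for all times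
`t_1 ≤ … ≤ t_k`, the Markovian finite-dimensional distributions
`P(ξ(t_1) = n_1, …, ξ(t_k) = n_k) = q_{n_1}(t_1) κ(n_2,t_2|n_1,t_1) ⋯ κ(n_k,t_k|n_{k-1},t_{k-1})`,
where `ξ(t)` is the coordinate process. Here the number of times is `k + 1`. -/
structure HasMarkovianFDD (P : Measure (ℝ≥0 → ℤ)) (q : ℝ → ℤ → ℝ)
    (κ : ℤ → ℝ → ℤ → ℝ → ℝ) : Prop where
  isProbabilityMeasure : IsProbabilityMeasure P
  fdd : ∀ (k : ℕ) (t : Fin (k + 1) → ℝ≥0), Monotone t → ∀ n : Fin (k + 1) → ℤ,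
    P.real {ω | ∀ i, ω (t i) = n i} =
      q (t 0) (n 0) *
        ∏ i : Fin k, κ (n i.succ) (t i.succ) (n i.castSucc) (t i.castSucc)

/-- The law of the coordinate process is invariant under time shifts. -/
def IsStationary (P : Measure (ℝ≥0 → ℤ)) : Prop :=
  ∀ h : ℝ≥0, P.map (fun ω t => ω (t + h)) = P

/-- The discrete Gaussian probability vector `π_s(n) = e^{-c(n-s)²} / ∑_k e^{-c(k-s)²}`. -/
def discreteGaussian (c s : ℝ) (n : ℤ) : ℝ :=
  Real.exp (-c * ((n : ℝ) - s) ^ 2) / ∑' k : ℤ, Real.exp (-c * ((k : ℝ) - s) ^ 2)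

/-- `P` is the law of the stationary classical random walk on `ℤ` with the time-independent
intensities given by the numbers `L`, `M`; its one-dimensional law is the discrete Gaussian
measure with `s = (L + M) / 2`. -/
structure IsStationaryWalk (c : ℝ) (β : ℤ → ℝ) (L M : ℝ) (P : Measure (ℝ≥0 → ℤ)) : Prop where
  fdd : HasMarkovianFDD P (fun _ => discreteGaussian c ((L + M) / 2))
    (transitionProb c β (fun _ => L) (fun _ => M))
  stationary : IsStationary P

/-- `(L, M, π)`, with `π` a probability vector, is a fixed point of the system. -/
structure IsFixedPoint (c : ℝ) (β : ℤ → ℝ) (Cl Cm L M : ℝ) (π : ℤ → ℝ) : Prop where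
  prob : IsProbVector π
  balance : ∀ n, kolmogorovRHS c β L M π n = 0
  sum_up : HasSum (fun n => π n * rateUp c β L n) Cl
  sum_down : HasSum (fun n => π n * rateDown c β M n) Cm

/-- The conserved quantity `K = L + M + ∑ n p_n`. -/
def invariantK (L M : ℝ) (p : ℤ → ℝ) : ℝ :=
  L + M + ∑' n : ℤ, (n : ℝ) * p n

/-- The technical condition for convergence: `inf β > 0`, and for some `C > 0` and all `n`,
`e^{-c} β(n ± 1) - β(n) < -C`. -/
def ConvergenceCondition (c : ℝ) (β : ℤ → ℝ) : Prop :=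
  (∃ b : ℝ, 0 < b ∧ ∀ n, b ≤ β n) ∧
  ∃ C : ℝ, 0 < C ∧ ∀ n,
    Real.exp (-c) * β (n + 1) - β n < -C ∧ Real.exp (-c) * β (n - 1) - β n < -C

/-- All finite-dimensional distributions of the process with law `P`, shifted by `τ`, converge as
`τ → ∞` to those of the process with law `Q` (setwise). -/
def FDDTendsto (P Q : Measure (ℝ≥0 → ℤ)) : Prop :=
  ∀ (k : ℕ) (t : Fin k → ℝ≥0), Monotone t → ∀ A : Set (Fin k → ℤ),
    Tendsto (fun τ : ℝ≥0 => P.real {ω | (fun i => ω (t i + τ)) ∈ A}) atTop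
      (𝓝 (Q.real {ω | (fun i => ω (t i)) ∈ A}))

end NonlinearWalk

end

/-! ### Rates against the Gaussian weight of B. -/

namespace NonlinearWalk

variable {c α B : ℝ} {β : ℤ → ℝ}

/-! The total rate grows like e^{c|n|}, but the Gaussian weight of B is matched to it: going from
n-1 to n multiplies the weight by e^{cn} up to a constant, and this is what λ_{n-1} takes away;
downward jumps are symmetric. So the off-diagonal part of the generator is bounded on B as long as
e^{cL} and e^{-cM} are, while the unbounded diagonal part is pure damping. The jump series is then
dominated by an exponential series (`sum_jumpTerm_mul_weight_le`) and its sum solves the forward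
equations. Pairing with constants gives total mass one, and uniqueness (`forward_unique`) gives
Chapman-Kolmogorov.

For the nonlinear system, L and M determine p through the linear flow, and p determines L and M. In
the unknowns e^{-cL} and e^{cM} the second half is a scalar linear equation with nonnegative source;
positivity bounds L above and M below, which are exactly the bounds that control the rates, so
nothing blows up in finite time. Comparing two flows with different coefficients costs a factor
e^{c|n|}, so their difference is measured with α - c in place of α (`forward_stability`). On every
[0, T] the resulting map on (L, M) contracts in a supremum norm weighted by e^{-κt} with κ large
(`picardMap_contracting`), which yields global existence and uniqueness. The process is then built
by Kolmogorov extension, proved here by compactness of products of finite sets.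

For convergence let C_λ = C_μ. Then K = L + M + Σ n p_n is conserved. Detailed balance makes π_s
stationary, and an intermediate value argument in s finds a fixed point with the given K. Put D_n =
Σ_{k≤n} (p_k - π_k) and S = L + M - L_* - M_*. Abel summation and the conservation law give Σ D_n =
S. Moreover D_n' = λ_n D_{n-1} + μ_{n+1} D_{n+1} - (λ_n + μ_{n+1}) D_n - r_n, where the defect r_n
of detailed balance has the sign of S. So if S ≥ 0 the source only lowers the positive parts of D,
and these are also the larger side, since their sum minus the sum of the negative parts is S; if S ≤
0 the roles are exchanged. The condition on β makes the linear part contract in ℓ¹ at a rate at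
least C min(e^{cL}, e^{-cM}). Hence the larger of the two one-sided sums never increases
(`hasDerivWithinAt_imbalance`).

It remains to keep that rate away from zero. Monotonicity bounds L + M; then e^{2cn} and e^{-2cn}
are Lyapunov functions, their moments stay bounded, and the equation for e^{-cL} bounds L below,
hence M above. The decay is therefore exponential, p tends to π_s, and the relaxation equation gives
L → L_* and then M → M_*. Stability of the forward equations carries this over to the time-shifted
kernels, and so to the joint laws. -/

theorem weight_pos (c α : ℝ) (n : ℤ) : 0 < weight c α n := Real.exp_pos _

theorem rateUp_eq (c : ℝ) (β : ℤ → ℝ) (L : ℝ) (n : ℤ) :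
    rateUp c β L n = Real.exp (c * L) * rateUp c β 0 n := by
  unfold rateUp
  rw [mul_left_comm, ← Real.exp_add]
  congr 2; ring

theorem rateDown_eq (c : ℝ) (β : ℤ → ℝ) (M : ℝ) (n : ℤ) :
    rateDown c β M n = Real.exp (-c * M) * rateDown c β 0 n := by
  unfold rateDown
  rw [mul_left_comm, ← Real.exp_add]
  congr 2; ring

theorem rateUp_pos (hβ : ∀ n, 0 < β n) (L : ℝ) (n : ℤ) : 0 < rateUp c β L n :=
  mul_pos (hβ n) (Real.exp_pos _)

theorem rateDown_pos (hβ : ∀ n, 0 < β n) (M : ℝ) (n : ℤ) : 0 < rateDown c β M n :=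
  mul_pos (hβ _) (Real.exp_pos _)

theorem continuous_rateUp {L : ℝ → ℝ} (hL : Continuous L) (n : ℤ) :
    Continuous fun t => rateUp c β (L t) n := by
  unfold rateUp; fun_prop

theorem continuous_rateDown {M : ℝ → ℝ} (hM : Continuous M) (n : ℤ) :
    Continuous fun t => rateDown c β (M t) n := by
  unfold rateDown; fun_prop

theorem rateUp_zero_le (hc : 0 < c) (hβ : ∀ n, 0 < β n) (hB : ∀ n, β n ≤ B) (n : ℤ) :
    rateUp c β 0 n ≤ B * Real.exp (c * |(n : ℝ)|) := by
  unfold rateUp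
  have h0 : 0 < B := (hβ 0).trans_le (hB 0)
  refine mul_le_mul (hB _) (Real.exp_le_exp.2 ?_) (Real.exp_pos _).le h0.le
  nlinarith [neg_abs_le (n : ℝ)]

theorem rateDown_zero_le (hc : 0 < c) (hβ : ∀ n, 0 < β n) (hB : ∀ n, β n ≤ B) (n : ℤ) :
    rateDown c β 0 n ≤ B * Real.exp (c * |(n : ℝ)|) := by
  unfold rateDown
  have h0 : 0 < B := (hβ 0).trans_le (hB 0)
  refine mul_le_mul (hB _) (Real.exp_le_exp.2 ?_) (Real.exp_pos _).le h0.le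
  nlinarith [le_abs_self (n : ℝ)]

/-- A bound for the off-diagonal part of the generator in the weighted norm. -/
noncomputable def offDiagConst (c α B : ℝ) : ℝ := B * Real.exp (c / 2 + |α|)

theorem mul_abs_sub_abs_le (α x y : ℝ) (h : |x - y| ≤ 1) : α * |x| ≤ α * |y| + |α| := by
  have h1 : |(|x| - |y|)| ≤ 1 := (abs_abs_sub_abs_le x y).trans h
  have h2 : α * (|x| - |y|) ≤ |α| * 1 := by
    refine (le_abs_self _).trans ?_
    rw [abs_mul]
    gcongr
  linarith

/-- The exponents fit because n²/2 - (n-1) = (n-1)²/2 + 1/2, so the gain term loses only e^{c/2} and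
the factor e^{|α|} from the linear part of the weight. -/
theorem rateUp_mul_weight_le (hβ : ∀ n, 0 < β n) (hB : ∀ n, β n ≤ B) (n : ℤ) :
    rateUp c β 0 (n - 1) * weight c α n ≤ offDiagConst c α B * weight c α (n - 1) := by
  unfold rateUp weight offDiagConst
  have h0 : 0 < B := (hβ 0).trans_le (hB 0)
  rw [mul_assoc, mul_assoc, ← Real.exp_add, ← Real.exp_add]
  refine mul_le_mul (hB _) (Real.exp_le_exp.2 ?_) (Real.exp_pos _).le h0.le
  · have := mul_abs_sub_abs_le α (n : ℝ) ((n - 1 : ℤ) : ℝ) (by push_cast; simp)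
    push_cast at this ⊢
    nlinarith

theorem rateDown_mul_weight_le (hβ : ∀ n, 0 < β n) (hB : ∀ n, β n ≤ B) (n : ℤ) :
    rateDown c β 0 (n + 1) * weight c α n ≤ offDiagConst c α B * weight c α (n + 1) := by
  unfold rateDown weight offDiagConst
  have h0 : 0 < B := (hβ 0).trans_le (hB 0)
  rw [mul_assoc, mul_assoc, ← Real.exp_add, ← Real.exp_add]
  refine mul_le_mul (hB _) (Real.exp_le_exp.2 ?_) (Real.exp_pos _).le h0.le
  · have := mul_abs_sub_abs_le α (n : ℝ) ((n + 1 : ℤ) : ℝ) (by push_cast; simp)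
    push_cast at this ⊢
    nlinarith

/-- The diagonal is unbounded on B; lowering α by c pays for its growth e^{c|n|}. This is the loss
of weight in the stability estimate. -/
theorem rateUp_mul_weight_sub_le (hc : 0 < c) (hβ : ∀ n, 0 < β n) (hB : ∀ n, β n ≤ B) (n : ℤ) :
    rateUp c β 0 n * weight c (α - c) n ≤ B * weight c α n := by
  refine (mul_le_mul_of_nonneg_right (rateUp_zero_le hc hβ hB n) (weight_pos _ _ _).le).trans
    (le_of_eq ?_)
  unfold weight
  rw [mul_assoc, ← Real.exp_add]
  congr 2; ring

theorem rateDown_mul_weight_sub_le (hc : 0 < c) (hβ : ∀ n, 0 < β n) (hB : ∀ n, β n ≤ B)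
    (n : ℤ) : rateDown c β 0 n * weight c (α - c) n ≤ B * weight c α n := by
  refine (mul_le_mul_of_nonneg_right (rateDown_zero_le hc hβ hB n) (weight_pos _ _ _).le).trans
    (le_of_eq ?_)
  unfold weight
  rw [mul_assoc, ← Real.exp_add]
  congr 2; ring

theorem weight_sub_le (hc : 0 < c) (n : ℤ) : weight c (α - c) n ≤ weight c α n := by
  unfold weight
  gcongr
  linarith

theorem summable_exp_neg_abs_int : Summable fun n : ℤ => Real.exp (-|(n : ℝ)|) := by
  have h : Summable fun n : ℕ => Real.exp (-(n : ℝ)) := Real.summable_exp_neg_nat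
  refine Summable.of_nat_of_neg ?_ ?_ <;> simpa using h

/-- A Gaussian weight beats every exponential. -/
theorem exists_exp_le_weight (hc : 0 < c) (α K : ℝ) :
    ∃ R : ℝ, 0 < R ∧ ∀ n : ℤ, Real.exp (K * |(n : ℝ)|) ≤ R * weight c α n := by
  refine ⟨Real.exp ((K - α) ^ 2 / (2 * c)), Real.exp_pos _, fun n => ?_⟩
  unfold weight
  rw [← Real.exp_add]
  gcongr
  -- Completing the square in |n|; the constant left over is the logarithm of the witness R.
  have h1 : (K - α) ^ 2 / (2 * c) + c * (n : ℝ) ^ 2 / 2 - (K - α) * |(n : ℝ)|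
      = (c * |(n : ℝ)| - (K - α)) ^ 2 / (2 * c) := by
    rw [← sq_abs (n : ℝ)]
    field_simp
    ring
  have h2 : 0 ≤ (c * |(n : ℝ)| - (K - α)) ^ 2 / (2 * c) := by positivity
  nlinarith

theorem summable_exp_div_weight (hc : 0 < c) (α K : ℝ) :
    Summable fun n : ℤ => Real.exp (K * |(n : ℝ)|) / weight c α n := by
  obtain ⟨R, hR, h⟩ := exists_exp_le_weight hc α (K + 1)
  refine Summable.of_nonneg_of_le (fun n => div_nonneg (Real.exp_pos _).le (weight_pos _ _ _).le)
    (fun n => ?_) (summable_exp_neg_abs_int.mul_left R)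
  rw [div_le_iff₀ (weight_pos _ _ _)]
  have h1 := h n
  calc Real.exp (K * |(n : ℝ)|) = Real.exp ((K + 1) * |(n : ℝ)|) * Real.exp (-|(n : ℝ)|) := by
        rw [← Real.exp_add]; congr 1; ring
    _ ≤ R * weight c α n * Real.exp (-|(n : ℝ)|) := by gcongr
    _ = _ := by ring

end NonlinearWalk

/-! ### One-sided calculus, termwise differentiation and damping. -/

namespace NonlinearWalk

/-- The right derivative of the maximum of two functions. -/
theorem hasDerivWithinAt_max {f g : ℝ → ℝ} {f' g' x : ℝ}
    (hf : HasDerivWithinAt f f' (Set.Ici x) x) (hg : HasDerivWithinAt g g' (Set.Ici x) x) :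
    HasDerivWithinAt (fun y => max (f y) (g y))
      (if g x < f x then f' else if f x < g x then g' else max f' g') (Set.Ici x) x := by
  split_ifs with h1 h2
  · refine hf.congr_of_eventuallyEq ?_ (max_eq_left h1.le)
    filter_upwards [hg.continuousWithinAt.eventually_lt hf.continuousWithinAt h1] with y hy
    exact max_eq_left hy.le
  · refine hg.congr_of_eventuallyEq ?_ (max_eq_right h2.le)
    filter_upwards [hf.continuousWithinAt.eventually_lt hg.continuousWithinAt h2] with y hy
    exact max_eq_right hy.le
  -- At a tie, for y > x, the slope of the maximum is the maximum of the slopes.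
  · have h : f x = g x := le_antisymm (not_lt.1 h1) (not_lt.1 h2)
    rw [hasDerivWithinAt_iff_tendsto_slope, Set.Ici_sdiff_left] at hf hg ⊢
    refine (hf.max hg).congr' ?_
    filter_upwards [self_mem_nhdsWithin] with y hy
    have hy : 0 < y - x := sub_pos.2 hy
    simp only [slope_def_field]
    rw [max_div_div_right hy.le, ← h, max_self, max_sub_sub_right]

theorem hasDerivWithinAt_abs {f : ℝ → ℝ} {f' x : ℝ} (hf : HasDerivWithinAt f f' (Set.Ici x) x) :
    HasDerivWithinAt (fun y => |f y|)
      (if 0 < f x then f' else if f x < 0 then -f' else |f'|) (Set.Ici x) x := by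
  have h1 : -f x < f x ↔ 0 < f x := by constructor <;> intro h <;> linarith
  have h2 : f x < -f x ↔ f x < 0 := by constructor <;> intro h <;> linarith
  refine (hasDerivWithinAt_max hf hf.neg).congr_deriv ?_
  simp only [Pi.neg_apply, h1, h2, abs_eq_max_neg]

/-- Termwise differentiation under a uniform summable Lipschitz bound. -/
theorem hasDerivWithinAt_tsum_of_lipschitz {ι : Type*} {f : ι → ℝ → ℝ} {f' : ι → ℝ}
    {G : ι → ℝ} {s : Set ℝ} {x : ℝ} (hG : Summable G)
    (hs : ∀ᶠ y in 𝓝[s] x, Summable fun i => f i y) (hx : Summable fun i => f i x)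
    (hlip : ∀ᶠ y in 𝓝[s] x, ∀ i, |f i y - f i x| ≤ G i * |y - x|)
    (hd : ∀ i, HasDerivWithinAt (f i) (f' i) s x) :
    HasDerivWithinAt (fun y => ∑' i, f i y) (∑' i, f' i) s x := by
  rw [hasDerivWithinAt_iff_tendsto_slope]
  -- The Lipschitz bound says that the slopes are dominated by `G`, so dominated convergence applies
  -- to the difference quotients. Only differentiability at x is needed, which suits positive parts.
  have h1 : Tendsto (fun y => ∑' i, slope (f i) x y) (𝓝[s \ {x}] x) (𝓝 (∑' i, f' i)) := by
    refine tendsto_tsum_of_dominated_convergence hG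
      (fun i => hasDerivWithinAt_iff_tendsto_slope.1 (hd i)) ?_
    filter_upwards [nhdsWithin_mono _ Set.sdiff_subset hlip, self_mem_nhdsWithin] with y hy hyx i
    have : 0 < |y - x| := abs_pos.2 (sub_ne_zero.2 hyx.2)
    rw [slope_def_field, Real.norm_eq_abs, abs_div, div_le_iff₀ this]
    exact hy i
  refine h1.congr' ?_
  filter_upwards [nhdsWithin_mono _ Set.sdiff_subset hs] with y hy
  rw [slope_def_field, ← hy.tsum_sub hx, ← tsum_div_const]
  simp only [slope_def_field]

/-- Termwise differentiation under a summable bound of the derivatives. -/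
theorem hasDerivWithinAt_tsum_of_bound {ι : Type*} {f f' : ι → ℝ → ℝ} {G : ι → ℝ} {a T x : ℝ}
    (hG : Summable G) (hx : x ∈ Set.Ico a T)
    (hs : ∀ y ∈ Set.Icc a T, Summable fun i => f i y)
    (hd : ∀ i, ∀ y ∈ Set.Icc a T, HasDerivWithinAt (f i) (f' i y) (Set.Ici a) y)
    (hb : ∀ i, ∀ y ∈ Set.Icc a T, |f' i y| ≤ G i) :
    HasDerivWithinAt (fun y => ∑' i, f i y) (∑' i, f' i x) (Set.Ici a) x := by
  have hx' : x ∈ Set.Icc a T := ⟨hx.1, hx.2.le⟩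
  have hev : ∀ᶠ y in 𝓝[Set.Ici a] x, y ∈ Set.Icc a T := by
    filter_upwards [self_mem_nhdsWithin, nhdsWithin_le_nhds (Iio_mem_nhds hx.2)] with y h1 h2
    exact ⟨h1, h2.le⟩
  refine hasDerivWithinAt_tsum_of_lipschitz hG (hev.mono hs) (hs x hx') ?_ fun i => hd i x hx'
  filter_upwards [hev] with y hy i
  exact (convex_Icc a T).norm_image_sub_le_of_norm_hasDerivWithin_le
    (fun z hz => (hd i z hz).mono Set.Icc_subset_Ici_self) (hb i) hx' hy

/-- Damping does not increase the solution of a linear inhomogeneous equation. -/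
theorem abs_le_of_damped {f g h : ℝ → ℝ} {a T G κ : ℝ} (hG : 0 ≤ G)
    (hd : ∀ x ∈ Set.Icc a T, HasDerivWithinAt f (-h x * f x + g x) (Set.Ici a) x)
    (hh : ∀ x ∈ Set.Icc a T, 0 ≤ h x) (h0 : f a = 0)
    (hg : ∀ x ∈ Set.Icc a T, |g x| ≤ G * κ * Real.exp (κ * x)) :
    ∀ x ∈ Set.Icc a T, |f x| ≤ G * Real.exp (κ * x) := by
  have hB : ∀ x, HasDerivAt (fun x => G * Real.exp (κ * x)) (G * κ * Real.exp (κ * x)) x := by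
    intro x
    refine ((((hasDerivAt_id x).const_mul κ).exp).const_mul G).congr_deriv ?_
    simp only [mul_one, id]; ring
  have hcont : ContinuousOn f (Set.Icc a T) := fun x hx =>
    ((hd x hx).mono Set.Icc_subset_Ici_self).continuousWithinAt
  -- Compare |f| with its barrier. In the right derivative of |f| the damping has a favourable sign,
  -- so it is at most |g|, hence at most the derivative of the barrier.
  refine image_le_of_deriv_right_le_deriv_boundary hcont.abs
    (fun x hx => hasDerivWithinAt_abs
      ((hd x ⟨hx.1, hx.2.le⟩).mono (Set.Ici_subset_Ici.2 hx.1))) ?_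
    (fun x _ => (hB x).continuousAt.continuousWithinAt) (fun x _ => (hB x).hasDerivWithinAt) ?_
  · rw [h0, abs_zero]; positivity
  · intro x hx
    have hx' : x ∈ Set.Icc a T := ⟨hx.1, hx.2.le⟩
    refine le_trans ?_ (hg x hx')
    have h1 := le_abs_self (g x)
    have h2 := neg_abs_le (g x)
    split_ifs with h3 h4
    · nlinarith [hh x hx']
    · nlinarith [hh x hx']
    · have h5 : f x = 0 := le_antisymm (not_lt.1 h3) (not_lt.1 h4)
      simp [h5]

/-- Duhamel's formula for a scalar linear equation. -/
theorem hasDerivAt_duhamel {h g : ℝ → ℝ} (hh : Continuous h) (hg : Continuous g) (t s : ℝ) :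
    HasDerivAt (fun s => ∫ u in t..s, g u * Real.exp (-∫ v in u..s, h v))
      (-h s * (∫ u in t..s, g u * Real.exp (-∫ v in u..s, h v)) + g s) s := by
  -- Splitting the exponent as H s - H u pulls the upper limit s out of the integrand, leaving a
  -- product and the fundamental theorem of calculus.
  set H : ℝ → ℝ := fun s => ∫ v in t..s, h v with hH
  have hHd : ∀ s, HasDerivAt H (h s) s := fun s => hh.integral_hasStrictDerivAt t s |>.hasDerivAt
  have hHc : Continuous H := continuous_iff_continuousAt.2 fun s => (hHd s).continuousAt
  have key : ∀ s, (∫ u in t..s, g u * Real.exp (-∫ v in u..s, h v))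
      = Real.exp (-H s) * ∫ u in t..s, g u * Real.exp (H u) := by
    intro s
    rw [← intervalIntegral.integral_const_mul]
    refine intervalIntegral.integral_congr fun u _ => ?_
    have : (∫ v in u..s, h v) = H s - H u :=
      (intervalIntegral.integral_interval_sub_left (hh.intervalIntegrable _ _)
        (hh.intervalIntegrable _ _)).symm
    simp only [this]
    rw [mul_left_comm, ← Real.exp_add]
    congr 2; ring
  simp only [key]
  have h1 : HasDerivAt (fun s => ∫ u in t..s, g u * Real.exp (H u)) (g s * Real.exp (H s)) s :=
    ((hg.mul (Real.continuous_exp.comp hHc)).integral_hasStrictDerivAt t s).hasDerivAt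
  refine (((hHd s).neg.exp).mul h1).congr_deriv ?_
  have : Real.exp (-H s) * Real.exp (H s) = 1 := by rw [← Real.exp_add]; simp
  simp only [Pi.neg_apply]
  linear_combination (g s) * this

end NonlinearWalk

/-! ### The terms of the jump series. -/

namespace NonlinearWalk

variable {c α B X : ℝ} {β : ℤ → ℝ} {L M : ℝ → ℝ}

/-- The gain term of the Kolmogorov equations. -/
noncomputable def inflow (c : ℝ) (β : ℤ → ℝ) (L M : ℝ) (p : ℤ → ℝ) (n : ℤ) : ℝ :=
  p (n - 1) * rateUp c β L (n - 1) + p (n + 1) * rateDown c β M (n + 1)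

theorem kolmogorovRHS_eq (L M : ℝ) (p : ℤ → ℝ) (n : ℤ) :
    kolmogorovRHS c β L M p n
      = -(rateUp c β L n + rateDown c β M n) * p n + inflow c β L M p n := by
  unfold kolmogorovRHS inflow; ring

/-- The exponentials of `c L` and of `-c M` are bounded by `X` on `[a, T]`. -/
def RateBound (c X a T : ℝ) (L M : ℝ → ℝ) : Prop :=
  ∀ s ∈ Set.Icc a T, Real.exp (c * L s) ≤ X ∧ Real.exp (-c * M s) ≤ X

theorem exists_rateBound (hL : Continuous L) (hM : Continuous M) (c a T : ℝ) :
    ∃ X : ℝ, 0 < X ∧ RateBound c X a T L M := by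
  have h1 : Continuous fun s => Real.exp (c * L s) + Real.exp (-c * M s) := by fun_prop
  obtain ⟨X, hX⟩ := (isCompact_Icc (a := a) (b := T)).bddAbove_image h1.continuousOn
  refine ⟨max X 1, by positivity, fun s hs => ?_⟩
  have := hX (Set.mem_image_of_mem _ hs)
  have h2 := Real.exp_pos (c * L s)
  have h3 := Real.exp_pos (-c * M s)
  have h4 := le_max_left X 1
  constructor <;> linarith

/-- The growth rate of the weighted norm. -/
noncomputable def growth (c α B X : ℝ) : ℝ := 2 * (offDiagConst c α B * X)

theorem offDiagConst_nonneg (hβ : ∀ n, 0 < β n) (hB : ∀ n, β n ≤ B) :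
    0 ≤ offDiagConst c α B :=
  mul_nonneg ((hβ 0).le.trans (hB 0)) (Real.exp_pos _).le

theorem rateUp_weight_le (hβ : ∀ n, 0 < β n) (hB : ∀ n, β n ≤ B) {l : ℝ}
    (hX : Real.exp (c * l) ≤ X) (n : ℤ) :
    rateUp c β l (n - 1) * weight c α n ≤ offDiagConst c α B * X * weight c α (n - 1) := by
  rw [rateUp_eq, mul_assoc]
  have h1 := rateUp_mul_weight_le (c := c) (α := α) hβ hB n
  calc _ ≤ Real.exp (c * l) * (offDiagConst c α B * weight c α (n - 1)) := by gcongr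
    _ ≤ X * (offDiagConst c α B * weight c α (n - 1)) :=
      mul_le_mul_of_nonneg_right hX
        (mul_nonneg (offDiagConst_nonneg hβ hB) (weight_pos _ _ _).le)
    _ = _ := by ring

theorem rateDown_weight_le (hβ : ∀ n, 0 < β n) (hB : ∀ n, β n ≤ B) {m : ℝ}
    (hX : Real.exp (-c * m) ≤ X) (n : ℤ) :
    rateDown c β m (n + 1) * weight c α n ≤ offDiagConst c α B * X * weight c α (n + 1) := by
  rw [rateDown_eq, mul_assoc]
  have h1 := rateDown_mul_weight_le (c := c) (α := α) hβ hB n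
  calc _ ≤ Real.exp (-c * m) * (offDiagConst c α B * weight c α (n + 1)) := by gcongr
    _ ≤ X * (offDiagConst c α B * weight c α (n + 1)) :=
      mul_le_mul_of_nonneg_right hX
        (mul_nonneg (offDiagConst_nonneg hβ hB) (weight_pos _ _ _).le)
    _ = _ := by ring

theorem inflow_nonneg (hβ : ∀ n, 0 < β n) {l m : ℝ} {p : ℤ → ℝ} (hp : ∀ n, 0 ≤ p n) (n : ℤ) :
    0 ≤ inflow c β l m p n :=
  add_nonneg (mul_nonneg (hp _) (rateUp_pos hβ _ _).le)
    (mul_nonneg (hp _) (rateDown_pos hβ _ _).le)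

/-- The gain term is bounded in the weighted supremum norm. -/
theorem abs_inflow_mul_weight_le (hβ : ∀ n, 0 < β n) (hB : ∀ n, β n ≤ B) {l m : ℝ}
    (hl : Real.exp (c * l) ≤ X) (hm : Real.exp (-c * m) ≤ X) {p : ℤ → ℝ} {b : ℝ}
    (hp : ∀ n, |p n| * weight c α n ≤ b) (n : ℤ) :
    |inflow c β l m p n| * weight c α n ≤ growth c α B X * b := by
  have hX : 0 ≤ X := (Real.exp_pos _).le.trans hl
  have hK := offDiagConst_nonneg (c := c) (α := α) hβ hB
  have h1 := rateUp_weight_le (α := α) hβ hB hl n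
  have h2 := rateDown_weight_le (α := α) hβ hB hm n
  have hw := weight_pos c α n
  calc |inflow c β l m p n| * weight c α n
      ≤ (|p (n - 1)| * rateUp c β l (n - 1) + |p (n + 1)| * rateDown c β m (n + 1))
        * weight c α n := by
        gcongr
        refine (abs_add_le _ _).trans (le_of_eq ?_)
        rw [abs_mul, abs_mul, abs_of_pos (rateUp_pos hβ _ _), abs_of_pos (rateDown_pos hβ _ _)]
    _ = |p (n - 1)| * (rateUp c β l (n - 1) * weight c α n)
        + |p (n + 1)| * (rateDown c β m (n + 1) * weight c α n) := by ring
    _ ≤ |p (n - 1)| * (offDiagConst c α B * X * weight c α (n - 1))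
        + |p (n + 1)| * (offDiagConst c α B * X * weight c α (n + 1)) := by gcongr
    _ = offDiagConst c α B * X * (|p (n - 1)| * weight c α (n - 1))
        + offDiagConst c α B * X * (|p (n + 1)| * weight c α (n + 1)) := by ring
    _ ≤ offDiagConst c α B * X * b + offDiagConst c α B * X * b := by
        gcongr
        · exact hp _
        · exact hp _
    _ = _ := by unfold growth; ring

/-- The gain term is bounded in the weighted `ℓ¹` norm. -/
theorem sum_inflow_mul_weight_le (hβ : ∀ n, 0 < β n) (hB : ∀ n, β n ≤ B) {l m : ℝ}
    (hl : Real.exp (c * l) ≤ X) (hm : Real.exp (-c * m) ≤ X) {p : ℤ → ℝ} {b : ℝ}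
    (hp0 : ∀ n, 0 ≤ p n) (hp : ∀ F : Finset ℤ, ∑ n ∈ F, p n * weight c α n ≤ b)
    (F : Finset ℤ) :
    ∑ n ∈ F, inflow c β l m p n * weight c α n ≤ growth c α B X * b := by
  have hX : 0 ≤ X := (Real.exp_pos _).le.trans hl
  have hK := offDiagConst_nonneg (c := c) (α := α) hβ hB
  -- The bound is assumed for all finite sets, so a translate of `F` is as good as `F`; no
  -- summability has to be known at this stage.
  have e1 : ∑ n ∈ F, p (n - 1) * weight c α (n - 1) ≤ b := by
    simpa using hp (F.map (Equiv.subRight (1 : ℤ)).toEmbedding)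
  have e2 : ∑ n ∈ F, p (n + 1) * weight c α (n + 1) ≤ b := by
    simpa using hp (F.map (Equiv.addRight (1 : ℤ)).toEmbedding)
  calc ∑ n ∈ F, inflow c β l m p n * weight c α n
      ≤ ∑ n ∈ F, (offDiagConst c α B * X * (p (n - 1) * weight c α (n - 1))
        + offDiagConst c α B * X * (p (n + 1) * weight c α (n + 1))) := by
        refine Finset.sum_le_sum fun n _ => ?_
        have h1 := mul_le_mul_of_nonneg_left (rateUp_weight_le (α := α) hβ hB hl n) (hp0 (n - 1))
        have h2 := mul_le_mul_of_nonneg_left (rateDown_weight_le (α := α) hβ hB hm n) (hp0 (n + 1))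
        unfold inflow
        linarith
    _ = offDiagConst c α B * X * (∑ n ∈ F, p (n - 1) * weight c α (n - 1))
        + offDiagConst c α B * X * (∑ n ∈ F, p (n + 1) * weight c α (n + 1)) := by
        rw [Finset.sum_add_distrib, Finset.mul_sum, Finset.mul_sum]
    _ ≤ offDiagConst c α B * X * b + offDiagConst c α B * X * b := by gcongr
    _ = _ := by unfold growth; ring

theorem continuous_totalRate (hL : Continuous L) (hM : Continuous M) (n : ℤ) :
    Continuous fun u => rateUp c β (L u) n + rateDown c β (M u) n :=
  (continuous_rateUp hL n).add (continuous_rateDown hM n)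

theorem holdProb_pos (n : ℤ) (t s : ℝ) : 0 < holdProb c β L M n t s := Real.exp_pos _

theorem holdProb_le_one (hβ : ∀ n, 0 < β n) (n : ℤ) {t s : ℝ} (hts : t ≤ s) :
    holdProb c β L M n t s ≤ 1 := by
  unfold holdProb
  rw [Real.exp_le_one_iff, neg_nonpos]
  exact intervalIntegral.integral_nonneg hts fun u _ =>
    (add_pos (rateUp_pos hβ _ _) (rateDown_pos hβ _ _)).le

theorem hasDerivAt_jumpTerm_zero (hL : Continuous L) (hM : Continuous M) (m : ℤ) (t : ℝ)
    (n : ℤ) (s : ℝ) :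
    HasDerivAt (fun s => jumpTerm c β L M 0 m t n s)
      (-(rateUp c β (L s) n + rateDown c β (M s) n) * jumpTerm c β L M 0 m t n s) s := by
  simp only [jumpTerm]
  split_ifs with h
  · have h1 := ((continuous_totalRate (c := c) (β := β) hL hM n).integral_hasStrictDerivAt
      t s).hasDerivAt
    refine h1.neg.exp.congr_deriv ?_
    simp only [holdProb, Pi.neg_apply]
    ring
  · simpa using hasDerivAt_const s (0 : ℝ)

/-- Duhamel's formula for the recursion. Continuity of the preceding terms is a hypothesis so that
the induction proving continuity can use it. -/
theorem hasDerivAt_jumpTerm_succ_of_continuous (hL : Continuous L) (hM : Continuous M)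
    {k : ℕ} {m : ℤ} {t : ℝ} (hk : ∀ n, Continuous fun s => jumpTerm c β L M k m t n s)
    (n : ℤ) (s : ℝ) :
    HasDerivAt (fun s => jumpTerm c β L M (k + 1) m t n s)
      (-(rateUp c β (L s) n + rateDown c β (M s) n) * jumpTerm c β L M (k + 1) m t n s
        + inflow c β (L s) (M s) (fun n => jumpTerm c β L M k m t n s) n) s := by
  have hg : Continuous fun u => inflow c β (L u) (M u) (fun n => jumpTerm c β L M k m t n u) n :=
    ((hk _).mul (continuous_rateUp hL _)).add ((hk _).mul (continuous_rateDown hM _))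
  exact hasDerivAt_duhamel (continuous_totalRate hL hM n) hg t s

theorem continuous_jumpTerm (hL : Continuous L) (hM : Continuous M) (k : ℕ) (m : ℤ) (t : ℝ)
    (n : ℤ) : Continuous fun s => jumpTerm c β L M k m t n s := by
  induction k generalizing n with
  | zero => exact continuous_iff_continuousAt.2 fun s =>
      (hasDerivAt_jumpTerm_zero hL hM m t n s).continuousAt
  | succ k ih => exact continuous_iff_continuousAt.2 fun s =>
      (hasDerivAt_jumpTerm_succ_of_continuous hL hM ih n s).continuousAt

theorem hasDerivAt_jumpTerm_succ (hL : Continuous L) (hM : Continuous M)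
    (k : ℕ) (m : ℤ) (t : ℝ) (n : ℤ) (s : ℝ) :
    HasDerivAt (fun s => jumpTerm c β L M (k + 1) m t n s)
      (-(rateUp c β (L s) n + rateDown c β (M s) n) * jumpTerm c β L M (k + 1) m t n s
        + inflow c β (L s) (M s) (fun n => jumpTerm c β L M k m t n s) n) s :=
  hasDerivAt_jumpTerm_succ_of_continuous hL hM (continuous_jumpTerm hL hM k m t) n s

theorem jumpTerm_nonneg (hβ : ∀ n, 0 < β n) (k : ℕ) (m : ℤ) {t : ℝ} (n : ℤ) {s : ℝ}
    (hts : t ≤ s) : 0 ≤ jumpTerm c β L M k m t n s := by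
  induction k generalizing n s with
  | zero =>
    simp only [jumpTerm]
    split_ifs
    · exact (holdProb_pos _ _ _).le
    · exact le_rfl
  | succ k ih =>
    simp only [jumpTerm]
    refine intervalIntegral.integral_nonneg hts fun u hu => ?_
    exact mul_nonneg (add_nonneg (mul_nonneg (ih _ hu.1) (rateUp_pos hβ _ _).le)
      (mul_nonneg (ih _ hu.1) (rateDown_pos hβ _ _).le)) (holdProb_pos _ _ _).le

theorem jumpTerm_self (k : ℕ) (m : ℤ) (t : ℝ) (n : ℤ) :
    jumpTerm c β L M k m t n t = if k = 0 ∧ n = m then 1 else 0 := by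
  cases k <;> simp [jumpTerm, holdProb]

theorem continuous_holdProb (hL : Continuous L) (hM : Continuous M) (n : ℤ) (s : ℝ) :
    Continuous fun u => holdProb c β L M n u s := by
  have h := continuous_totalRate (c := c) (β := β) hL hM n
  have h1 : Continuous fun u => ∫ v in s..u, (rateUp c β (L v) n + rateDown c β (M v) n) :=
    continuous_iff_continuousAt.2 fun u =>
      (h.integral_hasStrictDerivAt s u).hasDerivAt.continuousAt
  unfold holdProb
  refine Real.continuous_exp.comp ?_
  simpa only [← intervalIntegral.integral_symm] using h1

/-- The `k`-th term of the series in the weighted `ℓ¹` norm. -/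
theorem sum_jumpTerm_mul_weight_le (hβ : ∀ n, 0 < β n) (hB : ∀ n, β n ≤ B)
    (hL : Continuous L) (hM : Continuous M) {t T : ℝ} (hX : RateBound c X t T L M)
    (k : ℕ) (m : ℤ) {s : ℝ} (hs : s ∈ Set.Icc t T) (F : Finset ℤ) :
    ∑ n ∈ F, jumpTerm c β L M k m t n s * weight c α n
      ≤ weight c α m * ((growth c α B X * (s - t)) ^ k / k.factorial) := by
  induction k generalizing s F with
  | zero =>
    simp only [jumpTerm, pow_zero, Nat.factorial_zero, Nat.cast_one, div_one, mul_one, ite_mul,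
      zero_mul]
    rw [Finset.sum_ite_eq']
    split_ifs
    · exact mul_le_of_le_one_left (weight_pos _ _ _).le (holdProb_le_one hβ _ hs.1)
    · exact (weight_pos _ _ _).le
  | succ k ih =>
    have hcont : ∀ n, Continuous fun u => inflow c β (L u) (M u)
        (fun n => jumpTerm c β L M k m t n u) n := fun n =>
      ((continuous_jumpTerm hL hM k m t _).mul (continuous_rateUp hL _)).add
        ((continuous_jumpTerm hL hM k m t _).mul (continuous_rateDown hM _))
    have e1 : ∑ n ∈ F, jumpTerm c β L M (k + 1) m t n s * weight c α n
        = ∫ u in t..s, ∑ n ∈ F, inflow c β (L u) (M u) (fun n => jumpTerm c β L M k m t n u) n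
            * holdProb c β L M n u s * weight c α n := by
      rw [intervalIntegral.integral_finsetSum]
      · refine Finset.sum_congr rfl fun n _ => ?_
        rw [intervalIntegral.integral_mul_const]
        rfl
      · intro n _
        exact (((hcont n).mul (continuous_holdProb hL hM n s)).mul
          continuous_const).intervalIntegrable _ _
    rw [e1]
    set K := growth c α B X with hK
    -- A jump multiplies the weighted norm by at most `K` and waiting does not increase it;
    -- integrating the time of the last jump turns the k-th power over k! into the next one.
    calc _ ≤ ∫ u in t..s, K * (weight c α m * ((K * (u - t)) ^ k / k.factorial)) := by
          refine intervalIntegral.integral_mono_on hs.1 ?_ ?_ ?_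
          · exact (continuous_finsetSum _ fun n _ => ((hcont n).mul
              (continuous_holdProb hL hM n s)).mul continuous_const).intervalIntegrable _ _
          · exact Continuous.intervalIntegrable (by fun_prop) _ _
          · intro u hu
            have hu' : u ∈ Set.Icc t T := ⟨hu.1, hu.2.trans hs.2⟩
            have h1 := sum_inflow_mul_weight_le hβ hB (hX u hu').1 (hX u hu').2
              (fun n => jumpTerm_nonneg hβ k m n hu.1) (fun F => ih hu' F) F
            refine le_trans (Finset.sum_le_sum fun n _ => ?_) h1
            refine mul_le_mul_of_nonneg_right ?_ (weight_pos _ _ _).le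
            exact mul_le_of_le_one_right
              (inflow_nonneg hβ (fun n => jumpTerm_nonneg hβ k m n hu.1) n)
              (holdProb_le_one hβ _ hu.2)
      _ = weight c α m * ((K * (s - t)) ^ (k + 1) / (k + 1).factorial) := by
          have e2 : ∀ u, K * (weight c α m * ((K * (u - t)) ^ k / k.factorial))
              = (K ^ (k + 1) * weight c α m / k.factorial) * (u - t) ^ k := by
            intro u; rw [mul_pow]; ring
          simp only [e2]
          rw [intervalIntegral.integral_const_mul,
            intervalIntegral.integral_comp_sub_right (fun x => x ^ k) t, integral_pow,
            Nat.factorial_succ, sub_self, zero_pow (Nat.succ_ne_zero k), sub_zero, mul_pow]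
          push_cast
          field_simp

end NonlinearWalk

/-! ### The transition kernel and its flow on B. -/

namespace NonlinearWalk

variable {c α B X : ℝ} {β : ℤ → ℝ} {L M : ℝ → ℝ}

theorem growth_nonneg (hβ : ∀ n, 0 < β n) (hB : ∀ n, β n ≤ B) (hX : 0 ≤ X) :
    0 ≤ growth c α B X :=
  mul_nonneg two_pos.le (mul_nonneg (offDiagConst_nonneg hβ hB) hX)

theorem hasSum_pow_div_factorial (x : ℝ) :
    HasSum (fun k : ℕ => x ^ k / k.factorial) (Real.exp x) := by
  rw [Real.exp_eq_exp_ℝ]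
  exact NormedSpace.expSeries_div_hasSum_exp x

theorem RateBound.nonneg {a T : ℝ} (h : RateBound c X a T L M) (haT : a ≤ T) : 0 ≤ X :=
  (Real.exp_pos _).le.trans (h a ⟨le_rfl, haT⟩).1

theorem jumpTerm_mul_weight_le (hβ : ∀ n, 0 < β n) (hB : ∀ n, β n ≤ B)
    (hL : Continuous L) (hM : Continuous M) {t T : ℝ} (hX : RateBound c X t T L M)
    (k : ℕ) (m n : ℤ) {s : ℝ} (hs : s ∈ Set.Icc t T) :
    jumpTerm c β L M k m t n s * weight c α n
      ≤ weight c α m * ((growth c α B X * (T - t)) ^ k / k.factorial) := by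
  have h1 := sum_jumpTerm_mul_weight_le (α := α) hβ hB hL hM hX k m hs {n}
  rw [Finset.sum_singleton] at h1
  have hK := growth_nonneg (c := c) (α := α) hβ hB (hX.nonneg (hs.1.trans hs.2))
  have := weight_pos c α m
  have h2 : 0 ≤ s - t := sub_nonneg.2 hs.1
  refine h1.trans ?_
  gcongr
  exact hs.2

theorem summable_jumpTerm (hβ : ∀ n, 0 < β n) (hB : ∀ n, β n ≤ B)
    (hL : Continuous L) (hM : Continuous M) (m n : ℤ) {t s : ℝ} (hts : t ≤ s) :
    Summable fun k => jumpTerm c β L M k m t n s := by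
  obtain ⟨X, hX0, hX⟩ := exists_rateBound hL hM c t s
  have hw := weight_pos c 0 n
  refine Summable.of_nonneg_of_le (fun k => jumpTerm_nonneg hβ k m n hts) (fun k => ?_)
    ((Real.summable_pow_div_factorial (growth c 0 B X * (s - t))).mul_left
      (weight c 0 m / weight c 0 n))
  have h1 := jumpTerm_mul_weight_le (α := 0) hβ hB hL hM hX k m n ⟨hts, le_rfl⟩
  rw [div_mul_eq_mul_div, le_div_iff₀ hw]
  exact h1

theorem transitionProb_nonneg (hβ : ∀ n, 0 < β n) (n m : ℤ) {t s : ℝ} (hts : t ≤ s) :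
    0 ≤ transitionProb c β L M n s m t :=
  tsum_nonneg fun k => jumpTerm_nonneg hβ k m n hts

theorem transitionProb_self (n m : ℤ) (t : ℝ) :
    transitionProb c β L M n t m t = if n = m then 1 else 0 := by
  unfold transitionProb
  simp only [jumpTerm_self]
  rw [tsum_eq_single 0]
  · simp
  · intro k hk; simp [hk]

/-- The transition kernel in the weighted `ℓ¹` norm. -/
theorem sum_transitionProb_mul_weight_le (hβ : ∀ n, 0 < β n) (hB : ∀ n, β n ≤ B)
    (hL : Continuous L) (hM : Continuous M) {t T : ℝ} (hX : RateBound c X t T L M)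
    (m : ℤ) {s : ℝ} (hs : s ∈ Set.Icc t T) (F : Finset ℤ) :
    ∑ n ∈ F, transitionProb c β L M n s m t * weight c α n
      ≤ weight c α m * Real.exp (growth c α B X * (T - t)) := by
  have hsum : ∀ n, Summable fun k => jumpTerm c β L M k m t n s * weight c α n :=
    fun n => (summable_jumpTerm hβ hB hL hM m n hs.1).mul_right _
  have e1 : ∑ n ∈ F, transitionProb c β L M n s m t * weight c α n
      = ∑' k, ∑ n ∈ F, jumpTerm c β L M k m t n s * weight c α n := by
    rw [Summable.tsum_finsetSum fun n _ => hsum n]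
    refine Finset.sum_congr rfl fun n _ => ?_
    rw [tsum_mul_right]; rfl
  have hexp : HasSum (fun k : ℕ => weight c α m * ((growth c α B X * (T - t)) ^ k / k.factorial))
      (weight c α m * Real.exp (growth c α B X * (T - t))) :=
    (hasSum_pow_div_factorial _).mul_left _
  rw [e1, ← hexp.tsum_eq]
  refine Summable.tsum_le_tsum (fun k => ?_) (summable_sum fun n _ => hsum n) hexp.summable
  refine (sum_jumpTerm_mul_weight_le hβ hB hL hM hX k m hs F).trans ?_
  have hK := growth_nonneg (c := c) (α := α) hβ hB (hX.nonneg (hs.1.trans hs.2))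
  have := weight_pos c α m
  have h2 : 0 ≤ s - t := sub_nonneg.2 hs.1
  gcongr
  exact hs.2

theorem transitionProb_mul_weight_le (hβ : ∀ n, 0 < β n) (hB : ∀ n, β n ≤ B)
    (hL : Continuous L) (hM : Continuous M) {t T : ℝ} (hX : RateBound c X t T L M)
    (m n : ℤ) {s : ℝ} (hs : s ∈ Set.Icc t T) :
    transitionProb c β L M n s m t * weight c α n
      ≤ weight c α m * Real.exp (growth c α B X * (T - t)) := by
  simpa using sum_transitionProb_mul_weight_le (α := α) hβ hB hL hM hX m hs {n}

/-- `p` solves the forward Kolmogorov equations on `[a, ∞)`. -/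
def IsForward (c : ℝ) (β : ℤ → ℝ) (L M : ℝ → ℝ) (a : ℝ) (p : ℝ → ℤ → ℝ) : Prop :=
  ∀ s, a ≤ s → ∀ n, HasDerivWithinAt (fun u => p u n)
    (kolmogorovRHS c β (L s) (M s) (p s) n) (Set.Ici a) s

theorem rateUp_le (hβ : ∀ n, 0 < β n) {l : ℝ} (hl : Real.exp (c * l) ≤ X) (n : ℤ) :
    rateUp c β l n ≤ X * rateUp c β 0 n := by
  rw [rateUp_eq]
  exact mul_le_mul_of_nonneg_right hl (rateUp_pos hβ _ _).le

theorem rateDown_le (hβ : ∀ n, 0 < β n) {m : ℝ} (hm : Real.exp (-c * m) ≤ X) (n : ℤ) :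
    rateDown c β m n ≤ X * rateDown c β 0 n := by
  rw [rateDown_eq]
  exact mul_le_mul_of_nonneg_right hm (rateDown_pos hβ _ _).le

/-- A bound for the components of the right-hand side of the Kolmogorov equations. -/
noncomputable def rhsConst (c α B X : ℝ) (β : ℤ → ℝ) (n : ℤ) : ℝ :=
  X * (rateUp c β 0 n + rateDown c β 0 n) + growth c α B X

theorem abs_kolmogorovRHS_mul_weight_le (hβ : ∀ n, 0 < β n) (hB : ∀ n, β n ≤ B) {l m : ℝ}
    (hl : Real.exp (c * l) ≤ X) (hm : Real.exp (-c * m) ≤ X) {p : ℤ → ℝ} {b : ℝ}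
    (hp : ∀ n, |p n| * weight c α n ≤ b) (n : ℤ) :
    |kolmogorovRHS c β l m p n| * weight c α n ≤ rhsConst c α B X β n * b := by
  rw [kolmogorovRHS_eq]
  have h1 := abs_inflow_mul_weight_le (α := α) hβ hB hl hm hp n
  have hw := weight_pos c α n
  have ha := rateUp_pos (c := c) hβ l n
  have hb := rateDown_pos (c := c) hβ m n
  have h2 : |-(rateUp c β l n + rateDown c β m n) * p n| * weight c α n
      ≤ X * (rateUp c β 0 n + rateDown c β 0 n) * b := by
    rw [abs_mul, abs_neg, abs_of_pos (add_pos ha hb), mul_assoc]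
    have h3 := rateUp_le hβ hl n
    have h4 := rateDown_le hβ hm n
    refine mul_le_mul (by linarith) (hp n) (by positivity) (by linarith)
  calc _ ≤ (|-(rateUp c β l n + rateDown c β m n) * p n| + |inflow c β l m p n|)
        * weight c α n := by
        gcongr; exact abs_add_le _ _
    _ ≤ _ := by unfold rhsConst; linarith

/-- The transition kernel solves the forward Kolmogorov equations. -/
theorem isForward_transitionProb (hβ : ∀ n, 0 < β n) (hB : ∀ n, β n ≤ B)
    (hL : Continuous L) (hM : Continuous M) (m : ℤ) (t : ℝ) :
    IsForward c β L M t (fun s n => transitionProb c β L M n s m t) := by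
  intro s hts n
  obtain ⟨X, hX0, hX⟩ := exists_rateBound hL hM c t (s + 1)
  set K := growth c 0 B X with hKdef
  set w : ℤ → ℝ := weight c 0
  have hw : ∀ n, 0 < w n := weight_pos c 0
  have hK : 0 ≤ K := growth_nonneg hβ hB hX0.le
  set E : ℕ → ℝ := fun k => w m * ((K * (s + 1 - t)) ^ k / k.factorial) with hE
  have hEsum : Summable E := (Real.summable_pow_div_factorial _).mul_left _
  have hJ : ∀ k n, ∀ y ∈ Set.Icc t (s + 1), |jumpTerm c β L M k m t n y| * w n ≤ E k := by
    intro k n y hy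
    rw [abs_of_nonneg (jumpTerm_nonneg hβ k m n hy.1)]
    exact jumpTerm_mul_weight_le hβ hB hL hM hX k m n hy
  -- The term without jumps receives no inflow and every other term is fed by its predecessor.
  -- Summing over k shifts the index by one and reassembles the full gain term.
  let f' : ℕ → ℝ → ℝ := fun k y =>
    -(rateUp c β (L y) n + rateDown c β (M y) n) * jumpTerm c β L M k m t n y
      + match k with
        | 0 => 0
        | k + 1 => inflow c β (L y) (M y) (fun n => jumpTerm c β L M k m t n y) n
  let G : ℕ → ℝ := fun k => X * (rateUp c β 0 n + rateDown c β 0 n) * E k / w n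
      + match k with
        | 0 => 0
        | k + 1 => K * E k / w n
  have hGsum : Summable G := by
    refine ((hEsum.mul_left _).div_const _).add ?_
    refine (summable_nat_add_iff 1).1 ?_
    exact (hEsum.mul_left _).div_const _
  have hmain := hasDerivWithinAt_tsum_of_bound (f := fun k y => jumpTerm c β L M k m t n y)
    (f' := f') (G := G) (a := t) (T := s + 1) (x := s) hGsum ⟨hts, by linarith⟩
    (fun y hy => summable_jumpTerm hβ hB hL hM m n hy.1) ?_ ?_
  · refine hmain.congr_deriv ?_
    have hs1 : ∀ n, Summable fun k => jumpTerm c β L M k m t n s :=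
      fun n => summable_jumpTerm hβ hB hL hM m n hts
    have hin : HasSum (fun k => inflow c β (L s) (M s) (fun n => jumpTerm c β L M k m t n s) n)
        (inflow c β (L s) (M s) (fun n => transitionProb c β L M n s m t) n) :=
      ((hs1 (n - 1)).hasSum.mul_right _).add ((hs1 (n + 1)).hasSum.mul_right _)
    have hin' : HasSum (fun k : ℕ => (match k with
        | 0 => 0
        | k + 1 => inflow c β (L s) (M s) (fun n => jumpTerm c β L M k m t n s) n : ℝ))
        (inflow c β (L s) (M s) (fun n => transitionProb c β L M n s m t) n) := by
      rw [← hasSum_nat_add_iff' 1]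
      simpa using hin
    rw [kolmogorovRHS_eq]
    exact (((hs1 n).hasSum.mul_left _).add hin').tsum_eq
  · intro k y _
    cases k with
    | zero => simpa [f'] using (hasDerivAt_jumpTerm_zero hL hM m t n y).hasDerivWithinAt
    | succ k => exact (hasDerivAt_jumpTerm_succ hL hM k m t n y).hasDerivWithinAt
  · intro k y hy
    have ha := rateUp_pos (c := c) hβ (L y) n
    have hb := rateDown_pos (c := c) hβ (M y) n
    have h1 : |-(rateUp c β (L y) n + rateDown c β (M y) n) * jumpTerm c β L M k m t n y|
        ≤ X * (rateUp c β 0 n + rateDown c β 0 n) * E k / w n := by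
      rw [le_div_iff₀ (hw n), abs_mul, abs_neg, abs_of_pos (add_pos ha hb), mul_assoc]
      have h3 := rateUp_le hβ (hX y hy).1 n
      have h4 := rateDown_le hβ (hX y hy).2 n
      exact mul_le_mul (by linarith) (hJ k n y hy) (mul_nonneg (abs_nonneg _) (hw n).le)
        (by linarith)
    refine (abs_add_le _ _).trans (add_le_add h1 ?_)
    cases k with
    | zero => simp
    | succ k =>
      dsimp only
      rw [le_div_iff₀ (hw n)]
      exact abs_inflow_mul_weight_le hβ hB (hX y hy).1 (hX y hy).2 (fun n => hJ k n y hy) n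

/-- The evolution of the initial vector `q` given at the time `t`. -/
noncomputable def flow (c : ℝ) (β : ℤ → ℝ) (L M : ℝ → ℝ) (q : ℤ → ℝ) (t s : ℝ) (n : ℤ) : ℝ :=
  ∑' m, q m * transitionProb c β L M n s m t

section flow

variable {q : ℤ → ℝ}

theorem summable_flow (hβ : ∀ n, 0 < β n) (hB : ∀ n, β n ≤ B)
    (hL : Continuous L) (hM : Continuous M) (hq : MemB c α q) (n : ℤ) {t s : ℝ} (hts : t ≤ s) :
    Summable fun m => q m * transitionProb c β L M n s m t := by
  obtain ⟨X, hX0, hX⟩ := exists_rateBound hL hM c t s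
  refine Summable.of_norm_bounded
    (g := fun m => |q m| * weight c α m
      * (Real.exp (growth c α B X * (s - t)) / weight c α n)) (hq.mul_right _) fun m => ?_
  rw [Real.norm_eq_abs, abs_mul, abs_of_nonneg (transitionProb_nonneg hβ n m hts), mul_assoc]
  refine mul_le_mul_of_nonneg_left ?_ (abs_nonneg _)
  rw [mul_div_assoc', le_div_iff₀ (weight_pos _ _ _)]
  exact transitionProb_mul_weight_le hβ hB hL hM hX m n ⟨hts, le_rfl⟩

theorem flow_self (q : ℤ → ℝ) (t : ℝ) (n : ℤ) : flow c β L M q t t n = q n := by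
  unfold flow
  simp only [transitionProb_self]
  rw [tsum_eq_single n]
  · simp
  · intro m hm; simp [hm.symm]

theorem flow_nonneg (hβ : ∀ n, 0 < β n) (hq0 : ∀ n, 0 ≤ q n) {t s : ℝ} (hts : t ≤ s) (n : ℤ) :
    0 ≤ flow c β L M q t s n :=
  tsum_nonneg fun m => mul_nonneg (hq0 m) (transitionProb_nonneg hβ n m hts)

/-- Superposition of the kernels over the starting point. The kernel from m costs at most a multiple
of the weight of m, and membership of `q` in B makes these costs summable, which justifies termwise
differentiation. -/
theorem isForward_flow (hβ : ∀ n, 0 < β n) (hB : ∀ n, β n ≤ B)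
    (hL : Continuous L) (hM : Continuous M) (hq : MemB c α q) (t : ℝ) :
    IsForward c β L M t (flow c β L M q t) := by
  intro s hts n
  obtain ⟨X, hX0, hX⟩ := exists_rateBound hL hM c t (s + 1)
  set e := Real.exp (growth c α B X * (s + 1 - t))
  have hmain := hasDerivWithinAt_tsum_of_bound
    (f := fun m y => q m * transitionProb c β L M n y m t)
    (f' := fun m y => q m * kolmogorovRHS c β (L y) (M y)
      (fun n => transitionProb c β L M n y m t) n)
    (G := fun m => |q m| * weight c α m * (rhsConst c α B X β n * e / weight c α n))
    (a := t) (T := s + 1) (x := s) (hq.mul_right _) ⟨hts, by linarith⟩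
    (fun y hy => summable_flow hβ hB hL hM hq n hy.1)
    (fun m y hy => (isForward_transitionProb hβ hB hL hM m t y hy.1 n).const_mul _) ?_
  · refine hmain.congr_deriv ?_
    have hs1 : ∀ n, HasSum (fun m => q m * transitionProb c β L M n s m t)
      (flow c β L M q t s n) := fun n => (summable_flow hβ hB hL hM hq n hts).hasSum
    refine HasSum.tsum_eq ?_
    refine ((((hs1 (n - 1)).mul_left (rateUp c β (L s) (n - 1))).sub
      ((hs1 n).mul_left (rateUp c β (L s) n + rateDown c β (M s) n))).add
      ((hs1 (n + 1)).mul_left (rateDown c β (M s) (n + 1)))).congr_fun ?_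
    intro m
    unfold kolmogorovRHS
    ring
  · intro m y hy
    rw [abs_mul, mul_assoc]
    refine mul_le_mul_of_nonneg_left ?_ (abs_nonneg _)
    rw [mul_div_assoc', le_div_iff₀ (weight_pos _ _ _)]
    have := abs_kolmogorovRHS_mul_weight_le (α := α) (b := weight c α m * e) hβ hB (hX y hy).1 (hX y hy).2
      (p := fun n => transitionProb c β L M n y m t) (fun n => by
        rw [abs_of_nonneg (transitionProb_nonneg hβ n m hy.1)]
        exact transitionProb_mul_weight_le hβ hB hL hM hX m n hy) n
    linarith

/-- The flow in the weighted `ℓ¹` norm. -/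
theorem sum_flow_mul_weight_le (hβ : ∀ n, 0 < β n) (hB : ∀ n, β n ≤ B)
    (hL : Continuous L) (hM : Continuous M) (hq0 : ∀ n, 0 ≤ q n) (hq : MemB c α q)
    {t T : ℝ} (hX : RateBound c X t T L M) {s : ℝ} (hs : s ∈ Set.Icc t T) (F : Finset ℤ) :
    ∑ n ∈ F, flow c β L M q t s n * weight c α n
      ≤ normB c α q * Real.exp (growth c α B X * (T - t)) := by
  have hsum : ∀ n, Summable fun m => q m * transitionProb c β L M n s m t * weight c α n :=
    fun n => (summable_flow hβ hB hL hM hq n hs.1).mul_right _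
  have e1 : ∑ n ∈ F, flow c β L M q t s n * weight c α n
      = ∑' m, ∑ n ∈ F, q m * transitionProb c β L M n s m t * weight c α n := by
    rw [Summable.tsum_finsetSum fun n _ => hsum n]
    refine Finset.sum_congr rfl fun n _ => ?_
    rw [tsum_mul_right]; rfl
  rw [e1, normB, ← tsum_mul_right]
  refine Summable.tsum_le_tsum (fun m => ?_) (summable_sum fun n _ => hsum n) (hq.mul_right _)
  have h1 := sum_transitionProb_mul_weight_le (α := α) hβ hB hL hM hX m hs F
  calc ∑ n ∈ F, q m * transitionProb c β L M n s m t * weight c α n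
      = q m * ∑ n ∈ F, transitionProb c β L M n s m t * weight c α n := by
        rw [Finset.mul_sum]; exact Finset.sum_congr rfl fun n _ => mul_assoc _ _ _
    _ ≤ q m * (weight c α m * Real.exp (growth c α B X * (T - t))) :=
        mul_le_mul_of_nonneg_left h1 (hq0 m)
    _ = _ := by rw [abs_of_nonneg (hq0 m)]; ring

end flow

end NonlinearWalk

/-! ### Test functions of exponential growth and moments of forward solutions. -/

namespace NonlinearWalk

variable {c α B X : ℝ} {β : ℤ → ℝ} {L M : ℝ → ℝ}

/-- At most exponential growth. -/
def ExpBounded (f : ℤ → ℝ) : Prop := ∃ C K : ℝ, ∀ n : ℤ, |f n| ≤ C * Real.exp (K * |(n : ℝ)|)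

theorem ExpBounded.exists_nonneg {f : ℤ → ℝ} (hf : ExpBounded f) :
    ∃ C K : ℝ, 0 ≤ C ∧ 0 ≤ K ∧ ∀ n : ℤ, |f n| ≤ C * Real.exp (K * |(n : ℝ)|) := by
  obtain ⟨C, K, h⟩ := hf
  have hC : 0 ≤ C := by simpa using (abs_nonneg _).trans (h 0)
  refine ⟨C, |K|, hC, abs_nonneg _, fun n => (h n).trans ?_⟩
  gcongr
  exact le_abs_self K

theorem ExpBounded.mul {f g : ℤ → ℝ} (hf : ExpBounded f) (hg : ExpBounded g) :
    ExpBounded fun n => f n * g n := by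
  obtain ⟨C, K, hC, -, h⟩ := hf.exists_nonneg
  obtain ⟨C', K', hC', -, h'⟩ := hg.exists_nonneg
  refine ⟨C * C', K + K', fun n => ?_⟩
  rw [abs_mul, add_mul, Real.exp_add, mul_mul_mul_comm]
  exact mul_le_mul (h n) (h' n) (abs_nonneg _) (by positivity)

theorem ExpBounded.add {f g : ℤ → ℝ} (hf : ExpBounded f) (hg : ExpBounded g) :
    ExpBounded fun n => f n + g n := by
  obtain ⟨C, K, hC, hK, h⟩ := hf.exists_nonneg
  obtain ⟨C', K', hC', hK', h'⟩ := hg.exists_nonneg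
  refine ⟨C + C', K + K', fun n => (abs_add_le _ _).trans ?_⟩
  rw [add_mul]
  refine add_le_add ((h n).trans ?_) ((h' n).trans ?_) <;> gcongr <;> linarith

theorem ExpBounded.neg {f : ℤ → ℝ} (hf : ExpBounded f) : ExpBounded fun n => -f n := by
  obtain ⟨C, K, h⟩ := hf
  exact ⟨C, K, fun n => by rw [abs_neg]; exact h n⟩

theorem ExpBounded.sub {f g : ℤ → ℝ} (hf : ExpBounded f) (hg : ExpBounded g) :
    ExpBounded fun n => f n - g n := by
  simpa only [sub_eq_add_neg] using hf.add hg.neg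

theorem ExpBounded.comp_of_near {f : ℤ → ℝ} (hf : ExpBounded f) {g : ℤ → ℤ}
    (hg : ∀ n, |((g n : ℤ) : ℝ) - n| ≤ 1) : ExpBounded fun n => f (g n) := by
  obtain ⟨C, K, hC, hK, h⟩ := hf.exists_nonneg
  refine ⟨C * Real.exp |K|, K, fun n => (h _).trans ?_⟩
  rw [mul_assoc, ← Real.exp_add]
  gcongr
  have := mul_abs_sub_abs_le K _ _ (hg n)
  linarith

theorem ExpBounded.shift_add {f : ℤ → ℝ} (hf : ExpBounded f) : ExpBounded fun n => f (n + 1) :=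
  hf.comp_of_near fun n => by simp

theorem ExpBounded.shift_sub {f : ℤ → ℝ} (hf : ExpBounded f) : ExpBounded fun n => f (n - 1) :=
  hf.comp_of_near fun n => by simp

theorem ExpBounded.of_abs_le {f : ℤ → ℝ} {C : ℝ} (h : ∀ n, |f n| ≤ C) : ExpBounded f :=
  ⟨C, 0, fun n => by simpa using h n⟩

theorem expBounded_const (a : ℝ) : ExpBounded fun _ => a := .of_abs_le fun _ => le_rfl

theorem expBounded_exp (K : ℝ) : ExpBounded fun n => Real.exp (K * (n : ℝ)) := by
  refine ⟨1, |K|, fun n => ?_⟩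
  rw [one_mul, abs_of_pos (Real.exp_pos _), ← abs_mul]
  exact Real.exp_le_exp.2 (le_abs_self _)

theorem expBounded_exp_abs (K : ℝ) : ExpBounded fun n => Real.exp (K * |(n : ℝ)|) :=
  ⟨1, K, fun n => by rw [one_mul, abs_of_pos (Real.exp_pos _)]⟩

theorem expBounded_id : ExpBounded fun n => (n : ℝ) := by
  refine ⟨1, 1, fun n => ?_⟩
  rw [one_mul, one_mul]
  linarith [Real.add_one_le_exp |(n : ℝ)|]

theorem expBounded_rateUp (hc : 0 < c) (hβ : ∀ n, 0 < β n) (hB : ∀ n, β n ≤ B) (l : ℝ) :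
    ExpBounded (rateUp c β l) := by
  refine ⟨Real.exp (c * l) * B, c, fun n => ?_⟩
  rw [abs_of_pos (rateUp_pos hβ _ _), rateUp_eq, mul_assoc]
  gcongr
  exact rateUp_zero_le hc hβ hB n

theorem expBounded_rateDown (hc : 0 < c) (hβ : ∀ n, 0 < β n) (hB : ∀ n, β n ≤ B) (l : ℝ) :
    ExpBounded (rateDown c β l) := by
  refine ⟨Real.exp (-c * l) * B, c, fun n => ?_⟩
  rw [abs_of_pos (rateDown_pos hβ _ _), rateDown_eq, mul_assoc]
  gcongr
  exact rateDown_zero_le hc hβ hB n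

/-- The sum of an exponentially bounded function against a bounded function of the Banach
space with the supremum norm. -/
theorem ExpBounded.exists_summable_bound (hc : 0 < c) {f : ℤ → ℝ} (hf : ExpBounded f)
    (α R : ℝ) : ∃ G : ℤ → ℝ, Summable G ∧
      ∀ q : ℤ → ℝ, (∀ n, |q n| * weight c α n ≤ R) → ∀ n, |f n * q n| ≤ G n := by
  obtain ⟨C, K, hC, hK, h⟩ := hf.exists_nonneg
  refine ⟨fun n => C * R * (Real.exp (K * |(n : ℝ)|) / weight c α n),
    (summable_exp_div_weight hc α K).mul_left _, fun q hq n => ?_⟩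
  have h1 : |q n| ≤ R / weight c α n := (le_div_iff₀ (weight_pos _ _ _)).2 (hq n)
  rw [abs_mul]
  calc |f n| * |q n| ≤ (C * Real.exp (K * |(n : ℝ)|)) * (R / weight c α n) :=
        mul_le_mul (h n) h1 (abs_nonneg _) (by positivity)
    _ = _ := by ring

theorem ExpBounded.summable_mul (hc : 0 < c) {f : ℤ → ℝ} (hf : ExpBounded f) {R : ℝ}
    {q : ℤ → ℝ} (hq : ∀ n, |q n| * weight c α n ≤ R) : Summable fun n => f n * q n := by
  obtain ⟨G, hG, h⟩ := hf.exists_summable_bound hc α R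
  exact Summable.of_norm_bounded hG fun n => h q hq n

theorem MemB.abs_mul_weight_le {q : ℤ → ℝ} (hq : MemB c α q) (n : ℤ) :
    |q n| * weight c α n ≤ normB c α q :=
  hq.le_tsum n fun _ _ => mul_nonneg (abs_nonneg _) (weight_pos _ _ _).le

/-- `p` is bounded on `[a, T]` in the weighted supremum norm. -/
def WeightBound (c α R a T : ℝ) (p : ℝ → ℤ → ℝ) : Prop :=
  ∀ s ∈ Set.Icc a T, ∀ n, |p s n| * weight c α n ≤ R

theorem WeightBound.mono {R a T a' T' : ℝ} {p : ℝ → ℤ → ℝ} (h : WeightBound c α R a T p)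
    (ha : a ≤ a') (hT : T' ≤ T) : WeightBound c α R a' T' p :=
  fun s hs => h s ⟨ha.trans hs.1, hs.2.trans hT⟩

theorem IsForward.mono {a a' : ℝ} {p : ℝ → ℤ → ℝ} (h : IsForward c β L M a p) (ha : a ≤ a') :
    IsForward c β L M a' p :=
  fun s hs n => (h s (ha.trans hs) n).mono (Set.Ici_subset_Ici.2 ha)

theorem IsForward.continuousOn {a : ℝ} {p : ℝ → ℤ → ℝ} (h : IsForward c β L M a p) (n : ℤ) :
    ContinuousOn (fun u => p u n) (Set.Ici a) :=
  fun s hs => (h s hs n).continuousWithinAt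

theorem expBounded_rhsConst (hc : 0 < c) (hβ : ∀ n, 0 < β n) (hB : ∀ n, β n ≤ B) :
    ExpBounded (rhsConst c α B X β) :=
  ((expBounded_const X).mul ((expBounded_rateUp hc hβ hB 0).add
    (expBounded_rateDown hc hβ hB 0))).add (expBounded_const _)

theorem hasSum_shift_sub {f : ℤ → ℝ} {S : ℝ} (h : HasSum f S) :
    HasSum (fun n => f (n - 1)) S := (Equiv.subRight (1 : ℤ)).hasSum_iff.2 h

theorem hasSum_shift_add {f : ℤ → ℝ} {S : ℝ} (h : HasSum f S) :
    HasSum (fun n => f (n + 1)) S := (Equiv.addRight (1 : ℤ)).hasSum_iff.2 h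

/-- Summation by parts: the generator acting on test functions. -/
theorem tsum_mul_kolmogorovRHS (hc : 0 < c) (hβ : ∀ n, 0 < β n) (hB : ∀ n, β n ≤ B)
    {f q : ℤ → ℝ} (hf : ExpBounded f) {R : ℝ} (hq : ∀ n, |q n| * weight c α n ≤ R) (l m : ℝ) :
    ∑' n, f n * kolmogorovRHS c β l m q n
      = ∑' n, (rateUp c β l n * (f (n + 1) - f n) + rateDown c β m n * (f (n - 1) - f n)) * q n
    := by
  have hu := expBounded_rateUp hc hβ hB l
  have hd := expBounded_rateDown hc hβ hB m
  have s1 := ((hu.mul hf.shift_add).summable_mul hc hq).hasSum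
  have s2 := ((hd.mul hf.shift_sub).summable_mul hc hq).hasSum
  have s3 := (((hu.add hd).mul hf).summable_mul hc hq).hasSum
  have e1 := ((hasSum_shift_sub s1).sub s3).add (hasSum_shift_add s2)
  have e2 := (s1.sub s3).add s2
  rw [(e1.congr_fun fun n => ?_ : HasSum (fun n => f n * kolmogorovRHS c β l m q n) _).tsum_eq,
    (e2.congr_fun fun n => ?_ : HasSum (fun n => (rateUp c β l n * (f (n + 1) - f n)
      + rateDown c β m n * (f (n - 1) - f n)) * q n) _).tsum_eq]
  · ring
  · rw [sub_add_cancel, add_sub_cancel_right]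
    unfold kolmogorovRHS
    ring

/-- The evolution of the expectation of a test function of at most exponential growth. -/
theorem IsForward.hasDerivWithinAt_tsum (hc : 0 < c) (hβ : ∀ n, 0 < β n) (hB : ∀ n, β n ≤ B)
    {p : ℝ → ℤ → ℝ} {a T R : ℝ} (hp : IsForward c β L M a p) (hX : RateBound c X a T L M)
    (hR : WeightBound c α R a T p) {f : ℤ → ℝ} (hf : ExpBounded f) {s : ℝ}
    (hs : s ∈ Set.Ico a T) :
    HasDerivWithinAt (fun u => ∑' n, f n * p u n)
      (∑' n, (rateUp c β (L s) n * (f (n + 1) - f n)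
        + rateDown c β (M s) n * (f (n - 1) - f n)) * p s n) (Set.Ici a) s := by
  rw [← tsum_mul_kolmogorovRHS hc hβ hB hf (hR s ⟨hs.1, hs.2.le⟩)]
  obtain ⟨G, hG, hGb⟩ := (hf.mul (expBounded_rhsConst (α := α) (X := X) hc hβ hB)).exists_summable_bound
    hc α R
  refine hasDerivWithinAt_tsum_of_bound hG hs (fun y hy => hf.summable_mul hc (hR y hy))
    (fun n y hy => (hp y hy.1 n).const_mul (f n)) fun n y hy => ?_
  have h1 := abs_kolmogorovRHS_mul_weight_le (α := α) hβ hB (hX y hy).1 (hX y hy).2 (hR y hy) n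
  have hw := weight_pos c α n
  -- The bound is applied to the extremal sequence R / weight, since it is the derivative of p, not
  -- p itself, that has to be dominated.
  have h2 := hGb (fun n => R / weight c α n) (fun n => by
    have hR0 : 0 ≤ R := (mul_nonneg (abs_nonneg _) (weight_pos _ _ _).le).trans (hR y hy n)
    rw [abs_of_nonneg (div_nonneg hR0 (weight_pos _ _ _).le),
      div_mul_cancel₀ _ (weight_pos _ _ _).ne']) n
  have hX0 : 0 ≤ X := (Real.exp_pos _).le.trans (hX y hy).1
  have hr : 0 ≤ rhsConst c α B X β n := add_nonneg (mul_nonneg hX0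
    (add_pos (rateUp_pos hβ _ _) (rateDown_pos hβ _ _)).le) (growth_nonneg hβ hB hX0)
  have hR0 : 0 ≤ R := (mul_nonneg (abs_nonneg _) hw.le).trans (hR y hy n)
  refine le_trans ?_ h2
  rw [abs_mul, abs_mul, abs_mul, abs_of_nonneg hr, abs_of_nonneg (div_nonneg hR0 hw.le), mul_assoc]
  refine mul_le_mul_of_nonneg_left ?_ (abs_nonneg _)
  rw [mul_div_assoc', le_div_iff₀ hw]
  exact h1

end NonlinearWalk

/-! ### Stability, uniqueness and the semigroup property. -/

namespace NonlinearWalk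

variable {c α B X : ℝ} {β : ℤ → ℝ} {L M : ℝ → ℝ}

theorem exp_sub_exp_le (a b : ℝ) : Real.exp a - Real.exp b ≤ Real.exp a * |a - b| := by
  have h1 := Real.add_one_le_exp (b - a)
  have h2 : Real.exp b = Real.exp a * Real.exp (b - a) := by rw [← Real.exp_add]; congr 1; ring
  have h3 := le_abs_self (a - b)
  have h4 := Real.exp_pos a
  rw [h2]
  nlinarith

theorem abs_exp_sub_exp_le {a b Y : ℝ} (ha : Real.exp a ≤ Y) (hb : Real.exp b ≤ Y) :
    |Real.exp a - Real.exp b| ≤ Y * |a - b| := by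
  rw [abs_sub_le_iff]
  constructor
  · exact (exp_sub_exp_le a b).trans (mul_le_mul_of_nonneg_right ha (abs_nonneg _))
  · rw [abs_sub_comm]
    exact (exp_sub_exp_le b a).trans (mul_le_mul_of_nonneg_right hb (abs_nonneg _))

/-- The Lipschitz constant of the generator in the coefficients, between the weights with
parameters `α` and `α - c`. -/
noncomputable def coefConst (c α B X : ℝ) : ℝ :=
  c * X * (2 * offDiagConst c (α - c) B + 2 * B)

/-- The coefficients enter only through the scalar factors e^{cl} and e^{-cm}, so the difference of
the generators is a small scalar times a fixed generator. Its diagonal part forces the passage to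
the weaker weight. -/
theorem abs_kolmogorovRHS_sub_mul_weight_le (hc : 0 < c) (hβ : ∀ n, 0 < β n) (hB : ∀ n, β n ≤ B)
    {l m l' m' δ R : ℝ} (hl : Real.exp (c * l) ≤ X) (hm : Real.exp (-c * m) ≤ X)
    (hl' : Real.exp (c * l') ≤ X) (hm' : Real.exp (-c * m') ≤ X)
    (h1 : |l - l'| ≤ δ) (h2 : |m - m'| ≤ δ) {q : ℤ → ℝ}
    (hq : ∀ n, |q n| * weight c α n ≤ R) (n : ℤ) :
    |kolmogorovRHS c β l m q n - kolmogorovRHS c β l' m' q n| * weight c (α - c) n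
      ≤ coefConst c α B X * R * δ := by
  have hX : 0 ≤ X := (Real.exp_pos _).le.trans hl
  have hδ : 0 ≤ δ := (abs_nonneg _).trans h1
  have hB0 : 0 ≤ B := (hβ 0).le.trans (hB 0)
  have hx : |Real.exp (c * l) - Real.exp (c * l')| ≤ X * (c * δ) := by
    refine (abs_exp_sub_exp_le hl hl').trans ?_
    rw [← mul_sub, abs_mul, abs_of_pos hc]
    gcongr
  have hy : |Real.exp (-c * m) - Real.exp (-c * m')| ≤ X * (c * δ) := by
    refine (abs_exp_sub_exp_le hm hm').trans ?_
    rw [← mul_sub, abs_mul, abs_neg, abs_of_pos hc]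
    gcongr
  set K := offDiagConst c (α - c) B with hK
  have hK0 : 0 ≤ K := offDiagConst_nonneg hβ hB
  have hv := weight_pos c (α - c) n
  have hqv : ∀ n, |q n| * weight c (α - c) n ≤ R := fun n =>
    (mul_le_mul_of_nonneg_left (weight_sub_le hc n) (abs_nonneg _)).trans (hq n)
  have e : kolmogorovRHS c β l m q n - kolmogorovRHS c β l' m' q n
      = (Real.exp (c * l) - Real.exp (c * l'))
          * (rateUp c β 0 (n - 1) * q (n - 1) - rateUp c β 0 n * q n)
        + (Real.exp (-c * m) - Real.exp (-c * m'))
          * (rateDown c β 0 (n + 1) * q (n + 1) - rateDown c β 0 n * q n) := by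
    unfold kolmogorovRHS
    rw [rateUp_eq c β l (n - 1), rateUp_eq c β l n, rateDown_eq c β m n,
      rateDown_eq c β m (n + 1), rateUp_eq c β l' (n - 1), rateUp_eq c β l' n,
      rateDown_eq c β m' n, rateDown_eq c β m' (n + 1)]
    ring
  have hu : |rateUp c β 0 (n - 1) * q (n - 1) - rateUp c β 0 n * q n| * weight c (α - c) n
      ≤ (K + B) * R := by
    have a1 := mul_le_mul_of_nonneg_right
      (rateUp_mul_weight_le (c := c) (α := α - c) hβ hB n) (abs_nonneg (q (n - 1)))
    have a2 := mul_le_mul_of_nonneg_right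
      (rateUp_mul_weight_sub_le (α := α) hc hβ hB n) (abs_nonneg (q n))
    have a3 := mul_le_mul_of_nonneg_left (hqv (n - 1)) hK0
    have a4 := mul_le_mul_of_nonneg_left (hq n) hB0
    refine (mul_le_mul_of_nonneg_right (abs_sub _ _) hv.le).trans ?_
    rw [abs_mul, abs_mul, abs_of_pos (rateUp_pos hβ _ _), abs_of_pos (rateUp_pos hβ _ _)]
    linarith
  have hd : |rateDown c β 0 (n + 1) * q (n + 1) - rateDown c β 0 n * q n| * weight c (α - c) n
      ≤ (K + B) * R := by
    have a1 := mul_le_mul_of_nonneg_right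
      (rateDown_mul_weight_le (c := c) (α := α - c) hβ hB n) (abs_nonneg (q (n + 1)))
    have a2 := mul_le_mul_of_nonneg_right
      (rateDown_mul_weight_sub_le (α := α) hc hβ hB n) (abs_nonneg (q n))
    have a3 := mul_le_mul_of_nonneg_left (hqv (n + 1)) hK0
    have a4 := mul_le_mul_of_nonneg_left (hq n) hB0
    refine (mul_le_mul_of_nonneg_right (abs_sub _ _) hv.le).trans ?_
    rw [abs_mul, abs_mul, abs_of_pos (rateDown_pos hβ _ _), abs_of_pos (rateDown_pos hβ _ _)]
    linarith
  rw [e]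
  refine (mul_le_mul_of_nonneg_right (abs_add_le _ _) hv.le).trans ?_
  rw [abs_mul, abs_mul, add_mul, mul_assoc, mul_assoc]
  have hXc : 0 ≤ X * (c * δ) := by positivity
  calc _ ≤ X * (c * δ) * ((K + B) * R) + X * (c * δ) * ((K + B) * R) :=
        add_le_add (mul_le_mul hx hu (mul_nonneg (abs_nonneg _) hv.le) hXc)
          (mul_le_mul hy hd (mul_nonneg (abs_nonneg _) hv.le) hXc)
    _ = _ := by unfold coefConst; ring

theorem coefConst_nonneg (hc : 0 < c) (hβ : ∀ n, 0 < β n) (hB : ∀ n, β n ≤ B) (hX : 0 ≤ X) :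
    0 ≤ coefConst c α B X := by
  have := offDiagConst_nonneg (c := c) (α := α - c) hβ hB
  have hB0 : 0 ≤ B := (hβ 0).le.trans (hB 0)
  unfold coefConst
  positivity

theorem inflow_sub (l m : ℝ) (p q : ℤ → ℝ) (n : ℤ) :
    inflow c β l m (fun n => p n - q n) n = inflow c β l m p n - inflow c β l m q n := by
  unfold inflow; ring

/-- Stability of the forward equations under perturbations of the coefficients. -/
theorem forward_stability (hc : 0 < c) (hβ : ∀ n, 0 < β n) (hB : ∀ n, β n ≤ B)
    {L' M' : ℝ → ℝ} {p p' : ℝ → ℤ → ℝ} {a T R ρ κ : ℝ}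
    (hX : RateBound c X a T L M) (hX' : RateBound c X a T L' M')
    (hp : IsForward c β L M a p) (hp' : IsForward c β L' M' a p') (h0 : p a = p' a)
    (hR : WeightBound c α R a T p) (hR' : WeightBound c α R a T p')
    (hρ : ∀ s ∈ Set.Icc a T,
      |L s - L' s| ≤ ρ * Real.exp (κ * s) ∧ |M s - M' s| ≤ ρ * Real.exp (κ * s))
    (hκ : 0 < κ) (hκ2 : 2 * growth c (α - c) B X ≤ κ) {s : ℝ} (hs : s ∈ Set.Icc a T) (n : ℤ) :
    |p s n - p' s n| * weight c (α - c) n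
      ≤ 2 * (coefConst c α B X * R * ρ / κ) * Real.exp (κ * s) := by
  have haT : a ≤ T := hs.1.trans hs.2
  have hX0 : 0 ≤ X := hX.nonneg haT
  have hR0 : 0 ≤ R := (mul_nonneg (abs_nonneg _) (weight_pos _ _ _).le).trans (hR a ⟨le_rfl, haT⟩ 0)
  have hρ0 : 0 ≤ ρ := nonneg_of_mul_nonneg_left
    ((abs_nonneg _).trans (hρ a ⟨le_rfl, haT⟩).1) (Real.exp_pos _)
  set C := coefConst c α B X * R * ρ with hC
  have hC0 : 0 ≤ C := mul_nonneg (mul_nonneg (coefConst_nonneg hc hβ hB hX0) hR0) hρ0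
  set K := growth c (α - c) B X with hK
  have hK0 : 0 ≤ K := growth_nonneg hβ hB hX0
  -- The difference solves a damped equation whose source is its own inflow, at most (κ/2) b, plus
  -- the coefficient error, at most C. Integration against e^{κs} divides both by κ, so a bound b
  -- improves to b/2 + C/κ.
  have step : ∀ b : ℝ, 0 ≤ b →
      (∀ s ∈ Set.Icc a T, ∀ n, |p s n - p' s n| * weight c (α - c) n ≤ b * Real.exp (κ * s)) →
      ∀ s ∈ Set.Icc a T, ∀ n,
        |p s n - p' s n| * weight c (α - c) n ≤ (b / 2 + C / κ) * Real.exp (κ * s) := by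
    intro b hb hbd s hs n
    have hv := weight_pos c (α - c) n
    have hmain := abs_le_of_damped (f := fun u => p u n - p' u n)
      (h := fun u => rateUp c β (L u) n + rateDown c β (M u) n)
      (g := fun u => inflow c β (L u) (M u) (fun n => p u n - p' u n) n
        + (kolmogorovRHS c β (L u) (M u) (p' u) n - kolmogorovRHS c β (L' u) (M' u) (p' u) n))
      (a := a) (T := T) (G := (b / 2 + C / κ) / weight c (α - c) n) (κ := κ) (by positivity)
      (fun u hu => ((hp u hu.1 n).sub (hp' u hu.1 n)).congr_deriv (by
        rw [inflow_sub, kolmogorovRHS_eq (L u) (M u) (p u), kolmogorovRHS_eq (L u) (M u) (p' u)]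
        ring))
      (fun u _ => (add_pos (rateUp_pos hβ _ _) (rateDown_pos hβ _ _)).le)
      (by simp [h0]) (fun u hu => ?_) s hs
    · rw [div_mul_eq_mul_div, le_div_iff₀ hv] at hmain
      exact hmain
    · have h1 := abs_inflow_mul_weight_le (α := α - c) hβ hB (hX u hu).1 (hX u hu).2
        (p := fun n => p u n - p' u n) (hbd u hu) n
      have h2 := abs_kolmogorovRHS_sub_mul_weight_le (α := α) hc hβ hB (hX u hu).1 (hX u hu).2
        (hX' u hu).1 (hX' u hu).2 (hρ u hu).1 (hρ u hu).2 (hR' u hu) n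
      have e1 : (b / 2 + C / κ) / weight c (α - c) n * κ * Real.exp (κ * u)
          = ((κ / 2 * b + C) * Real.exp (κ * u)) / weight c (α - c) n := by
        field_simp
      rw [e1, le_div_iff₀ hv]
      refine (mul_le_mul_of_nonneg_right (abs_add_le _ _) hv.le).trans ?_
      have h3 : K * b * Real.exp (κ * u) ≤ κ / 2 * b * Real.exp (κ * u) := by
        gcongr
        linarith
      rw [add_mul, add_mul]
      linarith
  -- Start from the crude bound 2R and iterate; in the limit only the fixed point 2C/κ of b ↦ b/2 +
  -- C/κ survives.
  have iter : ∀ k : ℕ, ∀ s ∈ Set.Icc a T, ∀ n, |p s n - p' s n| * weight c (α - c) n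
      ≤ (2 * R * Real.exp (-κ * a) * (1 / 2) ^ k + 2 * (C / κ)) * Real.exp (κ * s) := by
    intro k
    induction k with
    | zero =>
      intro s hs n
      have h1 : |p s n - p' s n| * weight c (α - c) n ≤ 2 * R := by
        calc |p s n - p' s n| * weight c (α - c) n
            ≤ (|p s n| + |p' s n|) * weight c α n :=
              mul_le_mul (abs_sub _ _) (weight_sub_le hc n) (weight_pos _ _ _).le (by positivity)
          _ ≤ 2 * R := by linarith [hR s hs n, hR' s hs n]
      have h2 : 1 ≤ Real.exp (-κ * a) * Real.exp (κ * s) := by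
        rw [← Real.exp_add, Real.one_le_exp_iff]
        nlinarith [hs.1]
      have h3 : 0 ≤ 2 * (C / κ) * Real.exp (κ * s) := by positivity
      rw [pow_zero, mul_one, add_mul]
      nlinarith
    | succ k ih =>
      intro s hs n
      refine (step _ (by positivity) ih s hs n).trans (le_of_eq ?_)
      rw [pow_succ]; ring
  have hlim : Tendsto (fun k : ℕ =>
      (2 * R * Real.exp (-κ * a) * (1 / 2) ^ k + 2 * (C / κ)) * Real.exp (κ * s)) atTop
      (𝓝 ((2 * R * Real.exp (-κ * a) * 0 + 2 * (C / κ)) * Real.exp (κ * s))) :=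
    (((tendsto_pow_atTop_nhds_zero_of_lt_one (by norm_num) (by norm_num)).const_mul _).add_const
      _).mul_const _
  rw [mul_zero, zero_add] at hlim
  exact ge_of_tendsto' hlim fun k => iter k s hs n

/-- Stability with coefficient error ρ = 0. -/
theorem forward_unique (hc : 0 < c) (hβ : ∀ n, 0 < β n) (hB : ∀ n, β n ≤ B)
    {p p' : ℝ → ℤ → ℝ} {a T R R' : ℝ} (hX : RateBound c X a T L M)
    (hp : IsForward c β L M a p) (hp' : IsForward c β L M a p') (h0 : p a = p' a)
    (hR : WeightBound c α R a T p) (hR' : WeightBound c α R' a T p')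
    {s : ℝ} (hs : s ∈ Set.Icc a T) : p s = p' s := by
  funext n
  have h := forward_stability (α := α) (R := max R R') (ρ := 0)
    (κ := max 1 (2 * growth c (α - c) B X)) hc hβ hB hX hX hp hp' h0
    (fun s hs n => (hR s hs n).trans (le_max_left _ _))
    (fun s hs n => (hR' s hs n).trans (le_max_right _ _)) (fun s _ => by simp)
    (by positivity) (le_max_right _ _) hs n
  simp only [mul_zero, zero_div, zero_mul] at h
  have h1 : |p s n - p' s n| ≤ 0 := by
    by_contra hcon
    exact absurd h (not_le.2 (mul_pos (not_le.1 hcon) (weight_pos _ _ _)))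
  exact sub_eq_zero.1 (abs_nonpos_iff.1 h1)

theorem weightBound_flow (hβ : ∀ n, 0 < β n) (hB : ∀ n, β n ≤ B)
    (hL : Continuous L) (hM : Continuous M) {q : ℤ → ℝ} (hq0 : ∀ n, 0 ≤ q n) (hq : MemB c α q)
    {t T : ℝ} (hX : RateBound c X t T L M) :
    WeightBound c α (normB c α q * Real.exp (growth c α B X * (T - t))) t T
      (flow c β L M q t) := by
  intro s hs n
  rw [abs_of_nonneg (flow_nonneg hβ hq0 hs.1 n)]
  simpa using sum_flow_mul_weight_le hβ hB hL hM hq0 hq hX hs {n}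

theorem weightBound_transitionProb (hβ : ∀ n, 0 < β n) (hB : ∀ n, β n ≤ B)
    (hL : Continuous L) (hM : Continuous M) {t T : ℝ} (hX : RateBound c X t T L M) (m : ℤ) :
    WeightBound c α (weight c α m * Real.exp (growth c α B X * (T - t))) t T
      (fun s n => transitionProb c β L M n s m t) := by
  intro s hs n
  rw [abs_of_nonneg (transitionProb_nonneg hβ n m hs.1)]
  exact transitionProb_mul_weight_le hβ hB hL hM hX m n hs

theorem memB_flow (hβ : ∀ n, 0 < β n) (hB : ∀ n, β n ≤ B)
    (hL : Continuous L) (hM : Continuous M) {q : ℤ → ℝ} (hq0 : ∀ n, 0 ≤ q n) (hq : MemB c α q)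
    {t s : ℝ} (hts : t ≤ s) : MemB c α (flow c β L M q t s) := by
  obtain ⟨X, hX0, hX⟩ := exists_rateBound hL hM c t s
  refine summable_of_sum_le (fun n => mul_nonneg (abs_nonneg _) (weight_pos _ _ _).le)
    (c := normB c α q * Real.exp (growth c α B X * (s - t))) fun F => ?_
  simp only [abs_of_nonneg (flow_nonneg hβ hq0 hts _)]
  exact sum_flow_mul_weight_le hβ hB hL hM hq0 hq hX ⟨hts, le_rfl⟩ F

theorem memB_transitionProb (hβ : ∀ n, 0 < β n) (hB : ∀ n, β n ≤ B)
    (hL : Continuous L) (hM : Continuous M) (m : ℤ) {t s : ℝ} (hts : t ≤ s) :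
    MemB c α (fun n => transitionProb c β L M n s m t) := by
  obtain ⟨X, hX0, hX⟩ := exists_rateBound hL hM c t s
  refine summable_of_sum_le (fun n => mul_nonneg (abs_nonneg _) (weight_pos _ _ _).le)
    (c := weight c α m * Real.exp (growth c α B X * (s - t))) fun F => ?_
  simp only [abs_of_nonneg (transitionProb_nonneg hβ _ m hts)]
  exact sum_transitionProb_mul_weight_le hβ hB hL hM hX m ⟨hts, le_rfl⟩ F

/-- Forward solutions conserve the total mass. -/
theorem IsForward.hasSum_mass (hc : 0 < c) (hβ : ∀ n, 0 < β n) (hB : ∀ n, β n ≤ B)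
    {p : ℝ → ℤ → ℝ} {a s R S : ℝ} (hp : IsForward c β L M a p)
    (hX : RateBound c X a s L M) (hR : WeightBound c α R a s p)
    (has : a ≤ s) (h0 : HasSum (p a) S) : HasSum (p s) S := by
  have hsum : ∀ u ∈ Set.Icc a s, Summable (p u) := fun u hu => by
    simpa using (expBounded_const 1).summable_mul hc (hR u hu)
  -- The generator annihilates constants, which have exponential growth and so are legitimate test
  -- functions.
  have hd : ∀ u ∈ Set.Ico a s, HasDerivWithinAt (fun u => ∑' n, p u n) 0 (Set.Ici a) u := by
    intro u hu
    simpa using hp.hasDerivWithinAt_tsum hc hβ hB hX hR (expBounded_const 1) hu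
  have hG := (expBounded_const 1).exists_summable_bound hc α R
  obtain ⟨G, hG, hGb⟩ := hG
  have hcont : ContinuousOn (fun u => ∑' n, p u n) (Set.Icc a s) := by
    refine continuousOn_tsum (fun n => (hp.continuousOn n).mono Set.Icc_subset_Ici_self) hG ?_
    intro n u hu
    simpa using hGb (p u) (hR u hu) n
  have hconst := constant_of_has_deriv_right_zero hcont
    (fun u hu => (hd u hu).mono (Set.Ici_subset_Ici.2 hu.1)) s ⟨has, le_rfl⟩
  rw [h0.tsum_eq] at hconst
  rw [← hconst]
  exact (hsum s ⟨has, le_rfl⟩).hasSum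

theorem hasSum_transitionProb (hc : 0 < c) (hβ : ∀ n, 0 < β n) (hB : ∀ n, β n ≤ B)
    (hL : Continuous L) (hM : Continuous M) (m : ℤ) {t s : ℝ} (hts : t ≤ s) :
    HasSum (fun n => transitionProb c β L M n s m t) 1 := by
  obtain ⟨X, hX0, hX⟩ := exists_rateBound hL hM c t s
  refine (isForward_transitionProb hβ hB hL hM m t).hasSum_mass hc hβ hB hX
    (weightBound_transitionProb (α := 0) hβ hB hL hM hX m) hts ?_
  simp only [transitionProb_self]
  exact hasSum_ite_eq m 1

/-- The flow property with respect to a forward solution. -/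
theorem IsForward.eq_flow (hc : 0 < c) (hβ : ∀ n, 0 < β n) (hB : ∀ n, β n ≤ B)
    (hL : Continuous L) (hM : Continuous M) {p : ℝ → ℤ → ℝ} {t s R : ℝ}
    (hp : IsForward c β L M t p) (hR : WeightBound c α R t s p) (hts : t ≤ s)
    (hp0 : ∀ n, 0 ≤ p t n) (hpB : MemB c α (p t)) : p s = flow c β L M (p t) t s := by
  obtain ⟨X, hX0, hX⟩ := exists_rateBound hL hM c t s
  exact forward_unique hc hβ hB hX hp (isForward_flow hβ hB hL hM hpB t)
    (funext fun n => (flow_self _ t n).symm) hR (weightBound_flow hβ hB hL hM hp0 hpB hX)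
    ⟨hts, le_rfl⟩

/-- Restarting at time u with the current row of the kernel gives a second forward solution with the
same data at u; uniqueness identifies the two. -/
theorem chapman_kolmogorov (hc : 0 < c) (hβ : ∀ n, 0 < β n) (hB : ∀ n, β n ≤ B)
    (hL : Continuous L) (hM : Continuous M) (n m : ℤ) {t u s : ℝ} (htu : t ≤ u) (hus : u ≤ s) :
    HasSum (fun l => transitionProb c β L M l u m t * transitionProb c β L M n s l u)
      (transitionProb c β L M n s m t) := by
  obtain ⟨X, hX0, hX⟩ := exists_rateBound hL hM c t s
  have hB' := memB_transitionProb (c := c) (α := 0) hβ hB hL hM m htu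
  have h := ((isForward_transitionProb hβ hB hL hM m t).mono htu).eq_flow hc hβ hB hL hM
    ((weightBound_transitionProb (α := 0) hβ hB hL hM hX m).mono htu le_rfl) hus
    (fun n => transitionProb_nonneg hβ n m htu) hB'
  rw [congrFun h n]
  exact (summable_flow hβ hB hL hM hB' n hus).hasSum

theorem isStochasticSemigroup_transitionProb (hc : 0 < c) (hβ : ∀ n, 0 < β n)
    (hB : ∀ n, β n ≤ B) (hL : Continuous L) (hM : Continuous M) :
    IsStochasticSemigroup (transitionProb c β L M) where
  nonneg n _ m _ _ hts := transitionProb_nonneg hβ n m hts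
  sum_one _ m _ _ hts := hasSum_transitionProb hc hβ hB hL hM m hts
  diag n m t _ := transitionProb_self n m t
  chapman_kolmogorov n _ _ m _ _ htu hus := chapman_kolmogorov hc hβ hB hL hM n m htu hus

/-- A forward solution with bounded weighted `ℓ¹` norm is dominated by a fixed element of the
Banach space. -/
theorem IsForward.exists_dominating (hβ : ∀ n, 0 < β n) (hB : ∀ n, β n ≤ B)
    (hL : Continuous L) (hM : Continuous M) {p : ℝ → ℤ → ℝ} {a T R : ℝ}
    (hp : IsForward c β L M a p) (hp0 : ∀ s, a ≤ s → ∀ n, 0 ≤ p s n) (haT : a ≤ T)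
    (hX : RateBound c X a T L M)
    (hR : ∀ s ∈ Set.Icc a T, ∀ F : Finset ℤ, ∑ n ∈ F, p s n * weight c α n ≤ R) :
    ∃ Q : ℤ → ℝ, (Summable fun n => Q n * weight c α n) ∧
      ∀ s ∈ Set.Icc a T, ∀ n, p s n ≤ Q n := by
  -- Freezing p before time a makes the inflow continuous and nonnegative on the whole line.
  let g : ℤ → ℝ → ℝ := fun n u => inflow c β (L u) (M u) (p (max a u)) n
  have hpc : ∀ n, Continuous fun u => p (max a u) n := fun n =>
    (hp.continuousOn n).comp_continuous (continuous_const.max continuous_id)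
      fun u => Set.mem_Ici.2 (le_max_left _ _)
  have hg : ∀ n, Continuous (g n) := fun n =>
    ((hpc _).mul (continuous_rateUp hL _)).add ((hpc _).mul (continuous_rateDown hM _))
  have hg0 : ∀ n u, 0 ≤ g n u := fun n u => inflow_nonneg hβ (fun n => hp0 _ (le_max_left _ _) n) n
  have hmax : ∀ u ∈ Set.Icc a T, max a u = u := fun u hu => max_eq_right hu.1
  have hgd : ∀ n u, HasDerivAt (fun s => p a n + ∫ v in a..s, g n v) (g n u) u := fun n u =>
    ((hg n).integral_hasStrictDerivAt a u).hasDerivAt.const_add _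
  -- Dropping the loss term, p n is at most its initial value plus all the inflow received up to T;
  -- the inflow is bounded in weighted ℓ¹, so this majorant lies in B.
  refine ⟨fun n => p a n + ∫ v in a..T, g n v, ?_, fun s hs n => ?_⟩
  · refine summable_of_sum_le (c := R + ∫ _ in a..T, growth c α B X * R)
      (fun n => mul_nonneg (add_nonneg (hp0 a le_rfl n)
        (intervalIntegral.integral_nonneg haT fun u _ => hg0 n u)) (weight_pos _ _ _).le)
      fun F => ?_
    have e : ∑ n ∈ F, (p a n + ∫ v in a..T, g n v) * weight c α n
        = ∑ n ∈ F, p a n * weight c α n + ∫ v in a..T, ∑ n ∈ F, g n v * weight c α n := by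
      have hi : ∀ n ∈ F, IntervalIntegrable (fun v => g n v * weight c α n) volume a T :=
        fun n _ => ((hg n).mul continuous_const).intervalIntegrable _ _
      rw [intervalIntegral.integral_finsetSum hi, ← Finset.sum_add_distrib]
      refine Finset.sum_congr rfl fun n _ => ?_
      rw [intervalIntegral.integral_mul_const]; ring
    rw [e]
    refine add_le_add (hR a ⟨le_rfl, haT⟩ F) ?_
    refine intervalIntegral.integral_mono_on haT
      ((continuous_finsetSum _ fun n _ => (hg n).mul continuous_const).intervalIntegrable _ _)
      (continuous_const.intervalIntegrable _ _) fun u hu => ?_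
    have := sum_inflow_mul_weight_le (α := α) hβ hB (hX u hu).1 (hX u hu).2
      (p := p (max a u)) (fun n => hp0 _ (le_max_left _ _) n) (b := R)
      (by rw [hmax u hu]; exact hR u hu) F
    exact this
  · have h1 : p s n ≤ p a n + ∫ v in a..s, g n v := by
      refine image_le_of_deriv_right_le_deriv_boundary
        ((hp.continuousOn n).mono Set.Icc_subset_Ici_self)
        (fun u hu => (hp u hu.1 n).mono (Set.Ici_subset_Ici.2 hu.1)) (by simp)
        (fun u _ => (hgd n u).continuousAt.continuousWithinAt)
        (fun u _ => (hgd n u).hasDerivWithinAt) (fun u hu => ?_) hs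
      rw [kolmogorovRHS_eq]
      simp only [g, max_eq_right hu.1]
      have := mul_nonneg (add_pos (rateUp_pos (c := c) hβ (L u) n)
        (rateDown_pos (c := c) hβ (M u) n)).le (hp0 u hu.1 n)
      linarith
    have h2 : ∫ v in a..s, g n v ≤ ∫ v in a..T, g n v :=
      intervalIntegral.integral_mono_interval le_rfl hs.1 hs.2
        (Eventually.of_forall fun u => hg0 n u) ((hg n).intervalIntegrable _ _)
    linarith

/-- The flow of a nonnegative initial vector is continuous in the norm of the Banach space. -/
theorem tendsto_normB_flow (hβ : ∀ n, 0 < β n) (hB : ∀ n, β n ≤ B)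
    (hL : Continuous L) (hM : Continuous M) {q : ℤ → ℝ} (hq0 : ∀ n, 0 ≤ q n) (hq : MemB c α q)
    {a t : ℝ} (hat : a ≤ t) :
    Tendsto (fun u => normB c α (fun n => flow c β L M q a u n - flow c β L M q a t n))
      (𝓝[Set.Ici a] t) (𝓝 0) := by
  obtain ⟨X, hX0, hX⟩ := exists_rateBound hL hM c a (t + 1)
  have hfw := isForward_flow hβ hB hL hM hq a
  obtain ⟨Q, hQ, hQb⟩ := hfw.exists_dominating (α := α) hβ hB hL hM
    (fun s hs n => flow_nonneg hβ hq0 hs n) (by linarith : a ≤ t + 1) hX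
    (fun s hs F => sum_flow_mul_weight_le hβ hB hL hM hq0 hq hX hs F)
  have ht : t ∈ Set.Icc a (t + 1) := ⟨hat, by linarith⟩
  have h0 : (0 : ℝ) = ∑' n : ℤ, |flow c β L M q a t n - flow c β L M q a t n| * weight c α n := by
    simp
  rw [h0]
  refine tendsto_tsum_of_dominated_convergence hQ (fun n => ?_) ?_
  · exact ((((hfw.continuousOn n) t hat).tendsto.sub_const _).abs).mul_const _
  · filter_upwards [self_mem_nhdsWithin,
      nhdsWithin_le_nhds (Iio_mem_nhds (show t < t + 1 by linarith))] with u hu1 hu2 n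
    have hu : u ∈ Set.Icc a (t + 1) := ⟨hu1, le_of_lt hu2⟩
    have hw := weight_pos c α n
    rw [Real.norm_eq_abs, abs_mul, abs_abs, abs_of_pos hw]
    gcongr
    rw [abs_sub_le_iff]
    have h1 := hQb u hu n
    have h2 := hQb t ht n
    have h3 := flow_nonneg (L := L) (M := M) (c := c) hβ hq0 hu.1 n
    have h4 := flow_nonneg (L := L) (M := M) (c := c) hβ hq0 hat n
    constructor <;> linarith

end NonlinearWalk

/-! ### Causal contractions and scalar relaxation equations. -/

namespace NonlinearWalk

/-- Global fixed points of a causal map which is a contraction in exponentially weighted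
supremum norms on bounded time intervals. -/
theorem exists_causal_fixedPoint {E : Type*} [MetricSpace E] [CompleteSpace E]
    {Adm : (ℝ → E) → Prop} {Φ : (ℝ → E) → ℝ → E}
    (hcont : ∀ f, Adm f → Continuous f) (hmax : ∀ f, Adm f → ∀ t, f t = f (max 0 t))
    (hΦ : ∀ f, Adm f → Adm (Φ f))
    (hlim : ∀ (F : ℕ → ℝ → E) (f : ℝ → E), (∀ j, Adm (F j)) → Continuous f →
      (∀ t, Tendsto (fun j => F j t) atTop (𝓝 (f t))) → Adm f)
    (hcontr : ∀ T, 0 ≤ T → ∃ κ : ℝ, 0 < κ ∧ ∀ f g, Adm f → Adm g → ∀ ρ : ℝ,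
      (∀ s ∈ Set.Icc 0 T, dist (f s) (g s) ≤ ρ * Real.exp (κ * s)) →
      ∀ s ∈ Set.Icc 0 T, dist (Φ f s) (Φ g s) ≤ ρ / 2 * Real.exp (κ * s))
    {f₀ : ℝ → E} (h0 : Adm f₀) : ∃ f, Adm f ∧ ∀ t, 0 ≤ t → Φ f t = f t := by
  let F : ℕ → ℝ → E := fun j => Φ^[j] f₀
  have hFs : ∀ j, F (j + 1) = Φ (F j) := fun j => Function.iterate_succ_apply' Φ j f₀
  have hF : ∀ j, Adm (F j) := by
    intro j
    induction j with
    | zero => exact h0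
    | succ j ih => rw [hFs]; exact hΦ _ ih
  have hrate : ∀ T, 0 ≤ T → ∃ κ C : ℝ, 0 < κ ∧ 0 ≤ C ∧ (∀ j, ∀ s ∈ Set.Icc 0 T,
      dist (F j s) (F (j + 1) s) ≤ C / 2 ^ j * Real.exp (κ * s)) ∧
      (∀ f g, Adm f → Adm g → ∀ ρ : ℝ,
      (∀ s ∈ Set.Icc 0 T, dist (f s) (g s) ≤ ρ * Real.exp (κ * s)) →
      ∀ s ∈ Set.Icc 0 T, dist (Φ f s) (Φ g s) ≤ ρ / 2 * Real.exp (κ * s)) := by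
    intro T hT
    obtain ⟨κ, hκ, hk⟩ := hcontr T hT
    obtain ⟨C, hC⟩ := (isCompact_Icc (a := (0 : ℝ)) (b := T)).bddAbove_image
      ((hcont _ (hF 0)).dist (hcont _ (hF 1))).continuousOn
    refine ⟨κ, |C|, hκ, abs_nonneg _, fun j => ?_, hk⟩
    induction j with
    | zero =>
      intro s hs
      have h1 := hC (Set.mem_image_of_mem _ hs)
      have h2 : 1 ≤ Real.exp (κ * s) := Real.one_le_exp (mul_nonneg hκ.le hs.1)
      have h3 := le_abs_self C
      have h4 := abs_nonneg C
      rw [pow_zero, div_one]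
      calc _ ≤ C := h1
        _ ≤ |C| * 1 := by linarith
        _ ≤ _ := by gcongr
    | succ j ih =>
      intro s hs
      have := hk _ _ (hF j) (hF (j + 1)) _ ih s hs
      rw [← hFs, ← hFs] at this
      rw [pow_succ, ← div_div]
      exact this
  -- On [0, T] the factor e^{κs} is at most e^{κT}, and values at negative times are those at 0. The
  -- shape D / 2 / 2^j is the one expected by `cauchySeq_of_le_geometric_two`.
  have hle : ∀ T, 0 ≤ T → ∃ D : ℝ, ∀ s ≤ T, ∀ j, dist (F j s) (F (j + 1) s) ≤ D / 2 / 2 ^ j := by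
    intro T hT
    obtain ⟨κ, C, hκ, hC, h, -⟩ := hrate T hT
    refine ⟨2 * (C * Real.exp (κ * T)), fun s hs j => ?_⟩
    rw [hmax _ (hF j) s, hmax _ (hF (j + 1)) s]
    have hm : max 0 s ∈ Set.Icc 0 T := ⟨le_max_left _ _, max_le hT hs⟩
    refine (h j _ hm).trans ?_
    rw [mul_div_cancel_left₀ _ two_ne_zero, div_mul_eq_mul_div]
    gcongr
    exact hm.2
  have hlimit : ∀ s, ∃ x, Tendsto (fun j => F j s) atTop (𝓝 x) := by
    intro s
    obtain ⟨D, hD⟩ := hle (max 0 s) (le_max_left _ _)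
    exact cauchySeq_tendsto_of_complete (cauchySeq_of_le_geometric_two (hD s (le_max_right _ _)))
  choose f hf using hlimit
  have hdist : ∀ T, 0 ≤ T → ∃ D : ℝ, ∀ s ≤ T, ∀ j, dist (F j s) (f s) ≤ D / 2 ^ j := by
    intro T hT
    obtain ⟨D, hD⟩ := hle T hT
    exact ⟨D, fun s hs j => dist_le_of_le_geometric_two_of_tendsto (hD s hs) (hf s) j⟩
  have hpow : ∀ D : ℝ, Tendsto (fun j : ℕ => D / 2 ^ j) atTop (𝓝 0) := fun D =>
    tendsto_const_nhds.div_atTop (tendsto_pow_atTop_atTop_of_one_lt one_lt_two)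
  have hfc : Continuous f := by
    have hu : TendstoLocallyUniformly F f atTop := by
      rw [Metric.tendstoLocallyUniformly_iff]
      intro ε hε x
      obtain ⟨D, hD⟩ := hdist (max 0 (x + 1)) (le_max_left _ _)
      refine ⟨Set.Iio (x + 1), Iio_mem_nhds (by linarith), ?_⟩
      filter_upwards [(hpow D).eventually_lt_const hε] with j hj y hy
      rw [dist_comm]
      exact (hD y ((le_of_lt hy).trans (le_max_right _ _)) j).trans_lt hj
    exact hu.continuous (Eventually.of_forall fun j => hcont _ (hF j)).frequently
  have hfA : Adm f := hlim F f hF hfc hf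
  refine ⟨f, hfA, fun t ht => ?_⟩
  obtain ⟨κ, C, hκ, hC, -, hk⟩ := hrate t ht
  obtain ⟨D, hD⟩ := hdist t ht
  have h1 : ∀ j, dist (F (j + 1) t) (Φ f t) ≤ D / 2 / 2 ^ j * Real.exp (κ * t) := by
    intro j
    have h2 := hk _ _ (hF j) hfA (D / 2 ^ j) (fun s hs => (hD s hs.2 j).trans ?_) t ⟨ht, le_rfl⟩
    · rw [hFs]
      refine h2.trans (le_of_eq ?_)
      ring
    · have h3 : 0 ≤ D / 2 ^ j := dist_nonneg.trans (hD s hs.2 j)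
      exact le_mul_of_one_le_right h3 (Real.one_le_exp (mul_nonneg hκ.le hs.1))
  have h2 : Tendsto (fun j => F (j + 1) t) atTop (𝓝 (Φ f t)) := by
    rw [tendsto_iff_dist_tendsto_zero]
    refine squeeze_zero (fun j => dist_nonneg) h1 ?_
    simpa using (hpow (D / 2)).mul_const (Real.exp (κ * t))
  exact tendsto_nhds_unique h2 ((tendsto_add_atTop_iff_nat 1).2 (hf t))

/-- The weighted distance of two fixed points can be halved indefinitely. -/
theorem causal_fixedPoint_unique {E : Type*} [MetricSpace E]
    {Adm : (ℝ → E) → Prop} {Φ : (ℝ → E) → ℝ → E} (hcont : ∀ f, Adm f → Continuous f)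
    (hcontr : ∀ T, 0 ≤ T → ∃ κ : ℝ, 0 < κ ∧ ∀ f g, Adm f → Adm g → ∀ ρ : ℝ,
      (∀ s ∈ Set.Icc 0 T, dist (f s) (g s) ≤ ρ * Real.exp (κ * s)) →
      ∀ s ∈ Set.Icc 0 T, dist (Φ f s) (Φ g s) ≤ ρ / 2 * Real.exp (κ * s))
    {f g : ℝ → E} (hf : Adm f) (hg : Adm g) (hff : ∀ t, 0 ≤ t → Φ f t = f t)
    (hgg : ∀ t, 0 ≤ t → Φ g t = g t) {t : ℝ} (ht : 0 ≤ t) : f t = g t := by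
  obtain ⟨κ, hκ, hk⟩ := hcontr t ht
  obtain ⟨C, hC⟩ := (isCompact_Icc (a := (0 : ℝ)) (b := t)).bddAbove_image
    ((hcont _ hf).dist (hcont _ hg)).continuousOn
  have h : ∀ j : ℕ, ∀ s ∈ Set.Icc 0 t, dist (f s) (g s) ≤ C / 2 ^ j * Real.exp (κ * s) := by
    intro j
    induction j with
    | zero =>
      intro s hs
      have h1 := hC (Set.mem_image_of_mem _ hs)
      rw [pow_zero, div_one]
      exact h1.trans (le_mul_of_one_le_right (dist_nonneg.trans h1)
        (Real.one_le_exp (mul_nonneg hκ.le hs.1)))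
    | succ j ih =>
      intro s hs
      have := hk f g hf hg _ ih s hs
      rw [hff s hs.1, hgg s hs.1] at this
      rw [pow_succ, ← div_div]
      exact this
  have hlim : Tendsto (fun j : ℕ => C / 2 ^ j * Real.exp (κ * t)) atTop (𝓝 (0 * Real.exp (κ * t))) :=
    (tendsto_const_nhds.div_atTop (tendsto_pow_atTop_atTop_of_one_lt one_lt_two)).mul_const _
  rw [zero_mul] at hlim
  exact dist_le_zero.1 (ge_of_tendsto' hlim fun j => h j t ⟨ht, le_rfl⟩)

/-- The solution of `u' = -k u + g`, `u 0 = u₀`. -/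
noncomputable def relax (k u₀ : ℝ) (g : ℝ → ℝ) (t : ℝ) : ℝ :=
  Real.exp (-k * t) * (u₀ + ∫ s in (0 : ℝ)..t, Real.exp (k * s) * g s)

theorem relax_zero (k u₀ : ℝ) (g : ℝ → ℝ) : relax k u₀ g 0 = u₀ := by simp [relax]

theorem hasDerivAt_relax {k u₀ : ℝ} {g : ℝ → ℝ} (hg : Continuous g) (t : ℝ) :
    HasDerivAt (relax k u₀ g) (-k * relax k u₀ g t + g t) t := by
  have hc : Continuous fun s => Real.exp (k * s) * g s := by fun_prop
  have h1 := (hc.integral_hasStrictDerivAt 0 t).hasDerivAt.const_add u₀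
  have h2 := ((hasDerivAt_id t).const_mul (-k)).exp
  refine (h2.mul h1).congr_deriv ?_
  have h3 : Real.exp (-k * t) * Real.exp (k * t) = 1 := by rw [← Real.exp_add]; simp
  unfold relax
  simp only [id]
  linear_combination (g t) * h3

theorem le_relax {k u₀ : ℝ} {g : ℝ → ℝ} (hg : ∀ t, 0 ≤ g t) {t : ℝ} (ht : 0 ≤ t) :
    Real.exp (-k * t) * u₀ ≤ relax k u₀ g t := by
  unfold relax
  gcongr
  have : 0 ≤ ∫ s in (0 : ℝ)..t, Real.exp (k * s) * g s :=
    intervalIntegral.integral_nonneg ht fun s _ => mul_nonneg (Real.exp_pos _).le (hg s)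
  linarith

theorem abs_log_sub_log_le {a b Y : ℝ} (ha : 0 < a) (hb : 0 < b) (haY : a⁻¹ ≤ Y) (hbY : b⁻¹ ≤ Y) :
    |Real.log a - Real.log b| ≤ Y * |a - b| := by
  have key : ∀ a b : ℝ, 0 < a → 0 < b → b⁻¹ ≤ Y → Real.log a - Real.log b ≤ Y * |a - b| := by
    intro a b ha hb hbY
    rw [← Real.log_div ha.ne' hb.ne']
    have h1 := Real.log_le_sub_one_of_pos (div_pos ha hb)
    have h2 : a / b - 1 = b⁻¹ * (a - b) := by field_simp
    have h3 : b⁻¹ * (a - b) ≤ Y * |a - b| :=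
      (mul_le_mul_of_nonneg_left (le_abs_self _) (inv_pos.2 hb).le).trans
        (mul_le_mul_of_nonneg_right hbY (abs_nonneg _))
    linarith
  rw [abs_sub_le_iff]
  exact ⟨key a b ha hb hbY, by rw [abs_sub_comm]; exact key b a hb ha haY⟩

end NonlinearWalk

/-! ### The Picard map for the coefficients. -/

namespace NonlinearWalk

variable {c α B X : ℝ} {β : ℤ → ℝ} {L M : ℝ → ℝ}

theorem continuousOn_tsum_flow (hc : 0 < c) (hβ : ∀ n, 0 < β n) (hB : ∀ n, β n ≤ B)
    (hL : Continuous L) (hM : Continuous M) {q f : ℤ → ℝ} (hq0 : ∀ n, 0 ≤ q n)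
    (hq : MemB c α q) (hf : ExpBounded f) :
    ContinuousOn (fun s => ∑' n, f n * flow c β L M q 0 s n) (Set.Ici 0) := by
  intro s hs
  obtain ⟨X, hX0, hX⟩ := exists_rateBound hL hM c 0 (s + 1)
  exact ((isForward_flow hβ hB hL hM hq 0).hasDerivWithinAt_tsum hc hβ hB hX
    (weightBound_flow hβ hB hL hM hq0 hq hX) hf ⟨hs, by linarith⟩).continuousWithinAt

/-- The expectation of `f` along the flow, extended by a constant to negative times. -/
noncomputable def meanFlow (c : ℝ) (β : ℤ → ℝ) (p0 f : ℤ → ℝ) (L M : ℝ → ℝ) (t : ℝ) : ℝ :=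
  ∑' n, f n * flow c β L M p0 0 (max 0 t) n

theorem continuous_meanFlow (hc : 0 < c) (hβ : ∀ n, 0 < β n) (hB : ∀ n, β n ≤ B)
    (hL : Continuous L) (hM : Continuous M) {q f : ℤ → ℝ} (hq0 : ∀ n, 0 ≤ q n)
    (hq : MemB c α q) (hf : ExpBounded f) : Continuous (meanFlow c β q f L M) :=
  (continuousOn_tsum_flow hc hβ hB hL hM hq0 hq hf).comp_continuous
    (continuous_const.max continuous_id) fun _ => Set.mem_Ici.2 (le_max_left _ _)

theorem meanFlow_nonneg (hβ : ∀ n, 0 < β n) {q f : ℤ → ℝ} (hq0 : ∀ n, 0 ≤ q n)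
    (hf : ∀ n, 0 ≤ f n) (t : ℝ) : 0 ≤ meanFlow c β q f L M t :=
  tsum_nonneg fun n => mul_nonneg (hf n) (flow_nonneg hβ hq0 (le_max_left _ _) n)

/-- One step of the iteration for the coefficients `(L, M)`. -/
noncomputable def picardMap (c : ℝ) (β : ℤ → ℝ) (Cl Cm L0 M0 : ℝ) (p0 : ℤ → ℝ)
    (f : ℝ → ℝ × ℝ) (t : ℝ) : ℝ × ℝ :=
  (-Real.log (relax (c * Cl) (Real.exp (-c * L0)) (fun s => c * meanFlow c β p0 (rateUp c β 0)
      (fun s => (f s).1) (fun s => (f s).2) s) (max 0 t)) / c,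
    Real.log (relax (c * Cm) (Real.exp (c * M0)) (fun s => c * meanFlow c β p0 (rateDown c β 0)
      (fun s => (f s).1) (fun s => (f s).2) s) (max 0 t)) / c)

/-- The a priori bounds for the coefficients. -/
structure PicardAdm (Cl Cm L0 M0 : ℝ) (f : ℝ → ℝ × ℝ) : Prop where
  continuous : Continuous f
  eq_max : ∀ t, f t = f (max 0 t)
  fst_le : ∀ t, 0 ≤ t → (f t).1 ≤ L0 + Cl * t
  le_snd : ∀ t, 0 ≤ t → M0 - Cm * t ≤ (f t).2

/-- The bound of the rates on `[0, T]` which follows from the a priori bounds. -/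
noncomputable def admBound (c Cl Cm L0 M0 T : ℝ) : ℝ :=
  max (Real.exp (c * (L0 + Cl * T))) (Real.exp (-c * (M0 - Cm * T)))

theorem PicardAdm.rateBound (hc : 0 < c) {Cl Cm L0 M0 : ℝ} (hCl : 0 ≤ Cl) (hCm : 0 ≤ Cm)
    {f : ℝ → ℝ × ℝ} (hf : PicardAdm Cl Cm L0 M0 f) (T : ℝ) :
    RateBound c (admBound c Cl Cm L0 M0 T) 0 T (fun s => (f s).1) (fun s => (f s).2) := by
  intro s hs
  constructor
  · refine le_trans (Real.exp_le_exp.2 ?_) (le_max_left _ _)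
    have h1 := hf.fst_le s hs.1
    have h2 := mul_le_mul_of_nonneg_left hs.2 hCl
    exact mul_le_mul_of_nonneg_left (by linarith) hc.le
  · refine le_trans (Real.exp_le_exp.2 ?_) (le_max_right _ _)
    have h1 := hf.le_snd s hs.1
    have h2 := mul_le_mul_of_nonneg_left hs.2 hCm
    exact mul_le_mul_of_nonpos_left (by linarith) (by linarith)

theorem admBound_pos (c Cl Cm L0 M0 T : ℝ) : 0 < admBound c Cl Cm L0 M0 T :=
  lt_max_of_lt_left (Real.exp_pos _)

/-- A nonnegative source keeps the relaxation solution above e^{-kt} times its initial value; after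
taking logarithms this is the upper bound for L and the lower bound for M. No regularity beyond
continuity of the source is needed. -/
theorem picardAdm_of_relax (hc : 0 < c) {Cl Cm L0 M0 : ℝ} {g g' : ℝ → ℝ}
    (hg : Continuous g) (hg' : Continuous g') (hg0 : ∀ t, 0 ≤ g t) (hg0' : ∀ t, 0 ≤ g' t) :
    PicardAdm Cl Cm L0 M0 (fun t =>
      (-Real.log (relax (c * Cl) (Real.exp (-c * L0)) g (max 0 t)) / c,
        Real.log (relax (c * Cm) (Real.exp (c * M0)) g' (max 0 t)) / c)) := by
  have hpos : ∀ t, 0 ≤ t → 0 < relax (c * Cl) (Real.exp (-c * L0)) g t := fun t ht =>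
    lt_of_lt_of_le (mul_pos (Real.exp_pos _) (Real.exp_pos _)) (le_relax hg0 ht)
  have hpos' : ∀ t, 0 ≤ t → 0 < relax (c * Cm) (Real.exp (c * M0)) g' t := fun t ht =>
    lt_of_lt_of_le (mul_pos (Real.exp_pos _) (Real.exp_pos _)) (le_relax hg0' ht)
  have hrc : Continuous (relax (c * Cl) (Real.exp (-c * L0)) g) :=
    continuous_iff_continuousAt.2 fun t => (hasDerivAt_relax hg t).continuousAt
  have hrc' : Continuous (relax (c * Cm) (Real.exp (c * M0)) g') :=
    continuous_iff_continuousAt.2 fun t => (hasDerivAt_relax hg' t).continuousAt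
  have hm : Continuous fun t : ℝ => max 0 t := continuous_const.max continuous_id
  refine ⟨?_, fun t => ?_, fun t ht => ?_, fun t ht => ?_⟩
  · refine Continuous.prodMk ?_ ?_
    · exact (((hrc.comp hm).log fun t => (hpos _ (le_max_left _ _)).ne').neg).div_const _
    · exact ((hrc'.comp hm).log fun t => (hpos' _ (le_max_left _ _)).ne').div_const _
  · simp
  · simp only [max_eq_right ht]
    rw [div_le_iff₀ hc, neg_le, Real.le_log_iff_exp_le (hpos t ht)]
    refine le_trans (le_of_eq ?_) (le_relax hg0 ht)
    rw [← Real.exp_add]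
    congr 1; ring
  · simp only [max_eq_right ht]
    rw [le_div_iff₀ hc, Real.le_log_iff_exp_le (hpos' t ht)]
    refine le_trans (le_of_eq ?_) (le_relax hg0' ht)
    rw [← Real.exp_add]
    congr 1; ring

section

variable {Cl Cm L0 M0 : ℝ} {p0 : ℤ → ℝ}

theorem PicardAdm.picardMap (hc : 0 < c) (hβ : ∀ n, 0 < β n) (hB : ∀ n, β n ≤ B)
    (hp0 : ∀ n, 0 ≤ p0 n) (hp0B : MemB c α p0)
    {f : ℝ → ℝ × ℝ} (hf : Continuous f) :
    PicardAdm Cl Cm L0 M0 (picardMap c β Cl Cm L0 M0 p0 f) := by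
  refine picardAdm_of_relax hc ?_ ?_ ?_ ?_
  · exact continuous_const.mul (continuous_meanFlow hc hβ hB hf.fst hf.snd hp0 hp0B
      (expBounded_rateUp hc hβ hB 0))
  · exact continuous_const.mul (continuous_meanFlow hc hβ hB hf.fst hf.snd hp0 hp0B
      (expBounded_rateDown hc hβ hB 0))
  · exact fun t => mul_nonneg hc.le (meanFlow_nonneg hβ hp0 (fun n => (rateUp_pos hβ _ _).le) t)
  · exact fun t => mul_nonneg hc.le (meanFlow_nonneg hβ hp0 (fun n => (rateDown_pos hβ _ _).le) t)

theorem abs_relax_sub_le {k u₀ T G κ : ℝ} (hk : 0 ≤ k) (hG : 0 ≤ G) {g g' : ℝ → ℝ}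
    (hg : Continuous g) (hg' : Continuous g')
    (h : ∀ s ∈ Set.Icc 0 T, |g s - g' s| ≤ G * κ * Real.exp (κ * s)) :
    ∀ s ∈ Set.Icc 0 T, |relax k u₀ g s - relax k u₀ g' s| ≤ G * Real.exp (κ * s) :=
  abs_le_of_damped (f := fun s => relax k u₀ g s - relax k u₀ g' s) (h := fun _ => k)
    (g := fun s => g s - g' s) hG
    (fun s _ => (((hasDerivAt_relax hg s).sub (hasDerivAt_relax hg' s)).congr_deriv
      (by ring)).hasDerivWithinAt)
    (fun _ _ => hk) (by simp [relax_zero]) h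

theorem ExpBounded.exists_tsum_abs_le (hc : 0 < c) {f : ℤ → ℝ} (hf : ExpBounded f) (α : ℝ) :
    ∃ S : ℝ, 0 ≤ S ∧ ∀ (q q' : ℤ → ℝ) (b : ℝ), Summable (fun n => f n * q n) →
      Summable (fun n => f n * q' n) → (∀ n, |q n - q' n| * weight c α n ≤ b) →
      |∑' n, f n * q n - ∑' n, f n * q' n| ≤ S * b := by
  have hs : Summable fun n => |f n| * (1 / weight c α n) := by
    have := (hf.summable_mul hc (α := α) (R := 1) (q := fun n => 1 / weight c α n)
      (fun n => by
        rw [abs_of_pos (one_div_pos.2 (weight_pos _ _ _)),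
          one_div_mul_cancel (weight_pos _ _ _).ne'])).abs
    simpa [abs_mul, abs_of_pos (weight_pos c α _)] using this
  refine ⟨∑' n, |f n| * (1 / weight c α n), tsum_nonneg fun n => mul_nonneg (abs_nonneg _)
    (one_div_pos.2 (weight_pos _ _ _)).le, fun q q' b hq hq' hb => ?_⟩
  rw [← hq.tsum_sub hq', ← tsum_mul_right, ← Real.norm_eq_abs]
  refine tsum_of_norm_bounded (hs.mul_right b).hasSum fun n => ?_
  have h1 : |q n - q' n| ≤ b / weight c α n := (le_div_iff₀ (weight_pos _ _ _)).2 (hb n)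
  rw [← mul_sub, Real.norm_eq_abs, abs_mul, mul_assoc, one_div_mul_eq_div]
  exact mul_le_mul_of_nonneg_left h1 (abs_nonneg _)

/-- Coefficients at weighted distance ρ give flows at distance O(ρ/κ) in the weaker weight, hence
mean rates at distance O(ρ/κ); the relaxation equation gains another 1/κ, and the logarithm is
Lipschitz because the relaxation solutions are bounded below on [0, T]. A large κ makes the total
factor at most 1/2. -/
theorem picardMap_contracting (hc : 0 < c) (hCl : 0 < Cl) (hCm : 0 < Cm) (hβ : ∀ n, 0 < β n)
    (hB : ∀ n, β n ≤ B) (hp0 : ∀ n, 0 ≤ p0 n) (hp0B : MemB c α p0) (T : ℝ) (hT : 0 ≤ T) :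
    ∃ κ : ℝ, 0 < κ ∧ ∀ f g, PicardAdm Cl Cm L0 M0 f → PicardAdm Cl Cm L0 M0 g → ∀ ρ : ℝ,
      (∀ s ∈ Set.Icc 0 T, dist (f s) (g s) ≤ ρ * Real.exp (κ * s)) →
      ∀ s ∈ Set.Icc 0 T, dist (picardMap c β Cl Cm L0 M0 p0 f s)
        (picardMap c β Cl Cm L0 M0 p0 g s) ≤ ρ / 2 * Real.exp (κ * s) := by
  set X := admBound c Cl Cm L0 M0 T with hXdef
  have hX0 : 0 < X := admBound_pos _ _ _ _ _ _
  set R := normB c α p0 * Real.exp (growth c α B X * (T - 0)) with hR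
  have hR0 : 0 ≤ R := mul_nonneg (tsum_nonneg fun n => mul_nonneg (abs_nonneg _)
    (weight_pos _ _ _).le) (Real.exp_pos _).le
  have hCo : 0 ≤ coefConst c α B X := coefConst_nonneg hc hβ hB hX0.le
  have hu := expBounded_rateUp hc hβ hB 0
  have hd := expBounded_rateDown hc hβ hB 0
  obtain ⟨S, hS0, hS⟩ := hu.exists_tsum_abs_le hc (α - c)
  obtain ⟨S', hS0', hS'⟩ := hd.exists_tsum_abs_le hc (α - c)
  set D := 2 * (coefConst c α B X * R) * (S + S') with hD
  have hD0 : 0 ≤ D := by positivity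
  -- The entry with `growth` is what the stability estimate demands; the other two give X D ≤ κ²/2.
  set κ := max (max 1 (2 * growth c (α - c) B X)) (2 * (X * D)) with hκdef
  have hκ1 : 1 ≤ κ := (le_max_left _ _).trans (le_max_left _ _)
  have hκ2 : 2 * growth c (α - c) B X ≤ κ := (le_max_right _ _).trans (le_max_left _ _)
  have hκ3 : 2 * (X * D) ≤ κ := le_max_right _ _
  have hκ0 : 0 < κ := by linarith
  refine ⟨κ, hκ0, fun f g hf hg ρ hρ => ?_⟩
  have hρ0 : 0 ≤ ρ := nonneg_of_mul_nonneg_left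
    (dist_nonneg.trans (hρ 0 ⟨le_rfl, hT⟩)) (Real.exp_pos _)
  have hXf := hf.rateBound hc hCl.le hCm.le T
  have hXg := hg.rateBound hc hCl.le hCm.le T
  have hWf := weightBound_flow (α := α) hβ hB hf.continuous.fst hf.continuous.snd hp0 hp0B hXf
  have hWg := weightBound_flow (α := α) hβ hB hg.continuous.fst hg.continuous.snd hp0 hp0B hXg
  have hstab : ∀ s ∈ Set.Icc 0 T, ∀ n, _ := fun s hs n =>
    forward_stability (α := α) (ρ := ρ) (κ := κ) hc hβ hB hXf hXg
    (isForward_flow hβ hB hf.continuous.fst hf.continuous.snd hp0B 0)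
    (isForward_flow hβ hB hg.continuous.fst hg.continuous.snd hp0B 0)
    (funext fun n => by rw [flow_self, flow_self]) hWf hWg
    (fun s hs => by
      have := hρ s hs
      rw [Prod.dist_eq, max_le_iff, Real.dist_eq, Real.dist_eq] at this
      exact this) hκ0 hκ2 hs n
  have hmean : ∀ (φ : ℤ → ℝ) (Sφ : ℝ), ExpBounded φ → 0 ≤ Sφ → Sφ ≤ S + S' →
      (∀ (q q' : ℤ → ℝ) (b : ℝ), Summable (fun n => φ n * q n) →
      Summable (fun n => φ n * q' n) → (∀ n, |q n - q' n| * weight c (α - c) n ≤ b) →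
      |∑' n, φ n * q n - ∑' n, φ n * q' n| ≤ Sφ * b) →
      ∀ s ∈ Set.Icc 0 T,
        |c * meanFlow c β p0 φ (fun s => (f s).1) (fun s => (f s).2) s
          - c * meanFlow c β p0 φ (fun s => (g s).1) (fun s => (g s).2) s|
        ≤ (c * D * ρ / κ ^ 2) * κ * Real.exp (κ * s) := by
    intro φ Sφ hφ hSφ0 hSφ h s hs
    have h1 := h _ _ _ (hφ.summable_mul hc (hWf s hs)) (hφ.summable_mul hc (hWg s hs))
      (hstab s hs)
    rw [← mul_sub, abs_mul, abs_of_pos hc]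
    unfold meanFlow
    rw [max_eq_right hs.1]
    have e : c * D * ρ / κ ^ 2 * κ * Real.exp (κ * s)
        = c * ((S + S') * (2 * (coefConst c α B X * R * ρ / κ) * Real.exp (κ * s))) := by
      rw [hD]; field_simp
    rw [e]
    refine mul_le_mul_of_nonneg_left (h1.trans ?_) hc.le
    gcongr
  have hsmall : X * D * ρ / κ ^ 2 ≤ ρ / 2 := by
    rw [div_le_iff₀ (by positivity)]
    have : X * D ≤ κ ^ 2 / 2 := by nlinarith
    nlinarith
  -- The reciprocal of a relaxation solution is e^{cL} or e^{-cM}, so the a priori bound `X` of the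
  -- rates serves also as the Lipschitz constant of the logarithm.
  have hinv : ∀ (a u x t s : ℝ), 0 ≤ a → s ≤ T → Real.exp (-a * s) * x ≤ u → 0 < x →
      Real.exp (a * T) * x⁻¹ ≤ X → u⁻¹ ≤ X := by
    intro a u x t s ha hs hu hx h
    refine le_trans ?_ h
    have h1 : Real.exp (-a * T) * x ≤ u := by
      refine le_trans (mul_le_mul_of_nonneg_right (Real.exp_le_exp.2 ?_) hx.le) hu
      nlinarith
    refine (inv_anti₀ (mul_pos (Real.exp_pos _) hx) h1).trans (le_of_eq ?_)
    rw [mul_inv, ← Real.exp_neg]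
    congr 2; ring
  have hcu : ∀ f, PicardAdm Cl Cm L0 M0 f → Continuous fun s => c * meanFlow c β p0
      (rateUp c β 0) (fun s => (f s).1) (fun s => (f s).2) s := fun f hf =>
    continuous_const.mul (continuous_meanFlow hc hβ hB hf.continuous.fst hf.continuous.snd hp0
      hp0B hu)
  have hcd : ∀ f, PicardAdm Cl Cm L0 M0 f → Continuous fun s => c * meanFlow c β p0
      (rateDown c β 0) (fun s => (f s).1) (fun s => (f s).2) s := fun f hf =>
    continuous_const.mul (continuous_meanFlow hc hβ hB hf.continuous.fst hf.continuous.snd hp0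
      hp0B hd)
  have hnu : ∀ f : ℝ → ℝ × ℝ, ∀ t, 0 ≤ c * meanFlow c β p0
      (rateUp c β 0) (fun s => (f s).1) (fun s => (f s).2) t := fun f t =>
    mul_nonneg hc.le (meanFlow_nonneg hβ hp0 (fun n => (rateUp_pos hβ _ _).le) t)
  have hnd : ∀ f : ℝ → ℝ × ℝ, ∀ t, 0 ≤ c * meanFlow c β p0
      (rateDown c β 0) (fun s => (f s).1) (fun s => (f s).2) t := fun f t =>
    mul_nonneg hc.le (meanFlow_nonneg hβ hp0 (fun n => (rateDown_pos hβ _ _).le) t)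
  have hlog : ∀ (u u' s : ℝ), 0 < u → 0 < u' → u⁻¹ ≤ X → u'⁻¹ ≤ X →
      |u - u'| ≤ c * D * ρ / κ ^ 2 * Real.exp (κ * s) →
      |Real.log u - Real.log u'| / c ≤ ρ / 2 * Real.exp (κ * s) := by
    intro u u' s hu hu' hi hi' h
    rw [div_le_iff₀ hc]
    calc |Real.log u - Real.log u'| ≤ X * |u - u'| := abs_log_sub_log_le hu hu' hi hi'
      _ ≤ X * (c * D * ρ / κ ^ 2 * Real.exp (κ * s)) := by gcongr
      _ = X * D * ρ / κ ^ 2 * Real.exp (κ * s) * c := by ring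
      _ ≤ _ := by gcongr
  have hG0 : 0 ≤ c * D * ρ / κ ^ 2 := by positivity
  intro s hs
  rw [Prod.dist_eq]
  refine max_le ?_ ?_
  · have hb := abs_relax_sub_le (k := c * Cl) (u₀ := Real.exp (-c * L0)) (by positivity) hG0
      (hcu f hf) (hcu g hg) (hmean _ S hu hS0 (by linarith) hS) s hs
    have hl := fun f => le_relax (k := c * Cl) (u₀ := Real.exp (-c * L0)) (hnu f) hs.1
    have hX1 : Real.exp (c * Cl * T) * (Real.exp (-c * L0))⁻¹ ≤ X := by
      refine le_trans (le_of_eq ?_) (le_max_left _ _)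
      rw [← Real.exp_neg, ← Real.exp_add]; congr 1; ring
    have h0 : 0 < Real.exp (-(c * Cl) * s) * Real.exp (-c * L0) := by positivity
    have := hlog _ _ s (h0.trans_le (hl f)) (h0.trans_le (hl g))
      (hinv (c * Cl) _ _ 0 s (by positivity) hs.2 (hl f) (Real.exp_pos _) hX1)
      (hinv (c * Cl) _ _ 0 s (by positivity) hs.2 (hl g) (Real.exp_pos _) hX1) hb
    refine le_trans (le_of_eq ?_) this
    simp only [NonlinearWalk.picardMap, max_eq_right hs.1]
    rw [dist_comm, Real.dist_eq, ← sub_div, abs_div, abs_of_pos hc]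
    congr 2; ring
  · have hb := abs_relax_sub_le (k := c * Cm) (u₀ := Real.exp (c * M0)) (by positivity) hG0
      (hcd f hf) (hcd g hg) (hmean _ S' hd hS0' (by linarith) hS') s hs
    have hl := fun f => le_relax (k := c * Cm) (u₀ := Real.exp (c * M0)) (hnd f) hs.1
    have hX1 : Real.exp (c * Cm * T) * (Real.exp (c * M0))⁻¹ ≤ X := by
      refine le_trans (le_of_eq ?_) (le_max_right _ _)
      rw [← Real.exp_neg, ← Real.exp_add]; congr 1; ring
    have h0 : 0 < Real.exp (-(c * Cm) * s) * Real.exp (c * M0) := by positivity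
    have := hlog _ _ s (h0.trans_le (hl f)) (h0.trans_le (hl g))
      (hinv (c * Cm) _ _ 0 s (by positivity) hs.2 (hl f) (Real.exp_pos _) hX1)
      (hinv (c * Cm) _ _ 0 s (by positivity) hs.2 (hl g) (Real.exp_pos _) hX1) hb
    refine le_trans (le_of_eq ?_) this
    simp only [NonlinearWalk.picardMap, max_eq_right hs.1]
    rw [Real.dist_eq, ← sub_div, abs_div, abs_of_pos hc]

theorem exists_picard_fixedPoint (hc : 0 < c) (hCl : 0 < Cl) (hCm : 0 < Cm) (hβ : ∀ n, 0 < β n)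
    (hB : ∀ n, β n ≤ B) (hp0 : ∀ n, 0 ≤ p0 n) (hp0B : MemB c α p0) (L0 M0 : ℝ) :
    ∃ f, PicardAdm Cl Cm L0 M0 f ∧ ∀ t, 0 ≤ t → picardMap c β Cl Cm L0 M0 p0 f t = f t := by
  refine exists_causal_fixedPoint (fun f hf => hf.continuous) (fun f hf => hf.eq_max)
    (fun f hf => PicardAdm.picardMap hc hβ hB hp0 hp0B hf.continuous) ?_
    (picardMap_contracting hc hCl hCm hβ hB hp0 hp0B) (f₀ := fun _ => (L0, M0)) ?_
  · intro F f hF hf hlim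
    refine ⟨hf, fun t => ?_, fun t ht => ?_, fun t ht => ?_⟩
    · refine tendsto_nhds_unique (hlim t) ((hlim (max 0 t)).congr fun j => ?_)
      exact ((hF j).eq_max t).symm
    · exact le_of_tendsto' ((continuous_fst.tendsto _).comp (hlim t)) fun j => (hF j).fst_le t ht
    · exact ge_of_tendsto' ((continuous_snd.tendsto _).comp (hlim t)) fun j => (hF j).le_snd t ht
  · refine ⟨continuous_const, fun t => rfl, fun t ht => ?_, fun t ht => ?_⟩
    · have := mul_nonneg hCl.le ht; dsimp only; linarith
    · have := mul_nonneg hCm.le ht; dsimp only; linarith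

end

end NonlinearWalk

/-! ### Solutions of the nonlinear system as fixed points. -/

namespace NonlinearWalk

variable {c α B X : ℝ} {β : ℤ → ℝ} {L M : ℝ → ℝ} {Cl Cm L0 M0 : ℝ} {p0 : ℤ → ℝ}

theorem tsum_mul_rateUp (q : ℤ → ℝ) (l : ℝ) :
    ∑' n, q n * rateUp c β l n = Real.exp (c * l) * ∑' n, rateUp c β 0 n * q n := by
  rw [← tsum_mul_left]
  refine tsum_congr fun n => ?_
  rw [rateUp_eq]; ring

theorem tsum_mul_rateDown (q : ℤ → ℝ) (l : ℝ) :
    ∑' n, q n * rateDown c β l n = Real.exp (-c * l) * ∑' n, rateDown c β 0 n * q n := by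
  rw [← tsum_mul_left]
  refine tsum_congr fun n => ?_
  rw [rateDown_eq]; ring

theorem relax_pos {k u₀ : ℝ} (hu : 0 < u₀) {g : ℝ → ℝ} (hg : ∀ t, 0 ≤ g t) {t : ℝ} (ht : 0 ≤ t) :
    0 < relax k u₀ g t :=
  (mul_pos (Real.exp_pos _) hu).trans_le (le_relax hg ht)

theorem hasDerivAt_log_relax {k u₀ : ℝ} (hu : 0 < u₀) {g : ℝ → ℝ} (hgc : Continuous g)
    (hg : ∀ t, 0 ≤ g t) {t : ℝ} (ht : 0 ≤ t) :
    HasDerivAt (fun t => Real.log (relax k u₀ g t)) (-k + g t / relax k u₀ g t) t := by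
  have hp := (relax_pos (k := k) hu hg ht).ne'
  refine ((hasDerivAt_relax hgc t).log hp).congr_deriv ?_
  field_simp

/-- The unique solution of a scalar relaxation equation. -/
theorem eq_relax {k : ℝ} (hk : 0 ≤ k) {u g : ℝ → ℝ} (hg : Continuous g)
    (hu : ∀ t, 0 ≤ t → HasDerivWithinAt u (-k * u t + g t) (Set.Ici 0) t) {t : ℝ} (ht : 0 ≤ t) :
    u t = relax k (u 0) g t := by
  have h := abs_le_of_damped (f := fun s => u s - relax k (u 0) g s) (h := fun _ => k)
    (g := fun _ => 0) (a := 0) (T := t) (G := 0) (κ := 0) le_rfl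
    (fun s hs => ((hu s hs.1).sub (hasDerivAt_relax hg s).hasDerivWithinAt).congr_deriv (by ring))
    (fun _ _ => hk) (by simp [relax_zero]) (by simp) t ⟨ht, le_rfl⟩
  rw [zero_mul] at h
  exact sub_eq_zero.1 (abs_nonpos_iff.1 h)

/-- Undoing the substitution: at a fixed point e^{cL} is the reciprocal of the relaxation solution,
so the quotient in its logarithmic derivative is c times the mean rate with the true L; similarly
for M. -/
theorem isSolution_of_fixedPoint (hc : 0 < c) (hβ : ∀ n, 0 < β n)
    (hB : ∀ n, β n ≤ B) (hp0 : ∀ n, 0 ≤ p0 n) (hp0B : MemB c α p0) {f : ℝ → ℝ × ℝ}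
    (hf : PicardAdm Cl Cm L0 M0 f)
    (hfix : ∀ t, 0 ≤ t → picardMap c β Cl Cm L0 M0 p0 f t = f t) :
    IsSolution c α β Cl Cm L0 M0 p0 (fun t => (f t).1) (fun t => (f t).2)
      (flow c β (fun t => (f t).1) (fun t => (f t).2) p0 0) := by
  have hL := hf.continuous.fst
  have hM := hf.continuous.snd
  have hu0 : ∀ t, 0 ≤ c * meanFlow c β p0 (rateUp c β 0) (fun t => (f t).1) (fun t => (f t).2) t :=
    fun t => mul_nonneg hc.le (meanFlow_nonneg hβ hp0 (fun n => (rateUp_pos hβ _ _).le) t)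
  have hd0 : ∀ t, 0 ≤ c * meanFlow c β p0 (rateDown c β 0) (fun t => (f t).1)
    (fun t => (f t).2) t :=
    fun t => mul_nonneg hc.le (meanFlow_nonneg hβ hp0 (fun n => (rateDown_pos hβ _ _).le) t)
  have huc : Continuous fun t => c * meanFlow c β p0 (rateUp c β 0) (fun t => (f t).1)
      (fun t => (f t).2) t :=
    continuous_const.mul (continuous_meanFlow hc hβ hB hL hM hp0 hp0B
      (expBounded_rateUp hc hβ hB 0))
  have hdc : Continuous fun t => c * meanFlow c β p0 (rateDown c β 0) (fun t => (f t).1)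
      (fun t => (f t).2) t :=
    continuous_const.mul (continuous_meanFlow hc hβ hB hL hM hp0 hp0B
      (expBounded_rateDown hc hβ hB 0))
  have h1 : ∀ t, 0 ≤ t → (f t).1 = -Real.log (relax (c * Cl) (Real.exp (-c * L0))
      (fun s => c * meanFlow c β p0 (rateUp c β 0) (fun s => (f s).1) (fun s => (f s).2) s) t) / c := by
    intro t ht
    rw [← hfix t ht]
    simp only [picardMap, max_eq_right ht]
  have h2 : ∀ t, 0 ≤ t → (f t).2 = Real.log (relax (c * Cm) (Real.exp (c * M0))
      (fun s => c * meanFlow c β p0 (rateDown c β 0) (fun s => (f s).1) (fun s => (f s).2) s) t) / c := by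
    intro t ht
    rw [← hfix t ht]
    simp only [picardMap, max_eq_right ht]
  refine ⟨?_, ?_, funext fun n => flow_self _ _ n, fun t ht => memB_flow hβ hB hL hM hp0 hp0B ht,
    fun t ht => tendsto_normB_flow hβ hB hL hM hp0 hp0B ht,
    fun t ht n => isForward_flow hβ hB hL hM hp0B 0 t ht n, fun t ht => ?_, fun t ht => ?_⟩
  · rw [h1 0 le_rfl, relax_zero, Real.log_exp]; field_simp
  · rw [h2 0 le_rfl, relax_zero, Real.log_exp]; field_simp
  · have hr := relax_pos (k := c * Cl) (Real.exp_pos (-c * L0)) hu0 ht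
    have hd := ((hasDerivAt_log_relax (k := c * Cl) (Real.exp_pos (-c * L0)) huc hu0 ht).neg.div_const
      c).hasDerivWithinAt (s := Set.Ici 0)
    refine (hd.congr_of_mem h1 ht).congr_deriv ?_
    have he : Real.exp (c * (f t).1) = (relax (c * Cl) (Real.exp (-c * L0))
      (fun s => c * meanFlow c β p0 (rateUp c β 0) (fun s => (f s).1) (fun s => (f s).2) s) t)⁻¹ := by
      rw [h1 t ht, mul_div_cancel₀ _ hc.ne', Real.exp_neg, Real.exp_log hr]
    rw [tsum_mul_rateUp, he]
    conv_lhs => rw [meanFlow, max_eq_right ht]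
    field_simp
    ring
  · have hr := relax_pos (k := c * Cm) (Real.exp_pos (c * M0)) hd0 ht
    have hd := ((hasDerivAt_log_relax (k := c * Cm) (Real.exp_pos (c * M0)) hdc hd0 ht).div_const
      c).hasDerivWithinAt (s := Set.Ici 0)
    refine (hd.congr_of_mem h2 ht).congr_deriv ?_
    have he : Real.exp (-c * (f t).2) = (relax (c * Cm) (Real.exp (c * M0))
      (fun s => c * meanFlow c β p0 (rateDown c β 0) (fun s => (f s).1) (fun s => (f s).2) s) t)⁻¹ := by
      rw [h2 t ht, neg_mul, mul_div_cancel₀ _ hc.ne', Real.exp_neg, Real.exp_log hr]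
    rw [tsum_mul_rateDown, he]
    conv_lhs => rw [meanFlow, max_eq_right ht]
    field_simp
    ring

theorem MemB.sub {p q : ℤ → ℝ} (hp : MemB c α p) (hq : MemB c α q) :
    MemB c α (fun n => p n - q n) := by
  refine Summable.of_nonneg_of_le (fun n => mul_nonneg (abs_nonneg _) (weight_pos _ _ _).le)
    (fun n => ?_) (Summable.add hp hq)
  rw [← add_mul]
  exact mul_le_mul_of_nonneg_right (abs_sub _ _) (weight_pos _ _ _).le

theorem normB_le_add {p q : ℤ → ℝ} (hp : MemB c α p) (hq : MemB c α q) :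
    normB c α p ≤ normB c α q + normB c α (fun n => p n - q n) := by
  unfold normB
  rw [← Summable.tsum_add hq (hp.sub hq)]
  refine Summable.tsum_le_tsum (fun n => ?_) hp (Summable.add hq (hp.sub hq))
  rw [← add_mul]
  refine mul_le_mul_of_nonneg_right ?_ (weight_pos _ _ _).le
  calc |p n| = |q n + (p n - q n)| := by ring_nf
    _ ≤ _ := abs_add_le _ _

theorem normB_sub_comm (p q : ℤ → ℝ) :
    normB c α (fun n => p n - q n) = normB c α (fun n => q n - p n) := by
  unfold normB; simp only [abs_sub_comm]

/-- Continuity in B makes the norm bounded on compact time intervals. This puts an arbitrary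
solution into the uniqueness class of the linear forward equations. -/
theorem IsSolution.exists_weightBound {p : ℝ → ℤ → ℝ}
    (h : IsSolution c α β Cl Cm L0 M0 p0 L M p) (T : ℝ) : ∃ R, WeightBound c α R 0 T p := by
  have hcont : ContinuousOn (fun t => normB c α (p t)) (Set.Ici 0) := by
    intro t ht
    refine tendsto_iff_dist_tendsto_zero.2 ?_
    refine squeeze_zero' (Eventually.of_forall fun _ => dist_nonneg) ?_ (h.continuous_p t ht)
    filter_upwards [self_mem_nhdsWithin] with u hu
    rw [Real.dist_eq, abs_sub_le_iff]
    have h1 := normB_le_add (h.memB u hu) (h.memB t ht)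
    have h2 := normB_le_add (h.memB t ht) (h.memB u hu)
    rw [normB_sub_comm] at h2
    constructor <;> linarith
  obtain ⟨R, hR⟩ := (isCompact_Icc (a := (0 : ℝ)) (b := T)).bddAbove_image
    (hcont.mono Set.Icc_subset_Ici_self)
  exact ⟨R, fun s hs n => ((h.memB s hs.1).abs_mul_weight_le n).trans
    (hR (Set.mem_image_of_mem _ hs))⟩

/-- Every solution comes from a fixed point of the iteration map. -/
theorem IsSolution.picardMap_eq (hc : 0 < c) (hCl : 0 < Cl) (hCm : 0 < Cm) (hβ : ∀ n, 0 < β n)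
    (hB : ∀ n, β n ≤ B) (hp0 : ∀ n, 0 ≤ p0 n) (hp0B : MemB c α p0) {p : ℝ → ℤ → ℝ}
    (h : IsSolution c α β Cl Cm L0 M0 p0 L M p) {f : ℝ → ℝ × ℝ}
    (hf : f = fun t => (L (max 0 t), M (max 0 t))) :
    picardMap c β Cl Cm L0 M0 p0 f = f ∧
      ∀ t, 0 ≤ t → p t = flow c β (fun t => (f t).1) (fun t => (f t).2) p0 0 t := by
  have hLc : Continuous fun t => L (max 0 t) :=
    ContinuousOn.comp_continuous (s := Set.Ici 0) (fun t ht => (h.deriv_L t ht).continuousWithinAt)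
      (continuous_const.max continuous_id) fun _ => Set.mem_Ici.2 (le_max_left _ _)
  have hMc : Continuous fun t => M (max 0 t) :=
    ContinuousOn.comp_continuous (s := Set.Ici 0) (fun t ht => (h.deriv_M t ht).continuousWithinAt)
      (continuous_const.max continuous_id) fun _ => Set.mem_Ici.2 (le_max_left _ _)
  have hp : ∀ t, 0 ≤ t → p t = flow c β (fun t => L (max 0 t)) (fun t => M (max 0 t)) p0 0 t := by
    intro t ht
    obtain ⟨R, hR⟩ := h.exists_weightBound t
    have hfw : IsForward c β (fun t => L (max 0 t)) (fun t => M (max 0 t)) 0 p := by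
      intro s hs n
      simp only [max_eq_right hs]
      exact h.deriv_p s hs n
    have := hfw.eq_flow hc hβ hB hLc hMc hR ht (by rw [h.init_p]; exact hp0)
      (by rw [h.init_p]; exact hp0B)
    rw [h.init_p] at this
    exact this
  subst hf
  refine ⟨?_, hp⟩
  have hmean : ∀ (φ : ℤ → ℝ) t, 0 ≤ t →
      meanFlow c β p0 φ (fun t => L (max 0 t)) (fun t => M (max 0 t)) t
        = ∑' n, φ n * p t n := by
    intro φ t ht
    rw [meanFlow, max_eq_right ht, hp t ht]
  -- Multiplying the equation for L by -c e^{-cL} cancels the e^{cL} in the mean rate and leaves a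
  -- linear equation.
  have hu : ∀ t, 0 ≤ t → Real.exp (-c * L t) = relax (c * Cl) (Real.exp (-c * L 0))
      (fun s => c * meanFlow c β p0 (rateUp c β 0) (fun t => L (max 0 t))
        (fun t => M (max 0 t)) s) t := by
    intro t ht
    refine eq_relax (u := fun t => Real.exp (-c * L t)) (by positivity)
      (continuous_const.mul (continuous_meanFlow hc hβ hB hLc hMc hp0 hp0B
        (expBounded_rateUp hc hβ hB 0))) (fun s hs => ?_) ht
    refine (((h.deriv_L s hs).const_mul (-c)).exp).congr_deriv ?_
    simp only [Pi.mul_apply]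
    rw [hmean _ s hs, tsum_mul_rateUp]
    have : Real.exp (-c * L s) * Real.exp (c * L s) = 1 := by rw [← Real.exp_add]; simp
    linear_combination (c * ∑' n, rateUp c β 0 n * p s n) * this
  have hv : ∀ t, 0 ≤ t → Real.exp (c * M t) = relax (c * Cm) (Real.exp (c * M 0))
      (fun s => c * meanFlow c β p0 (rateDown c β 0) (fun t => L (max 0 t))
        (fun t => M (max 0 t)) s) t := by
    intro t ht
    refine eq_relax (u := fun t => Real.exp (c * M t)) (by positivity)
      (continuous_const.mul (continuous_meanFlow hc hβ hB hLc hMc hp0 hp0B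
        (expBounded_rateDown hc hβ hB 0))) (fun s hs => ?_) ht
    refine (((h.deriv_M s hs).const_mul c).exp).congr_deriv ?_
    simp only [Pi.mul_apply]
    rw [hmean _ s hs, tsum_mul_rateDown]
    have : Real.exp (c * M s) * Real.exp (-c * M s) = 1 := by rw [← Real.exp_add]; simp
    linear_combination (c * ∑' n, rateDown c β 0 n * p s n) * this
  funext t
  have ht : 0 ≤ max 0 t := le_max_left _ _
  have e1 := hu _ ht
  have e2 := hv _ ht
  rw [h.init_L] at e1
  rw [h.init_M] at e2
  simp only [picardMap]
  rw [← e1, ← e2, Real.log_exp, Real.log_exp]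
  ext
  · dsimp only; field_simp
  · dsimp only; field_simp

/-- Global existence and uniqueness for the nonlinear system. -/
theorem exists_unique_solution (hc : 0 < c) (hCl : 0 < Cl) (hCm : 0 < Cm) (hβ : ∀ n, 0 < β n)
    (hB : ∀ n, β n ≤ B) (hp0 : ∀ n, 0 ≤ p0 n) (hp0B : MemB c α p0) (L0 M0 : ℝ) :
    ∃ L M : ℝ → ℝ, Continuous L ∧ Continuous M ∧
      IsSolution c α β Cl Cm L0 M0 p0 L M (flow c β L M p0 0) ∧
      ∀ (L' M' : ℝ → ℝ) (p' : ℝ → ℤ → ℝ), IsSolution c α β Cl Cm L0 M0 p0 L' M' p' →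
        ∀ t, 0 ≤ t → L' t = L t ∧ M' t = M t ∧ p' t = flow c β L M p0 0 t := by
  obtain ⟨f, hf, hfix⟩ := exists_picard_fixedPoint (Cl := Cl) (Cm := Cm) hc hCl hCm hβ hB hp0 hp0B
    L0 M0
  refine ⟨_, _, hf.continuous.fst, hf.continuous.snd,
    isSolution_of_fixedPoint hc hβ hB hp0 hp0B hf hfix, fun L' M' p' h t ht => ?_⟩
  obtain ⟨hg, hp⟩ := h.picardMap_eq hc hCl hCm hβ hB hp0 hp0B rfl
  set g : ℝ → ℝ × ℝ := fun t => (L' (max 0 t), M' (max 0 t)) with hgdef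
  have hLc : Continuous fun t => L' (max 0 t) :=
    ContinuousOn.comp_continuous (s := Set.Ici 0) (fun t ht => (h.deriv_L t ht).continuousWithinAt)
      (continuous_const.max continuous_id) fun _ => Set.mem_Ici.2 (le_max_left _ _)
  have hMc : Continuous fun t => M' (max 0 t) :=
    ContinuousOn.comp_continuous (s := Set.Ici 0) (fun t ht => (h.deriv_M t ht).continuousWithinAt)
      (continuous_const.max continuous_id) fun _ => Set.mem_Ici.2 (le_max_left _ _)
  have hgA : PicardAdm Cl Cm L0 M0 g := by
    rw [← hg]
    exact PicardAdm.picardMap hc hβ hB hp0 hp0B (hLc.prodMk hMc)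
  have heq : g = f := by
    funext t
    rw [hgA.eq_max, hf.eq_max]
    exact causal_fixedPoint_unique (fun f hf => hf.continuous)
      (picardMap_contracting hc hCl hCm hβ hB hp0 hp0B) hgA hf (fun t _ => congrFun hg t) hfix
      (le_max_left _ _)
  rw [hp t ht, ← heq]
  simp [hgdef, max_eq_right ht]

end NonlinearWalk

/-! ### Kolmogorov extension over a countable discrete state space. -/

namespace NonlinearWalk

theorem exists_finset_measure_compl_lt {S : Type*} [Countable S] [Nonempty S] [MeasurableSpace S]
    [MeasurableSingletonClass S] (μ : Measure S) [IsFiniteMeasure μ] {ε : ENNReal} (hε : 0 < ε) :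
    ∃ F : Finset S, F.Nonempty ∧ μ (F : Set S)ᶜ < ε := by
  classical
  obtain ⟨e, he⟩ := exists_surjective_nat S
  let F : ℕ → Finset S := fun n => (Finset.range (n + 1)).image e
  have hanti : Antitone fun n => ((F n : Set S))ᶜ := by
    intro a b hab
    refine Set.compl_subset_compl.2 ?_
    rw [Finset.coe_subset]
    exact Finset.image_subset_image (Finset.range_mono (by omega))
  have hempty : ⋂ n, ((F n : Set S))ᶜ = ∅ := by
    rw [← Set.compl_iUnion, Set.compl_empty_iff, Set.eq_univ_iff_forall]
    intro x
    obtain ⟨n, rfl⟩ := he x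
    exact Set.mem_iUnion.2 ⟨n, Finset.mem_coe.2
      (Finset.mem_image_of_mem _ (Finset.mem_range.2 (Nat.lt_succ_self n)))⟩
  have hlim := tendsto_measure_iInter_atTop (μ := μ) (s := fun n => ((F n : Set S))ᶜ)
    (fun n => ((F n).measurableSet.compl).nullMeasurableSet) hanti ⟨0, measure_ne_top _ _⟩
  rw [hempty, measure_empty] at hlim
  obtain ⟨n, hn⟩ := (hlim.eventually_lt_const hε).exists
  exact ⟨F n, ⟨e 0, Finset.mem_image_of_mem _ (by simp)⟩, hn⟩

/-- Kolmogorov's extension theorem for a countable discrete state space. -/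
theorem exists_isProjectiveLimit {ι S : Type*} [Countable S] [MeasurableSpace S]
    [MeasurableSingletonClass S] {P : ∀ J : Finset ι, Measure (J → S)}
    [∀ J, IsProbabilityMeasure (P J)] (hP : IsProjectiveMeasureFamily (α := fun _ => S) P) :
    ∃ μ : Measure (ι → S), IsProjectiveLimit (α := fun _ => S) μ P := by
  classical
  rcases isEmpty_or_nonempty ι with hι | hι
  · refine ⟨(P ∅).map fun _ i => isEmptyElim i, fun I => ?_⟩
    obtain rfl : I = ∅ := Finset.eq_empty_of_isEmpty I
    rw [Measure.map_map (by fun_prop) (measurable_pi_lambda _ fun i => isEmptyElim i)]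
    convert Measure.map_id
    funext x i
    exact absurd i.2 (Finset.notMem_empty _)
  have hS : Nonempty S := by
    obtain ⟨i⟩ := hι
    obtain ⟨x⟩ := nonempty_of_isProbabilityMeasure (P {i})
    exact ⟨x ⟨i, Finset.mem_singleton_self i⟩⟩
  have hzero : ∀ ⦃A : ℕ → Set (ι → S)⦄, (∀ n, A n ∈ measurableCylinders fun _ => S) →
      Antitone A → ⋂ n, A n = ∅ →
      Tendsto (fun n => projectiveFamilyContent hP (A n)) atTop (𝓝 0) := by
    intro A hA hanti hempty
    have hm : Antitone fun n => projectiveFamilyContent hP (A n) := fun a b hab =>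
      projectiveFamilyContent_mono hP (hA b) (hA a) (hanti hab)
    by_contra hcon
    -- If the contents did not tend to zero they would stay above some ε > 0; the aim is a point
    -- common to all the cylinders.
    have hlim := tendsto_atTop_iInf hm
    set ε := ⨅ n, projectiveFamilyContent hP (A n) with hε
    have hε0 : ε ≠ 0 := fun h => hcon (h ▸ hlim)
    have hAε : ∀ n, ε ≤ projectiveFamilyContent hP (A n) := fun n => iInf_le _ n
    have hcyl : ∀ n, ∃ (s : Finset ι) (U : Set (s → S)), MeasurableSet U ∧
        A n = cylinder (α := fun _ => S) s U := fun n => (mem_measurableCylinders _).1 (hA n)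
    choose s U hU hAU using hcyl
    let u : Set ι := ⋃ n, (s n : Set ι)
    have hu : u.Countable := Set.countable_iUnion fun n => (s n).countable_toSet
    have : Countable u := hu.to_subtype
    obtain ⟨δ, hδ0, hδ⟩ := ENNReal.exists_pos_sum_of_countable hε0 u
    let e : ι → ENNReal := fun i => if h : i ∈ u then (δ ⟨i, h⟩ : ENNReal) else 1
    have he : ∀ i, 0 < e i := by
      intro i
      by_cases h : i ∈ u
      · simp only [e, dif_pos h]; exact_mod_cast hδ0 _
      · simp [e, dif_neg h]
    have hF : ∀ i, ∃ F : Finset S, F.Nonempty ∧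
        (P {i}).map (fun x => x ⟨i, Finset.mem_singleton_self i⟩) (F : Set S)ᶜ < e i := fun i => by
      have : IsProbabilityMeasure
          ((P {i}).map (fun x => x ⟨i, Finset.mem_singleton_self i⟩)) :=
        Measure.isProbabilityMeasure_map (measurable_pi_apply _).aemeasurable
      exact exists_finset_measure_compl_lt _ (he i)
    choose F hFne hFlt using hF
    have hsum : ∀ n, ∑ i ∈ s n, e i < ε := by
      intro n
      have hsu : ∀ i ∈ s n, i ∈ u := fun i hi => Set.mem_iUnion.2 ⟨n, hi⟩
      rw [← Finset.sum_subtype_of_mem e hsu]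
      refine lt_of_le_of_lt ?_ hδ
      refine le_trans (le_of_eq ?_) (ENNReal.sum_le_tsum ((s n).subtype (· ∈ u)))
      refine Finset.sum_congr rfl fun i _ => ?_
      simp only [e, dif_pos i.2]
    have hmarg : ∀ n, ∀ i : s n, P (s n) {x | x i ∉ F i} ≤ e i := by
      intro n i
      have hsub : ({(i : ι)} : Finset ι) ⊆ s n := Finset.singleton_subset_iff.2 i.2
      refine le_trans (le_of_eq ?_) (hFlt i).le
      rw [hP (s n) {(i : ι)} hsub, Measure.map_map (by fun_prop) (by fun_prop),
        Measure.map_apply (by fun_prop) (F i).measurableSet.compl]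
      rfl
    let d : ι → S := fun i => (hFne i).choose
    have hd : ∀ i, d i ∈ F i := fun i => (hFne i).choose_spec
    -- The base of `A n` has mass at least ε, while leaving the finite sets `F i` at some of its
    -- coordinates has mass less than ε. Coordinates outside `s n` are filled with the default
    -- points `d i`.
    have hne : ∀ n, (A n ∩ Set.univ.pi fun i => (F i : Set S)).Nonempty := by
      intro n
      have h1 : P (s n) (⋃ i : s n, {x | x i ∉ F i}) < P (s n) (U n) := by
        calc P (s n) (⋃ i : s n, {x | x i ∉ F i}) ≤ ∑ i : s n, P (s n) {x | x i ∉ F i} :=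
              measure_iUnion_fintype_le _ _
          _ ≤ ∑ i : s n, e i := Finset.sum_le_sum fun i _ => hmarg n i
          _ = ∑ i ∈ s n, e i := Finset.sum_coe_sort (s n) e
          _ < ε := hsum n
          _ ≤ projectiveFamilyContent hP (A n) := hAε n
          _ = P (s n) (U n) := by rw [hAU n, projectiveFamilyContent_cylinder hP (hU n)]
      obtain ⟨x, hxU, hx⟩ : ∃ x ∈ U n, x ∉ ⋃ i : s n, {x | x i ∉ F i} := by
        by_contra! hall
        exact absurd (measure_mono (μ := P (s n)) hall) (not_le.2 h1)
      refine ⟨fun i => if h : i ∈ s n then x ⟨i, h⟩ else d i, ?_, ?_⟩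
      · rw [hAU n, mem_cylinder]
        have hr : (s n).restrict (π := fun _ => S)
            (fun i => if h : i ∈ s n then x ⟨i, h⟩ else d i) = x := by
          funext i
          simp only [Finset.restrict, i.2, dite_true]
        rw [hr]
        exact hxU
      · intro i _
        by_cases h : i ∈ s n
        · simp only [dif_pos h]
          by_contra hcon
          exact hx (Set.mem_iUnion.2 ⟨⟨i, h⟩, hcon⟩)
        · simp only [dif_neg h]
          exact hd i
    -- In the discrete topology cylinders are closed and a product of finite sets is compact, so the
    -- decreasing nonempty intersections share a point.
    let _ : TopologicalSpace S := ⊥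
    have : DiscreteTopology S := ⟨rfl⟩
    have hcompact : IsCompact (Set.univ.pi fun i => (F i : Set S)) :=
      isCompact_univ_pi fun i => (F i).finite_toSet.isCompact
    have hAclosed : ∀ n, IsClosed (A n) := by
      intro n
      rw [hAU n]
      have hr : Continuous ((s n).restrict (π := fun _ => S)) :=
        continuous_pi fun i => continuous_apply (i : ι)
      exact IsClosed.preimage hr (isClosed_discrete (U n))
    obtain ⟨x, hx⟩ := IsCompact.nonempty_iInter_of_sequence_nonempty_isCompact_isClosed
      (fun n => A n ∩ Set.univ.pi fun i => (F i : Set S))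
      (fun n => Set.inter_subset_inter_left _ (hanti (Nat.le_succ n))) hne
      (hcompact.inter_left (hAclosed 0)) (fun n => (hAclosed n).inter hcompact.isClosed)
    have : x ∈ ⋂ n, A n := Set.mem_iInter.2 fun n => (Set.mem_iInter.1 hx n).1
    rw [hempty] at this
    exact this
  have hsub : (projectiveFamilyContent hP).IsSigmaSubadditive :=
    isSigmaSubadditive_of_addContent_iUnion_eq_tsum isSetRing_measurableCylinders
      fun f hf hfU hdisj => addContent_iUnion_eq_sum_of_tendsto_zero isSetRing_measurableCylinders
        _ (fun t _ => projectiveFamilyContent_ne_top hP) hzero hf hfU hdisj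
  refine ⟨(projectiveFamilyContent hP).measure isSetSemiring_measurableCylinders
    generateFrom_measurableCylinders.ge hsub, fun I => ?_⟩
  ext t ht
  rw [Measure.map_apply (by fun_prop) ht, AddContent.measure_eq, ← cylinder,
    projectiveFamilyContent_cylinder hP ht]
  · exact generateFrom_measurableCylinders.symm
  · exact cylinder_mem_measurableCylinders _ _ ht

end NonlinearWalk

/-! ### Markovian finite-dimensional distributions. -/

namespace NonlinearWalk

section pathWeight

variable {k : ℤ → ℝ≥0 → ℤ → ℝ≥0 → ENNReal}

/-- The probability that the walk started from `m` at time `t` agrees with `ω` at the times of a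
list. -/
noncomputable def pathWeight (k : ℤ → ℝ≥0 → ℤ → ℝ≥0 → ENNReal) (ω : ℝ≥0 → ℤ) : ℤ → ℝ≥0 → List ℝ≥0 → ENNReal
  | _, _, [] => 1
  | m, t, s :: l => k (ω s) s m t * pathWeight k ω (ω s) s l

theorem pathWeight_congr {ω ω' : ℝ≥0 → ℤ} (l : List ℝ≥0) (h : ∀ s ∈ l, ω s = ω' s) (m : ℤ)
    (t : ℝ≥0) : pathWeight k ω m t l = pathWeight k ω' m t l := by
  induction l generalizing m t with
  | nil => rfl
  | cons b l ih =>
    simp only [pathWeight]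
    rw [h b List.mem_cons_self, ih fun s hs => h s (List.mem_cons_of_mem _ hs)]

/-- Summing out one of the times. -/
theorem tsum_pathWeight_update (hsum : ∀ m t s, t ≤ s → ∑' n, k n s m t = 1)
    (hck : ∀ n m t u s, t ≤ u → u ≤ s → ∑' l, k l u m t * k n s l u = k n s m t)
    (ω : ℝ≥0 → ℤ) (a : ℝ≥0) (l : List ℝ≥0) (hl : l.Pairwise (· ≤ ·)) (ha : a ∉ l)
    (m : ℤ) (t : ℝ≥0) (hta : t ≤ a) (htl : ∀ s ∈ l, t ≤ s) :
    ∑' j, pathWeight k (Function.update ω a j) m t (l.orderedInsert (· ≤ ·) a)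
      = pathWeight k ω m t l := by
  induction l generalizing m t with
  | nil => simpa [pathWeight] using hsum m t a hta
  | cons b l ih =>
    have hab : b ≠ a := fun h => ha (h ▸ List.mem_cons_self)
    have hal : a ∉ l := fun h => ha (List.mem_cons_of_mem _ h)
    have hne : ∀ s ∈ l, s ≠ a := fun s hs h => hal (h ▸ hs)
    rw [List.pairwise_cons] at hl
    rw [List.orderedInsert_cons]
    split_ifs with h
    -- The new time comes just before b: Chapman-Kolmogorov merges the two transitions. If it comes
    -- after every time of the list, stochasticity removes it in the base case.
    · simp only [pathWeight, Function.update_self, Function.update_of_ne hab]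
      have e : ∀ j, pathWeight k (Function.update ω a j) (ω b) b l = pathWeight k ω (ω b) b l :=
        fun j => pathWeight_congr l (fun s hs => Function.update_of_ne (hne s hs) _ _) _ _
      simp only [e, ← mul_assoc]
      rw [ENNReal.tsum_mul_right, hck _ _ _ _ _ hta h]
    · have hba : b ≤ a := (not_le.1 h).le
      simp only [pathWeight, Function.update_of_ne hab]
      rw [ENNReal.tsum_mul_left, ih hl.2 hal (ω b) b hba hl.1]

/-- A repeated time contributes the factor 1. This reconciles the measures, indexed by finite sets
of times, with merely monotone tuples of times. -/
theorem pathWeight_sort_toFinset (hdiag : ∀ n t, k n t n t = 1) (ω : ℝ≥0 → ℤ) (l : List ℝ≥0)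
    (hl : l.Pairwise (· ≤ ·)) (m : ℤ) (t : ℝ≥0) :
    pathWeight k ω m t (l.toFinset.sort (· ≤ ·)) = pathWeight k ω m t l := by
  induction l generalizing m t with
  | nil => simp [pathWeight]
  | cons b l ih =>
    rw [List.pairwise_cons] at hl
    rw [List.toFinset_cons]
    by_cases hb : b ∈ l
    · rw [Finset.insert_eq_of_mem (List.mem_toFinset.2 hb), ih hl.2]
      cases l with
      | nil => simp at hb
      | cons b' l =>
        have : b' = b := le_antisymm (by
          rcases List.mem_cons.1 hb with h | h
          · exact h.ge
          · exact (List.pairwise_cons.1 hl.2).1 _ h) (hl.1 _ List.mem_cons_self)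
        subst this
        simp only [pathWeight, hdiag, one_mul]
    · rw [Finset.sort_insert (r := (· ≤ ·)) (fun s hs => hl.1 s (List.mem_toFinset.1 hs))
        (fun h => hb (List.mem_toFinset.1 h))]
      simp only [pathWeight]
      rw [ih hl.2]

theorem pathWeight_ofFn (ω : ℝ≥0 → ℤ) (j : ℕ) (t : Fin (j + 1) → ℝ≥0) (m : ℤ) (t₀ : ℝ≥0) :
    pathWeight k ω m t₀ (List.ofFn t) = k (ω (t 0)) (t 0) m t₀ *
      ∏ i : Fin j, k (ω (t i.succ)) (t i.succ) (ω (t i.castSucc)) (t i.castSucc) := by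
  induction j generalizing m t₀ with
  | zero => simp [List.ofFn_succ, pathWeight]
  | succ j ih =>
    rw [List.ofFn_succ, pathWeight, ih, Fin.prod_univ_succ]
    rfl

theorem sort_insert_eq_orderedInsert (I : Finset ℝ≥0) {a : ℝ≥0} (ha : a ∉ I) :
    (insert a I).sort (· ≤ ·) = (I.sort (· ≤ ·)).orderedInsert (· ≤ ·) a := by
  refine List.Perm.eq_of_pairwise' (r := (· ≤ ·)) (Finset.pairwise_sort _ _)
    ((Finset.pairwise_sort I _).orderedInsert a _) ?_
  refine (Finset.sort_perm_toList _ _).trans (((Finset.toList_insert ha)).trans ?_)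
  exact ((Finset.sort_perm_toList I (· ≤ ·)).symm.cons a).trans
    (List.perm_orderedInsert (· ≤ ·) a _).symm

/-- The extension by zero of a partial trajectory. -/
noncomputable def extendPath (I : Finset ℝ≥0) (x : I → ℤ) (t : ℝ≥0) : ℤ :=
  if h : t ∈ I then x ⟨t, h⟩ else 0

/-- The weight of the values of `ω` at the times of `I` under the initial distribution `q`. -/
noncomputable def fddWeight (k : ℤ → ℝ≥0 → ℤ → ℝ≥0 → ENNReal) (q : ℤ → ENNReal) (I : Finset ℝ≥0)
    (ω : ℝ≥0 → ℤ) : ENNReal :=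
  ∑' m, q m * pathWeight k ω m 0 (I.sort (· ≤ ·))

theorem fddWeight_congr (q : ℤ → ENNReal) (I : Finset ℝ≥0) {ω ω' : ℝ≥0 → ℤ}
    (h : ∀ s ∈ I, ω s = ω' s) : fddWeight k q I ω = fddWeight k q I ω' := by
  unfold fddWeight
  refine tsum_congr fun m => ?_
  rw [pathWeight_congr _ fun s hs => h s ((Finset.mem_sort _).1 hs)]

/-- The finite-dimensional distributions. -/
noncomputable def fddMeasure (k : ℤ → ℝ≥0 → ℤ → ℝ≥0 → ENNReal) (q : ℤ → ENNReal)
    (I : Finset ℝ≥0) : Measure (I → ℤ) :=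
  Measure.sum fun x : I → ℤ => fddWeight k q I (extendPath I x) • Measure.dirac x

theorem fddMeasure_singleton (q : ℤ → ENNReal) (I : Finset ℝ≥0) (x : I → ℤ) :
    fddMeasure k q I {x} = fddWeight k q I (extendPath I x) := by
  rw [fddMeasure, Measure.sum_apply _ (measurableSet_singleton x), tsum_eq_single x]
  · simp
  · intro y hy
    simp [hy]

theorem fddMeasure_restrict_singleton (q : ℤ → ENNReal) (I : Finset ℝ≥0) (ω : ℝ≥0 → ℤ) :
    fddMeasure k q I {I.restrict ω} = fddWeight k q I ω := by
  rw [fddMeasure_singleton]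
  refine fddWeight_congr q I fun s hs => ?_
  simp [extendPath, hs]

/-- The fibre over x consists of the extensions of x by an arbitrary value at the new time, so its
mass is a sum over that value. -/
theorem fddMeasure_insert (hsum : ∀ m t s, t ≤ s → ∑' n, k n s m t = 1)
    (hck : ∀ n m t u s, t ≤ u → u ≤ s → ∑' l, k l u m t * k n s l u = k n s m t)
    (q : ℤ → ENNReal) (I : Finset ℝ≥0) {a : ℝ≥0} (ha : a ∉ I) (h : I ⊆ insert a I) :
    fddMeasure k q I = (fddMeasure k q (insert a I)).map (Finset.restrict₂ (π := fun _ => ℤ) h) := by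
  refine Measure.ext_of_singleton fun x => ?_
  rw [Measure.map_apply (by fun_prop) (measurableSet_singleton x)]
  have hpre : Finset.restrict₂ (π := fun _ => ℤ) h ⁻¹' {x}
      = ⋃ j, {(insert a I).restrict (π := fun _ => ℤ) (Function.update (extendPath I x) a j)} := by
    ext y
    simp only [Set.mem_preimage, Set.mem_singleton_iff, Set.mem_iUnion]
    constructor
    · rintro rfl
      refine ⟨y ⟨a, Finset.mem_insert_self a I⟩, funext fun ⟨t, ht⟩ => ?_⟩
      by_cases hta : t = a
      · subst hta; simp
      · have htI : t ∈ I := (Finset.mem_insert.1 ht).resolve_left hta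
        simp [Function.update_of_ne hta, extendPath, htI]
    · rintro ⟨j, rfl⟩
      funext ⟨t, ht⟩
      have hta : t ≠ a := fun h => ha (h ▸ ht)
      simp [Function.update_of_ne hta, extendPath, ht]
  rw [hpre, measure_iUnion _ fun _ => measurableSet_singleton _]
  · simp only [fddMeasure_restrict_singleton]
    rw [fddMeasure_singleton]
    simp only [fddWeight, sort_insert_eq_orderedInsert I ha]
    rw [ENNReal.tsum_comm]
    refine tsum_congr fun m => ?_
    rw [ENNReal.tsum_mul_left, tsum_pathWeight_update hsum hck _ _ _ (Finset.pairwise_sort _ _)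
      (by simpa using ha) _ _ zero_le (fun _ _ => zero_le)]
  · intro j j' hjj
    simp only [Function.onFun, Set.disjoint_singleton]
    intro hcon
    have := congrFun hcon ⟨a, Finset.mem_insert_self a I⟩
    simp at this
    exact hjj this

theorem isProjectiveMeasureFamily_fddMeasure (hsum : ∀ m t s, t ≤ s → ∑' n, k n s m t = 1)
    (hck : ∀ n m t u s, t ≤ u → u ≤ s → ∑' l, k l u m t * k n s l u = k n s m t)
    (q : ℤ → ENNReal) :
    IsProjectiveMeasureFamily (α := fun _ : ℝ≥0 => ℤ) (fddMeasure k q) := by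
  have key : ∀ (j : ℕ) (I J : Finset ℝ≥0) (hJI : J ⊆ I), (I \ J).card = j →
      fddMeasure k q J = (fddMeasure k q I).map (Finset.restrict₂ (π := fun _ => ℤ) hJI) := by
    intro j
    induction j with
    | zero =>
      intro I J hJI hcard
      obtain rfl : I = J := subset_antisymm (Finset.sdiff_eq_empty_iff_subset.1
        (Finset.card_eq_zero.1 hcard)) hJI
      exact Measure.map_id.symm
    | succ j ih =>
      intro I J hJI hcard
      obtain ⟨a, ha⟩ : (I \ J).Nonempty := Finset.card_pos.1 (by omega)
      rw [Finset.mem_sdiff] at ha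
      obtain ⟨I', haI', rfl⟩ : ∃ I', a ∉ I' ∧ insert a I' = I :=
        ⟨I.erase a, Finset.notMem_erase a I, Finset.insert_erase ha.1⟩
      have hJI' : J ⊆ I' := fun t ht =>
        (Finset.mem_insert.1 (hJI ht)).resolve_left fun h => ha.2 (h ▸ ht)
      have hc : (I' \ J).card = j := by
        rw [Finset.insert_sdiff_of_notMem _ ha.2, Finset.card_insert_of_notMem
          (fun h => haI' (Finset.mem_sdiff.1 h).1)] at hcard
        omega
      rw [ih I' J hJI' hc, fddMeasure_insert hsum hck q I' haI' (Finset.subset_insert _ _),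
        Measure.map_map (by fun_prop) (by fun_prop)]
      rfl
  exact fun I J hJI => key _ I J hJI rfl

theorem isProbabilityMeasure_fddMeasure (hsum : ∀ m t s, t ≤ s → ∑' n, k n s m t = 1)
    (hck : ∀ n m t u s, t ≤ u → u ≤ s → ∑' l, k l u m t * k n s l u = k n s m t)
    {q : ℤ → ENNReal} (hq : ∑' m, q m = 1) (I : Finset ℝ≥0) :
    IsProbabilityMeasure (fddMeasure k q I) := by
  refine ⟨?_⟩
  -- Consistency reduces the total mass to the empty set of times, where it is the mass of `q`.
  rw [(isProjectiveMeasureFamily_fddMeasure hsum hck q).measure_univ_eq I ∅]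
  have : (Set.univ : Set ((∅ : Finset ℝ≥0) → ℤ))
      = {(∅ : Finset ℝ≥0).restrict (π := fun _ => ℤ) fun _ => 0} := by
    ext x
    simp only [Set.mem_univ, Set.mem_singleton_iff, true_iff]
    funext i
    exact absurd i.2 (Finset.notMem_empty _)
  rw [this, fddMeasure_restrict_singleton]
  simp [fddWeight, pathWeight, hq]

end pathWeight

/-- By monotonicity equal times are consecutive, so a contradictory assignment of values to times is
already visible at two neighbouring indices. -/
theorem eq_of_eq_time {S : Type*} {j : ℕ} {t : Fin (j + 1) → ℝ≥0} (ht : Monotone t)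
    {n : Fin (j + 1) → S} (h : ∀ i : Fin j, t i.castSucc = t i.succ → n i.castSucc = n i.succ) :
    ∀ i i' : Fin (j + 1), t i = t i' → n i = n i' := by
  have key : ∀ i' i : Fin (j + 1), i ≤ i' → t i = t i' → n i = n i' := by
    intro i'
    induction i' using Fin.induction with
    | zero => intro i hi _; rw [Fin.le_zero_iff.1 hi]
    | succ i' ih =>
      intro i hi hti
      rcases hi.eq_or_lt with rfl | hlt
      · rfl
      · have hle : i ≤ i'.castSucc := Fin.le_castSucc_iff.2 hlt
        have h1 := ht hle
        have h2 := ht (Fin.castSucc_le_succ i')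
        have h3 : t i'.castSucc = t i'.succ := le_antisymm h2 (hti ▸ h1)
        rw [ih i hle (hti.trans h3.symm), h i' h3]
  intro i i' hti
  rcases le_total i i' with hle | hle
  · exact key i' i hle hti
  · exact (key i i' hle hti.symm).symm

/-- Existence of the Markov process with a given transition semigroup. -/
theorem exists_hasMarkovianFDD {κ : ℤ → ℝ → ℤ → ℝ → ℝ} (hκ : IsStochasticSemigroup κ)
    {p0 : ℤ → ℝ} (hp0 : IsProbVector p0) {q : ℝ → ℤ → ℝ}
    (hq : ∀ t, 0 ≤ t → ∀ n, HasSum (fun m => p0 m * κ n t m 0) (q t n)) :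
    ∃ P : Measure (ℝ≥0 → ℤ), HasMarkovianFDD P q κ := by
  let k : ℤ → ℝ≥0 → ℤ → ℝ≥0 → ENNReal := fun n s m t => ENNReal.ofReal (κ n s m t)
  have hsum : ∀ m t s, t ≤ s → ∑' n, k n s m t = 1 := by
    intro m t s hts
    have h := hκ.sum_one s m t t.2 hts
    rw [← ENNReal.ofReal_tsum_of_nonneg (fun n => hκ.nonneg n s m t t.2 hts) h.summable,
      h.tsum_eq, ENNReal.ofReal_one]
  have hck : ∀ n m t u s, t ≤ u → u ≤ s → ∑' l, k l u m t * k n s l u = k n s m t := by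
    intro n m t u s htu hus
    have h := hκ.chapman_kolmogorov n s u m t t.2 htu hus
    have h0 : ∀ l, 0 ≤ κ l u m t := fun l => hκ.nonneg l u m t t.2 htu
    simp only [k]
    rw [← h.tsum_eq, ENNReal.ofReal_tsum_of_nonneg
      (fun l => mul_nonneg (h0 l) (hκ.nonneg n s l u u.2 hus)) h.summable]
    exact tsum_congr fun l => (ENNReal.ofReal_mul (h0 l)).symm
  have hdiag : ∀ n t, k n t n t = 1 := by
    intro n t
    simp [k, hκ.diag n n t t.2]
  let q0 : ℤ → ENNReal := fun m => ENNReal.ofReal (p0 m)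
  have hq0 : ∑' m, q0 m = 1 := by
    rw [← ENNReal.ofReal_tsum_of_nonneg hp0.1 hp0.2.summable, hp0.2.tsum_eq, ENNReal.ofReal_one]
  have hproj := isProjectiveMeasureFamily_fddMeasure hsum hck q0
  have hprob := isProbabilityMeasure_fddMeasure hsum hck hq0
  obtain ⟨P, hP⟩ := exists_isProjectiveLimit hproj
  refine ⟨P, hP.isProbabilityMeasure, fun j t ht n => ?_⟩
  -- If no trajectory fits, some time is repeated with two different values: the event is empty, and
  -- the corresponding diagonal kernel makes the product vanish.
  by_cases hn : ∃ ω : ℝ≥0 → ℤ, ∀ i, ω (t i) = n i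
  · obtain ⟨ω, hω⟩ := hn
    have hset : {ω' : ℝ≥0 → ℤ | ∀ i, ω' (t i) = n i}
        = cylinder (α := fun _ => ℤ) (List.ofFn t).toFinset
          {(List.ofFn t).toFinset.restrict (π := fun _ => ℤ) ω} := by
      ext ω'
      rw [mem_cylinder, Set.mem_singleton_iff]
      constructor
      · intro h
        funext ⟨s, hs⟩
        obtain ⟨i, rfl⟩ := List.mem_ofFn.1 (List.mem_toFinset.1 hs)
        simp only [Finset.restrict]
        rw [h i, hω i]
      · intro h i
        have := congrFun h ⟨t i, List.mem_toFinset.2 (List.mem_ofFn.2 ⟨i, rfl⟩)⟩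
        simp only [Finset.restrict] at this
        rw [this, hω i]
    have hsorted : (List.ofFn t).Pairwise (· ≤ ·) := List.pairwise_ofFn.2 fun i i' h => ht h.le
    have hqk : ∑' m, q0 m * k (n 0) (t 0) m 0 = ENNReal.ofReal (q (t 0) (n 0)) := by
      have h := hq (t 0) (t 0).2 (n 0)
      have h0 : ∀ m, 0 ≤ p0 m * κ (n 0) (t 0) m 0 := fun m => mul_nonneg (hp0.1 m)
        (hκ.nonneg _ _ _ _ le_rfl (t 0).2)
      rw [← h.tsum_eq, ENNReal.ofReal_tsum_of_nonneg h0 h.summable]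
      exact tsum_congr fun l => (ENNReal.ofReal_mul (hp0.1 l)).symm
    have hval : P {ω' : ℝ≥0 → ℤ | ∀ i, ω' (t i) = n i} = ENNReal.ofReal (q (t 0) (n 0)) *
        ∏ i : Fin j, k (n i.succ) (t i.succ) (n i.castSucc) (t i.castSucc) := by
      rw [hset, hP.measure_cylinder _ (measurableSet_singleton _), fddMeasure_restrict_singleton,
        fddWeight]
      simp only [pathWeight_sort_toFinset hdiag ω _ hsorted, pathWeight_ofFn, hω, ← mul_assoc]
      rw [ENNReal.tsum_mul_right, hqk]
    have hq_nonneg : 0 ≤ q (t 0) (n 0) := (hq (t 0) (t 0).2 (n 0)).nonneg fun m =>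
      mul_nonneg (hp0.1 m) (hκ.nonneg _ _ _ _ le_rfl (t 0).2)
    rw [Measure.real, hval, ENNReal.toReal_mul, ENNReal.toReal_ofReal hq_nonneg,
      ENNReal.toReal_prod]
    congr 1
    refine Finset.prod_congr rfl fun i _ => ENNReal.toReal_ofReal ?_
    exact hκ.nonneg _ _ _ _ (t i.castSucc).2 (ht (Fin.castSucc_le_succ i))
  · have hempty : {ω' : ℝ≥0 → ℤ | ∀ i, ω' (t i) = n i} = ∅ := by
      ext ω'
      simp only [Set.mem_ofPred_eq, Set.mem_empty_iff_false, iff_false]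
      exact fun h => hn ⟨ω', h⟩
    have hex : ∃ i : Fin j, t i.castSucc = t i.succ ∧ n i.castSucc ≠ n i.succ := by
      by_contra! hcon
      have hfac : Function.FactorsThrough n t := fun i i' h => eq_of_eq_time ht hcon i i' h
      exact hn ⟨Function.extend t n fun _ => 0, fun i => hfac.extend_apply _ i⟩
    obtain ⟨i, hti, hni⟩ := hex
    rw [hempty, measureReal_empty, Finset.prod_eq_zero (Finset.mem_univ i), mul_zero]
    rw [hti]
    exact (hκ.diag _ _ _ (t i.succ).2).trans (if_neg hni.symm)

end NonlinearWalk

/-! ### Discrete Gaussian laws and fixed points. -/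

namespace NonlinearWalk

variable {c α B X : ℝ} {β : ℤ → ℝ} {L M : ℝ → ℝ}

/-- e^{-cn²} has room to spare over the weight e^{cn²/2}. Uniformity for bounded s is what
continuity of the Gaussian sums in s requires. -/
theorem exists_gaussian_mul_weight_le (hc : 0 < c) (α S : ℝ) :
    ∃ R : ℝ, ∀ s : ℝ, |s| ≤ S → ∀ n : ℤ,
      Real.exp (-c * ((n : ℝ) - s) ^ 2) * weight c α n ≤ R * Real.exp (-|(n : ℝ)|) := by
  obtain ⟨R, _, hR⟩ := exists_exp_le_weight hc 0 (2 * c * S + |α| + 1)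
  refine ⟨R, fun s hs n => ?_⟩
  have h := hR n
  unfold weight at h ⊢
  rw [← Real.exp_add]
  have h1 : Real.exp ((2 * c * S + |α| + 1) * |(n : ℝ)|) * Real.exp (-(c * (n : ℝ) ^ 2 / 2)
      - |(n : ℝ)|) ≤ R * Real.exp (-|(n : ℝ)|) := by
    calc _ ≤ R * Real.exp (c * (n : ℝ) ^ 2 / 2 + 0 * |(n : ℝ)|)
          * Real.exp (-(c * (n : ℝ) ^ 2 / 2) - |(n : ℝ)|) := by gcongr
      _ = _ := by rw [mul_assoc, ← Real.exp_add]; congr 2; ring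
  refine le_trans ?_ h1
  rw [← Real.exp_add]
  refine Real.exp_le_exp.2 ?_
  have h2 : α * |(n : ℝ)| ≤ |α| * |(n : ℝ)| :=
    mul_le_mul_of_nonneg_right (le_abs_self α) (abs_nonneg _)
  have h3 : (n : ℝ) * s ≤ |(n : ℝ)| * S := by
    calc (n : ℝ) * s ≤ |(n : ℝ) * s| := le_abs_self _
      _ = |(n : ℝ)| * |s| := abs_mul _ _
      _ ≤ _ := by gcongr
  nlinarith [mul_le_mul_of_nonneg_left h3 hc.le, mul_nonneg hc.le (sq_nonneg s)]

theorem memB_gaussian (hc : 0 < c) (α s : ℝ) :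
    MemB c α fun n => Real.exp (-c * ((n : ℝ) - s) ^ 2) := by
  obtain ⟨R, hR⟩ := exists_gaussian_mul_weight_le hc α |s|
  refine Summable.of_nonneg_of_le (fun n => mul_nonneg (abs_nonneg _) (weight_pos _ _ _).le)
    (fun n => ?_) (summable_exp_neg_abs_int.mul_left R)
  rw [Real.abs_exp]
  exact hR s le_rfl n

theorem MemB.summable_mul (hc : 0 < c) {q f : ℤ → ℝ} (hq : MemB c α q) (hf : ExpBounded f) :
    Summable fun n => f n * q n :=
  hf.summable_mul hc hq.abs_mul_weight_le

theorem summable_gaussian (hc : 0 < c) (s : ℝ) :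
    Summable fun n : ℤ => Real.exp (-c * ((n : ℝ) - s) ^ 2) := by
  simpa using (memB_gaussian hc 0 s).summable_mul hc (expBounded_const 1)

theorem tsum_gaussian_pos (hc : 0 < c) (s : ℝ) :
    0 < ∑' k : ℤ, Real.exp (-c * ((k : ℝ) - s) ^ 2) :=
  (summable_gaussian hc s).tsum_pos (fun _ => (Real.exp_pos _).le) 0 (Real.exp_pos _)

theorem discreteGaussian_pos (hc : 0 < c) (s : ℝ) (n : ℤ) : 0 < discreteGaussian c s n :=
  div_pos (Real.exp_pos _) (tsum_gaussian_pos hc s)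

theorem isProbVector_discreteGaussian (hc : 0 < c) (s : ℝ) :
    IsProbVector (discreteGaussian c s) := by
  refine ⟨fun n => (discreteGaussian_pos hc s n).le, ?_⟩
  have h := (summable_gaussian hc s).hasSum.div_const
    (∑' k : ℤ, Real.exp (-c * ((k : ℝ) - s) ^ 2))
  rwa [div_self (tsum_gaussian_pos hc s).ne'] at h

theorem memB_discreteGaussian (hc : 0 < c) (α s : ℝ) : MemB c α (discreteGaussian c s) := by
  refine ((memB_gaussian hc α s).div_const
    (∑' k : ℤ, Real.exp (-c * ((k : ℝ) - s) ^ 2))).congr fun n => ?_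
  rw [abs_of_pos (discreteGaussian_pos hc s n), discreteGaussian, Real.abs_exp]
  ring

/-- Detailed balance. -/
theorem rateUp_mul_discreteGaussian (c : ℝ) (β : ℤ → ℝ) (l m : ℝ) (n : ℤ) :
    rateUp c β l n * discreteGaussian c ((l + m) / 2) n
      = rateDown c β m (n + 1) * discreteGaussian c ((l + m) / 2) (n + 1) := by
  unfold rateUp rateDown discreteGaussian
  have h : Real.exp (-c * ((n : ℝ) - l)) * Real.exp (-c * ((n : ℝ) - (l + m) / 2) ^ 2)
      = Real.exp (c * (((n + 1 : ℤ) : ℝ) - m))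
        * Real.exp (-c * (((n + 1 : ℤ) : ℝ) - (l + m) / 2) ^ 2) := by
    rw [← Real.exp_add, ← Real.exp_add]
    congr 1
    push_cast
    ring
  rw [add_sub_cancel_right, mul_assoc, mul_assoc, ← mul_div_assoc (Real.exp _),
    ← mul_div_assoc (Real.exp _), h]

theorem kolmogorovRHS_discreteGaussian (c : ℝ) (β : ℤ → ℝ) (l m : ℝ) (n : ℤ) :
    kolmogorovRHS c β l m (discreteGaussian c ((l + m) / 2)) n = 0 := by
  have h1 := rateUp_mul_discreteGaussian c β l m n
  have h2 := rateUp_mul_discreteGaussian c β l m (n - 1)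
  rw [sub_add_cancel] at h2
  unfold kolmogorovRHS
  linarith

/-- The mean value of the discrete Gaussian law. -/
noncomputable def gaussianMean (c s : ℝ) : ℝ := ∑' n : ℤ, (n : ℝ) * discreteGaussian c s n

theorem discreteGaussian_add_one (c s : ℝ) (n : ℤ) :
    discreteGaussian c (s + 1) n = discreteGaussian c s (n - 1) := by
  unfold discreteGaussian
  rw [← (Equiv.addRight (1 : ℤ)).tsum_eq fun k : ℤ => Real.exp (-c * ((k : ℝ) - (s + 1)) ^ 2)]
  congr 1
  · push_cast
    congr 3
    ring
  · refine tsum_congr fun k => ?_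
    simp only [Equiv.coe_addRight]
    push_cast
    congr 3
    ring

theorem gaussianMean_add_one (hc : 0 < c) (s : ℝ) :
    gaussianMean c (s + 1) = gaussianMean c s + 1 := by
  have h1 : HasSum (fun n : ℤ => (n : ℝ) * discreteGaussian c s n) (gaussianMean c s) :=
    ((memB_discreteGaussian hc 0 s).summable_mul hc expBounded_id).hasSum
  have h := hasSum_shift_sub (h1.add (isProbVector_discreteGaussian hc s).2)
  refine HasSum.tsum_eq (h.congr_fun ?_)
  intro n
  rw [discreteGaussian_add_one]
  push_cast
  ring

theorem continuous_tsum_mul_gaussian (hc : 0 < c) {f : ℤ → ℝ} (hf : ExpBounded f) :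
    Continuous fun s => ∑' n : ℤ, f n * Real.exp (-c * ((n : ℝ) - s) ^ 2) := by
  refine continuous_iff_continuousAt.2 fun s₀ => ?_
  obtain ⟨R, hR⟩ := exists_gaussian_mul_weight_le hc 0 (|s₀| + 1)
  obtain ⟨G, hG, hGb⟩ := hf.exists_summable_bound hc 0 |R|
  have : ContinuousOn (fun s => ∑' n : ℤ, f n * Real.exp (-c * ((n : ℝ) - s) ^ 2))
      (Metric.ball s₀ 1) := by
    refine continuousOn_tsum (fun n => Continuous.continuousOn (by fun_prop)) hG
      fun n s hs => hGb (fun n => Real.exp (-c * ((n : ℝ) - s) ^ 2)) (fun n => ?_) n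
    rw [Real.abs_exp]
    have hs' : |s| ≤ |s₀| + 1 := by
      rw [Metric.mem_ball, Real.dist_eq] at hs
      have := abs_sub_abs_le_abs_sub s s₀
      linarith
    refine (hR s hs' n).trans ?_
    calc R * Real.exp (-|(n : ℝ)|) ≤ |R| * 1 := by
          gcongr
          · exact le_abs_self R
          · exact Real.exp_le_one_iff.2 (by simp)
      _ = |R| := mul_one _
  exact this.continuousAt (Metric.ball_mem_nhds s₀ one_pos)

theorem continuous_gaussianMean (hc : 0 < c) : Continuous (gaussianMean c) := by
  have h1 := continuous_tsum_mul_gaussian hc expBounded_id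
  have h2 : Continuous fun s => ∑' n : ℤ, Real.exp (-c * ((n : ℝ) - s) ^ 2) := by
    simpa using continuous_tsum_mul_gaussian hc (expBounded_const 1)
  refine (h1.div h2 fun s => (tsum_gaussian_pos hc s).ne').congr fun s => ?_
  rw [gaussianMean, Pi.div_apply, ← tsum_div_const]
  exact tsum_congr fun n => (mul_div_assoc _ _ _)

/-- Intermediate values: translating s by an integer j translates the mean by j, so the continuous
left-hand side is unbounded in both directions. -/
theorem exists_gaussianMean_eq (hc : 0 < c) (K : ℝ) : ∃ s, 2 * s + gaussianMean c s = K := by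
  have hcont : Continuous fun s => 2 * s + gaussianMean c s :=
    (continuous_const.mul continuous_id).add (continuous_gaussianMean hc)
  have hnat : ∀ (j : ℕ) (s : ℝ), gaussianMean c (s + j) = gaussianMean c s + j := by
    intro j s
    induction j with
    | zero => simp
    | succ j ih => push_cast; rw [← add_assoc, gaussianMean_add_one hc, ih]; ring
  obtain ⟨j, hj⟩ := exists_nat_ge |K - gaussianMean c 0|
  have h := abs_le.1 hj
  refine mem_range_of_exists_le_of_exists_ge hcont ⟨-(j : ℝ), ?_⟩ ⟨(j : ℝ), ?_⟩
  · have := hnat j (-(j : ℝ))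
    rw [neg_add_cancel] at this
    have hj0 : (0 : ℝ) ≤ j := j.cast_nonneg
    linarith
  · have := hnat j 0
    rw [zero_add] at this
    have hj0 : (0 : ℝ) ≤ j := j.cast_nonneg
    linarith

theorem tsum_rateUp_eq_tsum_rateDown (c : ℝ) (β : ℤ → ℝ) (l m : ℝ) :
    ∑' n, rateDown c β m n * discreteGaussian c ((l + m) / 2) n
      = ∑' n, rateUp c β l n * discreteGaussian c ((l + m) / 2) n := by
  rw [← (Equiv.addRight (1 : ℤ)).tsum_eq]
  exact tsum_congr fun n => (rateUp_mul_discreteGaussian c β l m n).symm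

/-- Fixed points with a prescribed value of the conserved quantity. -/
theorem exists_isFixedPoint (hc : 0 < c) (hβ : ∀ n, 0 < β n) (hB : ∀ n, β n ≤ B) {C : ℝ}
    (hC : 0 < C) (K : ℝ) :
    ∃ l m : ℝ, IsFixedPoint c β C C l m (discreteGaussian c ((l + m) / 2)) ∧
      invariantK l m (discreteGaussian c ((l + m) / 2)) = K := by
  obtain ⟨s, hs⟩ := exists_gaussianMean_eq hc K
  have hsumm : ∀ l, Summable fun n => rateUp c β l n * discreteGaussian c s n := fun l =>
    (memB_discreteGaussian hc 0 s).summable_mul hc (expBounded_rateUp hc hβ hB l)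
  set A := ∑' n, rateUp c β 0 n * discreteGaussian c s n with hA
  have hApos : 0 < A := (hsumm 0).tsum_pos
    (fun n => (mul_pos (rateUp_pos hβ _ _) (discreteGaussian_pos hc s n)).le) 0
    (mul_pos (rateUp_pos hβ _ _) (discreteGaussian_pos hc s 0))
  -- The centre s fixes only l + m; the size of l is then tuned so that the mean upward rate is C.
  -- The mean downward rate follows by detailed balance.
  set l := Real.log (C / A) / c with hl
  have hlm : (l + (2 * s - l)) / 2 = s := by ring
  have hup : ∑' n, rateUp c β l n * discreteGaussian c s n = C := by
    have : ∀ n, rateUp c β l n * discreteGaussian c s n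
        = Real.exp (c * l) * (rateUp c β 0 n * discreteGaussian c s n) := fun n => by
      rw [rateUp_eq, mul_assoc]
    rw [tsum_congr this, tsum_mul_left, ← hA, hl, mul_div_cancel₀ _ hc.ne',
      Real.exp_log (div_pos hC hApos), div_mul_cancel₀ _ hApos.ne']
  have hdown := tsum_rateUp_eq_tsum_rateDown c β l (2 * s - l)
  refine ⟨l, 2 * s - l, ?_, ?_⟩
  · refine ⟨isProbVector_discreteGaussian hc _, kolmogorovRHS_discreteGaussian c β _ _, ?_, ?_⟩
    · rw [hlm]
      have := (hsumm l).hasSum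
      rw [hup] at this
      exact this.congr_fun fun n => mul_comm _ _
    · rw [hlm] at hdown ⊢
      have h := ((memB_discreteGaussian hc 0 s).summable_mul hc
        (expBounded_rateDown hc hβ hB (2 * s - l))).hasSum
      rw [hdown, hup] at h
      exact h.congr_fun fun n => mul_comm _ _
  · rw [hlm, invariantK, ← hs, gaussianMean]
    ring

end NonlinearWalk

/-! ### Distribution functions, dissipation and the conserved quantity. -/

namespace NonlinearWalk

variable {c α B X : ℝ} {β : ℤ → ℝ} {L M : ℝ → ℝ}

/-- The partial sums `∑_{k ≤ n} d_k`. -/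
noncomputable def cumul (d : ℤ → ℝ) (n : ℤ) : ℝ := ∑' k, (if k ≤ n then (1 : ℝ) else 0) * d k

theorem expBounded_indicator (n : ℤ) : ExpBounded fun k : ℤ => if k ≤ n then (1 : ℝ) else 0 :=
  .of_abs_le (C := 1) fun k => by split_ifs <;> simp

theorem cumul_sub_cumul (hc : 0 < c) {d : ℤ → ℝ} (hd : MemB c α d) (n : ℤ) :
    cumul d n - cumul d (n - 1) = d n := by
  unfold cumul
  rw [← (hd.summable_mul hc (expBounded_indicator n)).tsum_sub
    (hd.summable_mul hc (expBounded_indicator (n - 1))), tsum_eq_single n]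
  · simp
  · intro k hk
    by_cases h : k ≤ n
    · rw [if_pos h, if_pos (by omega), sub_self]
    · rw [if_neg h, if_neg (by omega), sub_self]

/-- The partial sum is a left tail, and, the total being zero, also minus a right tail. Using the
tail on the side of n, every index in it has |k| ≥ |n|, which gives decay faster than any
exponential. -/
theorem abs_cumul_le (hc : 0 < c) {d : ℤ → ℝ} (hd : MemB c α d) (h0 : HasSum d 0) {K : ℝ}
    (hK : 0 ≤ K) (n : ℤ) :
    |cumul d n| ≤ Real.exp (-(K * |(n : ℝ)|)) * ∑' k : ℤ, Real.exp (K * |(k : ℝ)|) * |d k| := by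
  have hs : Summable fun k : ℤ => Real.exp (K * |(k : ℝ)|) * |d k| := by
    refine (hd.summable_mul hc (expBounded_exp_abs K)).abs.congr fun k => ?_
    rw [abs_mul, Real.abs_exp]
  have key : ∀ g : ℤ → ℝ, (∀ k, |g k| ≤ Real.exp (-(K * |(n : ℝ)|)) * Real.exp (K * |(k : ℝ)|)) →
      |∑' k, g k * d k| ≤ Real.exp (-(K * |(n : ℝ)|)) * ∑' k : ℤ, Real.exp (K * |(k : ℝ)|) * |d k|
      := by
    intro g hg
    rw [← tsum_mul_left]
    rw [← Real.norm_eq_abs]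
    refine tsum_of_norm_bounded (hs.mul_left _).hasSum fun k => ?_
    rw [Real.norm_eq_abs, abs_mul, ← mul_assoc]
    exact mul_le_mul_of_nonneg_right (hg k) (abs_nonneg _)
  have hle : ∀ k : ℤ, |(n : ℝ)| ≤ |(k : ℝ)| →
      1 ≤ Real.exp (-(K * |(n : ℝ)|)) * Real.exp (K * |(k : ℝ)|) := by
    intro k hk
    rw [← Real.exp_add]
    exact Real.one_le_exp (by nlinarith)
  rcases lt_or_ge n 0 with hn | hn
  · refine key _ fun k => ?_
    split_ifs with hk
    · rw [abs_one]
      refine hle k ?_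
      have h1 : (k : ℝ) ≤ n := by exact_mod_cast hk
      have h2 : (n : ℝ) < 0 := by exact_mod_cast hn
      rw [abs_of_neg h2, abs_of_neg (h1.trans_lt h2)]
      linarith
    · rw [abs_zero]; positivity
  · have : cumul d n = ∑' k, ((if k ≤ n then (1 : ℝ) else 0) - 1) * d k := by
      have h := (hd.summable_mul hc (expBounded_indicator n)).hasSum.sub h0
      rw [sub_zero] at h
      rw [cumul, ← h.tsum_eq]
      exact tsum_congr fun k => by ring
    rw [this]
    refine key _ fun k => ?_
    split_ifs with hk
    · rw [sub_self, abs_zero]; positivity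
    · rw [zero_sub, abs_neg, abs_one]
      refine hle k ?_
      have h1 : (n : ℝ) ≤ k := by exact_mod_cast (not_le.1 hk).le
      have h2 : (0 : ℝ) ≤ n := by exact_mod_cast hn
      rwa [abs_of_nonneg h2, abs_of_nonneg (h2.trans h1)]

theorem summable_mul_of_abs_le_cumul (hc : 0 < c) {d : ℤ → ℝ} (hd : MemB c α d)
    (h0 : HasSum d 0) {f e : ℤ → ℝ} (hf : ExpBounded f) (he : ∀ n, |e n| ≤ |cumul d n|) :
    Summable fun n => f n * e n := by
  obtain ⟨C, K, hC, hK, hfb⟩ := hf.exists_nonneg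
  have h := abs_cumul_le hc hd h0 (K := K + 1) (by linarith)
  set S := ∑' k : ℤ, Real.exp ((K + 1) * |(k : ℝ)|) * |d k|
  refine Summable.of_norm_bounded (summable_exp_neg_abs_int.mul_left (C * S)) fun n => ?_
  rw [Real.norm_eq_abs, abs_mul]
  calc |f n| * |e n| ≤ C * Real.exp (K * |(n : ℝ)|) * (Real.exp (-((K + 1) * |(n : ℝ)|)) * S) :=
        mul_le_mul (hfb n) ((he n).trans (h n)) (abs_nonneg _) (by positivity)
    _ = C * S * (Real.exp (K * |(n : ℝ)|) * Real.exp (-((K + 1) * |(n : ℝ)|))) := by ring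
    _ = C * S * Real.exp (-|(n : ℝ)|) := by rw [← Real.exp_add]; congr 2; ring

theorem summable_cumul (hc : 0 < c) {d : ℤ → ℝ} (hd : MemB c α d) (h0 : HasSum d 0) :
    Summable (cumul d) := by
  simpa using summable_mul_of_abs_le_cumul hc hd h0 (expBounded_const 1) fun _ => le_rfl

/-- Abel summation: shift invariance of the sum of (n + 1) times the partial sums. -/
theorem tsum_cumul (hc : 0 < c) {d : ℤ → ℝ} (hd : MemB c α d) (h0 : HasSum d 0) :
    ∑' n, cumul d n = -∑' n : ℤ, (n : ℝ) * d n := by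
  have h1 := (summable_cumul hc hd h0).hasSum
  have h2 := (summable_mul_of_abs_le_cumul hc hd h0 expBounded_id fun _ => le_rfl).hasSum
  have h3 := hasSum_shift_sub (h2.add h1)
  have h4 := (h2.sub h3).tsum_eq
  have : ∀ n : ℤ, (n : ℝ) * cumul d n - (((n - 1 : ℤ) : ℝ) * cumul d (n - 1) + cumul d (n - 1))
      = (n : ℝ) * d n := by
    intro n
    rw [← cumul_sub_cumul hc hd n]
    push_cast
    ring
  rw [tsum_congr this] at h4
  linarith

/-- The condition of convergence makes the flux of a nonnegative sequence dissipative. -/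
theorem tsum_flux_le (hc : 0 < c) (hβ : ∀ n, 0 < β n) (hB : ∀ n, β n ≤ B) {C : ℝ} (hC : 0 ≤ C)
    (hdiff : ∀ n, Real.exp (-c) * β (n + 1) - β n < -C ∧ Real.exp (-c) * β (n - 1) - β n < -C)
    {e : ℤ → ℝ} (he : ∀ n, 0 ≤ e n) (hs : ∀ f : ℤ → ℝ, ExpBounded f → Summable fun n => f n * e n)
    (l m : ℝ) :
    (Summable fun n => rateUp c β l n * e (n - 1) + rateDown c β m (n + 1) * e (n + 1)
        - (rateUp c β l n + rateDown c β m (n + 1)) * e n) ∧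
    ∑' n, (rateUp c β l n * e (n - 1) + rateDown c β m (n + 1) * e (n + 1)
        - (rateUp c β l n + rateDown c β m (n + 1)) * e n)
      ≤ -(C * min (Real.exp (c * l)) (Real.exp (-c * m))) * ∑' n, e n := by
  have hup := expBounded_rateUp hc hβ hB l
  have hdown := expBounded_rateDown hc hβ hB m
  have h1 := hasSum_shift_sub (hs _ hup.shift_add).hasSum
  have h2 := hasSum_shift_add (hs _ hdown).hasSum
  have h3 := (hs _ (hup.add hdown.shift_add)).hasSum
  simp only [sub_add_cancel] at h1
  have h4 := (h1.add h2).sub h3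
  refine ⟨h4.summable, ?_⟩
  -- After shifting the indices, e_n carries the coefficient (λ_{n+1} - λ_n) + (μ_n - μ_{n+1}); the
  -- condition on β makes both brackets negative, as e1 and e2 quantify.
  rw [h4.tsum_eq, ← (hs _ hup.shift_add).tsum_add (hs _ hdown),
    ← ((hs _ hup.shift_add).add (hs _ hdown)).tsum_sub (hs _ (hup.add hdown.shift_add)),
    ← tsum_mul_left]
  have hse : Summable e := by simpa using hs _ (expBounded_const 1)
  refine (((hs _ hup.shift_add).add (hs _ hdown)).sub (hs _ (hup.add hdown.shift_add))).tsum_le_tsum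
    (fun n => ?_) (hse.mul_left _)
  set z := min (Real.exp (c * l)) (Real.exp (-c * m)) with hz
  have hz0 : 0 < z := lt_min (Real.exp_pos _) (Real.exp_pos _)
  have e1 : C * z * Real.exp (-c * n) ≤ rateUp c β l n - rateUp c β l (n + 1) := by
    have : rateUp c β l n - rateUp c β l (n + 1)
        = (β n - Real.exp (-c) * β (n + 1)) * Real.exp (c * l) * Real.exp (-c * n) := by
      have h1 : rateUp c β l n = β n * (Real.exp (c * l) * Real.exp (-c * n)) := by
        rw [rateUp, ← Real.exp_add]; congr 2; ring
      have h2 : rateUp c β l (n + 1)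
          = β (n + 1) * (Real.exp (-c) * Real.exp (c * l) * Real.exp (-c * n)) := by
        rw [rateUp, ← Real.exp_add, ← Real.exp_add]; congr 2; push_cast; ring
      rw [h1, h2]; ring
    rw [this]
    have hz' : z ≤ _ := min_le_left _ _
    have hC' := hdiff n
    gcongr <;> linarith [hC'.1]
  have e2 : C * z * Real.exp (c * (n + 1)) ≤ rateDown c β m (n + 1) - rateDown c β m n := by
    have : rateDown c β m (n + 1) - rateDown c β m n
        = (β n - Real.exp (-c) * β (n - 1)) * Real.exp (-c * m) * Real.exp (c * (n + 1)) := by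
      have h1 : rateDown c β m (n + 1)
          = β n * (Real.exp (-c * m) * Real.exp (c * (n + 1))) := by
        rw [rateDown, ← Real.exp_add, add_sub_cancel_right]; congr 2; push_cast; ring
      have h2 : rateDown c β m n
          = β (n - 1) * (Real.exp (-c) * Real.exp (-c * m) * Real.exp (c * (n + 1))) := by
        rw [rateDown, ← Real.exp_add, ← Real.exp_add]; congr 2; ring
      rw [h1, h2]; ring
    rw [this]
    have hz' : z ≤ _ := min_le_right _ _
    have hC' := hdiff n
    gcongr <;> linarith [hC'.2]
  -- One of the two exponents is nonnegative, so the dissipation rate is uniform in n.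
  have e3 : 1 ≤ Real.exp (-c * n) + Real.exp (c * (n + 1)) := by
    rcases le_total n 0 with hn | hn
    · have : (n : ℝ) ≤ 0 := by exact_mod_cast hn
      have := Real.one_le_exp (show 0 ≤ -c * (n : ℝ) by nlinarith)
      linarith [Real.exp_pos (c * ((n : ℝ) + 1))]
    · have : (0 : ℝ) ≤ n := by exact_mod_cast hn
      have := Real.one_le_exp (show 0 ≤ c * ((n : ℝ) + 1) by positivity)
      linarith [Real.exp_pos (-c * (n : ℝ))]
  have e4 : C * z ≤ C * z * Real.exp (-c * n) + C * z * Real.exp (c * (n + 1)) := by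
    rw [← mul_add]
    exact le_mul_of_one_le_right (by positivity) e3
  nlinarith [he n]

variable {C₀ L₀ M₀ : ℝ} {p₀ : ℤ → ℝ} {p : ℝ → ℤ → ℝ}

/-- Derivatives of the moments along a solution. -/
theorem IsSolution.hasDerivWithinAt_moment (hc : 0 < c) (hβ : ∀ n, 0 < β n) (hB : ∀ n, β n ≤ B)
    {Cl Cm : ℝ} (h : IsSolution c α β Cl Cm L₀ M₀ p₀ L M p) (hL : Continuous L)
    (hM : Continuous M) {f : ℤ → ℝ} (hf : ExpBounded f) {t : ℝ} (ht : 0 ≤ t) :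
    HasDerivWithinAt (fun u => ∑' n, f n * p u n)
      (∑' n, (rateUp c β (L t) n * (f (n + 1) - f n)
        + rateDown c β (M t) n * (f (n - 1) - f n)) * p t n) (Set.Ici 0) t := by
  obtain ⟨X, _, hX⟩ := exists_rateBound hL hM c 0 (t + 1)
  obtain ⟨R, hR⟩ := h.exists_weightBound (t + 1)
  exact IsForward.hasDerivWithinAt_tsum hc hβ hB h.deriv_p hX hR hf ⟨ht, lt_add_one t⟩

theorem le_of_right_deriv_nonpos {f f' : ℝ → ℝ} {a b : ℝ} (hab : a ≤ b)
    (hf : ContinuousOn f (Set.Icc a b))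
    (hd : ∀ x ∈ Set.Ico a b, HasDerivWithinAt f (f' x) (Set.Ici x) x)
    (h : ∀ x ∈ Set.Ico a b, f' x ≤ 0) : f b ≤ f a :=
  image_le_of_deriv_right_le_deriv_boundary (B := fun _ => f a) (B' := fun _ => 0) hf hd le_rfl
    continuousOn_const (fun x _ => hasDerivWithinAt_const x (Set.Ici x) (f a)) h ⟨hab, le_rfl⟩

/-- The conserved quantity. -/
theorem IsSolution.invariantK_eq (hc : 0 < c) (hβ : ∀ n, 0 < β n) (hB : ∀ n, β n ≤ B)
    (h : IsSolution c α β C₀ C₀ L₀ M₀ p₀ L M p) (hL : Continuous L) (hM : Continuous M)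
    {t : ℝ} (ht : 0 ≤ t) : invariantK (L t) (M t) (p t) = invariantK L₀ M₀ p₀ := by
  have hd : ∀ s, 0 ≤ s →
      HasDerivWithinAt (fun u => invariantK (L u) (M u) (p u)) 0 (Set.Ici 0) s := by
    intro s hs
    have h1 := h.hasDerivWithinAt_moment hc hβ hB hL hM expBounded_id hs
    refine (((h.deriv_L s hs).add (h.deriv_M s hs)).add h1).congr_deriv ?_
    have e1 := ((h.memB s hs).summable_mul hc (expBounded_rateUp hc hβ hB (L s)))
    have e2 := ((h.memB s hs).summable_mul hc (expBounded_rateDown hc hβ hB (M s)))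
    -- The mean position moves by mean upward minus mean downward rate, the opposite of what the
    -- sums in L' + M' contribute; the constants cancel because both equal `C₀`.
    have : ∑' n : ℤ, (rateUp c β (L s) n * (((n + 1 : ℤ) : ℝ) - n)
        + rateDown c β (M s) n * (((n - 1 : ℤ) : ℝ) - n)) * p s n
        = ∑' n, rateUp c β (L s) n * p s n - ∑' n, rateDown c β (M s) n * p s n := by
      rw [← e1.tsum_sub e2]
      refine tsum_congr fun n => ?_
      push_cast
      ring
    rw [this, tsum_congr fun n => mul_comm (p s n) (rateUp c β (L s) n),
      tsum_congr fun n => mul_comm (p s n) (rateDown c β (M s) n)]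
    ring
  have := constant_of_has_deriv_right_zero (a := 0) (b := t)
    (fun s hs => (hd s hs.1).continuousWithinAt.mono Set.Icc_subset_Ici_self)
    (fun s hs => (hd s hs.1).mono (Set.Ici_subset_Ici.2 hs.1)) t ⟨ht, le_rfl⟩
  rw [this, h.init_L, h.init_M, h.init_p]

end NonlinearWalk

/-! ### Decay of the one-sided deviations. -/

namespace NonlinearWalk

variable {c α B X : ℝ} {β : ℤ → ℝ} {L M : ℝ → ℝ}
variable {C₀ L₀ M₀ l m : ℝ} {p₀ : ℤ → ℝ} {p : ℝ → ℤ → ℝ}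

/-- The deviation from the discrete Gaussian law. -/
noncomputable def deviation (c l m : ℝ) (p : ℝ → ℤ → ℝ) (t : ℝ) (n : ℤ) : ℝ :=
  p t n - discreteGaussian c ((l + m) / 2) n

theorem memB_deviation (hc : 0 < c) {Cl Cm : ℝ}
    (h : IsSolution c α β Cl Cm L₀ M₀ p₀ L M p) {t : ℝ} (ht : 0 ≤ t) :
    MemB c α (deviation c l m p t) :=
  (h.memB t ht).sub (memB_discreteGaussian hc α _)

theorem hasSum_deviation (hc : 0 < c) {t : ℝ} (hp : IsProbVector (p t)) :
    HasSum (deviation c l m p t) 0 := by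
  have h := hp.2.sub (isProbVector_discreteGaussian hc ((l + m) / 2)).2
  rwa [sub_self] at h

theorem IsSolution.tsum_cumul_deviation (hc : 0 < c) (hβ : ∀ n, 0 < β n) (hB : ∀ n, β n ≤ B)
    (h : IsSolution c α β C₀ C₀ L₀ M₀ p₀ L M p) (hL : Continuous L) (hM : Continuous M)
    (hK : invariantK l m (discreteGaussian c ((l + m) / 2)) = invariantK L₀ M₀ p₀)
    {t : ℝ} (ht : 0 ≤ t) (hp : IsProbVector (p t)) :
    ∑' n, cumul (deviation c l m p t) n = L t + M t - (l + m) := by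
  rw [tsum_cumul hc (memB_deviation hc h ht) (hasSum_deviation hc hp)]
  have h1 := h.invariantK_eq hc hβ hB hL hM ht
  rw [← hK] at h1
  unfold invariantK at h1
  have h2 := ((h.memB t ht).summable_mul hc expBounded_id).tsum_sub
    ((memB_discreteGaussian hc α ((l + m) / 2)).summable_mul hc expBounded_id)
  have h3 : ∑' n : ℤ, (n : ℝ) * deviation c l m p t n
      = ∑' n : ℤ, ((n : ℝ) * p t n - (n : ℝ) * discreteGaussian c ((l + m) / 2) n) :=
    tsum_congr fun n => mul_sub _ _ _
  rw [h3, h2]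
  linarith

/-- The mass on (-∞, n] changes only by the flux across the edge between n and n + 1, the only place
where the indicator varies. -/
theorem IsSolution.hasDerivWithinAt_cumul (hc : 0 < c) (hβ : ∀ n, 0 < β n) (hB : ∀ n, β n ≤ B)
    {Cl Cm : ℝ} (h : IsSolution c α β Cl Cm L₀ M₀ p₀ L M p) (hL : Continuous L)
    (hM : Continuous M) {t : ℝ} (ht : 0 ≤ t) (n : ℤ) :
    HasDerivWithinAt (fun u => cumul (deviation c l m p u) n)
      (rateDown c β (M t) (n + 1) * p t (n + 1) - rateUp c β (L t) n * p t n) (Set.Ici 0) t := by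
  have h1 := h.hasDerivWithinAt_moment hc hβ hB hL hM (expBounded_indicator n) ht
  have h2 : ∀ u ∈ Set.Ici (0 : ℝ), cumul (deviation c l m p u) n
      = ∑' k, (if k ≤ n then (1 : ℝ) else 0) * p u k
        - cumul (discreteGaussian c ((l + m) / 2)) n := by
    intro u hu
    unfold cumul
    rw [← ((h.memB u hu).summable_mul hc (expBounded_indicator n)).tsum_sub
      ((memB_discreteGaussian hc α ((l + m) / 2)).summable_mul hc (expBounded_indicator n))]
    exact tsum_congr fun k => mul_sub _ _ _
  refine ((h1.sub_const _).congr h2 (h2 t ht)).congr_deriv ?_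
  rw [tsum_eq_sum (s := {n, n + 1})]
  · rw [Finset.sum_pair (by omega)]
    simp
    ring
  · intro k hk
    simp only [Finset.mem_insert, Finset.mem_singleton, not_or] at hk
    have e1 : (k + 1 ≤ n) = (k ≤ n) := propext (by omega)
    have e2 : (k - 1 ≤ n) = (k ≤ n) := propext (by omega)
    simp only [e1, e2]
    ring

/-- Positive parts are only one-sidedly differentiable, so the sum over n is differentiated with
summable Lipschitz constants. They come from the fluxes through the edges. -/
theorem IsSolution.exists_cumul_lipschitz (hc : 0 < c) (hβ : ∀ n, 0 < β n) (hB : ∀ n, β n ≤ B)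
    {Cl Cm : ℝ} (h : IsSolution c α β Cl Cm L₀ M₀ p₀ L M p) (hL : Continuous L)
    (hM : Continuous M) (T : ℝ) :
    ∃ G : ℤ → ℝ, Summable G ∧ ∀ u ∈ Set.Icc 0 T, ∀ v ∈ Set.Icc 0 T, ∀ n,
      |cumul (deviation c l m p u) n - cumul (deviation c l m p v) n| ≤ G n * |u - v| := by
  obtain ⟨X, hX0, hX⟩ := exists_rateBound hL hM c 0 T
  obtain ⟨R, hR⟩ := h.exists_weightBound T
  obtain ⟨G₁, hG₁, h₁⟩ := ((expBounded_const X).mul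
    (expBounded_rateUp hc hβ hB 0)).exists_summable_bound hc α R
  obtain ⟨G₂, hG₂, h₂⟩ := ((expBounded_const X).mul
    (expBounded_rateDown hc hβ hB 0)).exists_summable_bound hc α R
  refine ⟨fun n => G₂ (n + 1) + G₁ n, (hasSum_shift_add hG₂.hasSum).summable.add hG₁,
    fun u hu v hv n => ?_⟩
  refine Convex.norm_image_sub_le_of_norm_hasDerivWithin_le (s := Set.Icc 0 T)
    (fun t ht => (h.hasDerivWithinAt_cumul hc hβ hB hL hM ht.1 n).mono Set.Icc_subset_Ici_self)
    (fun t ht => ?_) (convex_Icc _ _) hv hu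
  have e1 := h₁ (p t) (hR t ht) n
  have e2 := h₂ (p t) (hR t ht) (n + 1)
  rw [Real.norm_eq_abs]
  refine (abs_sub _ _).trans (add_le_add (le_trans ?_ e2) (le_trans ?_ e1))
  · rw [abs_mul, abs_mul, abs_of_pos (rateDown_pos hβ _ _),
      abs_of_pos (mul_pos hX0 (rateDown_pos hβ _ _))]
    exact mul_le_mul_of_nonneg_right (rateDown_le hβ (hX t ht).2 _) (abs_nonneg _)
  · rw [abs_mul, abs_mul, abs_of_pos (rateUp_pos hβ _ _),
      abs_of_pos (mul_pos hX0 (rateUp_pos hβ _ _))]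
    exact mul_le_mul_of_nonneg_right (rateUp_le hβ (hX t ht).1 _) (abs_nonneg _)

/-- The sum of the positive parts of `σ D_n`, where `D_n` is the deviation of the distribution
functions. -/
noncomputable def excess (c l m : ℝ) (p : ℝ → ℤ → ℝ) (σ t : ℝ) : ℝ :=
  ∑' n, max (σ * cumul (deviation c l m p t) n) 0

theorem abs_posPart_le {σ x : ℝ} (hσ : |σ| ≤ 1) : |max (σ * x) 0| ≤ |x| := by
  rw [abs_of_nonneg (le_max_right _ _)]
  refine max_le ((le_abs_self _).trans ?_) (abs_nonneg _)
  rw [abs_mul]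
  exact mul_le_of_le_one_left (abs_nonneg _) hσ

theorem abs_posPart_sub_le {σ x y : ℝ} (hσ : |σ| ≤ 1) :
    |max (σ * x) 0 - max (σ * y) 0| ≤ |x - y| := by
  refine (abs_max_sub_max_le_abs _ _ _).trans ?_
  rw [← mul_sub, abs_mul]
  exact mul_le_of_le_one_left (abs_nonneg _) hσ

theorem summable_posPart (hc : 0 < c) {Cl Cm σ : ℝ} (hσ : |σ| ≤ 1)
    (h : IsSolution c α β Cl Cm L₀ M₀ p₀ L M p) {t : ℝ} (ht : 0 ≤ t) (hp : IsProbVector (p t)) :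
    Summable fun n => max (σ * cumul (deviation c l m p t) n) 0 := by
  simpa using summable_mul_of_abs_le_cumul hc (memB_deviation (l := l) (m := m) hc h ht)
    (hasSum_deviation hc hp) (expBounded_const 1)
    (e := fun n => max (σ * cumul (deviation c l m p t) n) 0) fun n => abs_posPart_le hσ

theorem excess_nonneg (σ t : ℝ) : 0 ≤ excess c l m p σ t := tsum_nonneg fun _ => le_max_right _ _

theorem continuousOn_excess (hc : 0 < c) (hβ : ∀ n, 0 < β n) (hB : ∀ n, β n ≤ B)
    {Cl Cm σ : ℝ} (hσ : |σ| ≤ 1) (h : IsSolution c α β Cl Cm L₀ M₀ p₀ L M p) (hL : Continuous L)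
    (hM : Continuous M) (hp : ∀ t, 0 ≤ t → IsProbVector (p t)) (T : ℝ) :
    ContinuousOn (excess c l m p σ) (Set.Icc 0 T) := by
  obtain ⟨G, hG, hGb⟩ := h.exists_cumul_lipschitz (l := l) (m := m) hc hβ hB hL hM T
  have hd := (summable_cumul hc (memB_deviation (l := l) (m := m) hc h le_rfl)
    (hasSum_deviation hc (hp 0 le_rfl))).abs
  refine continuousOn_tsum (u := fun n => |cumul (deviation c l m p 0) n| + G n * T) (fun n => ?_)
    (hd.add (hG.mul_right T)) fun n t ht => ?_
  · refine ContinuousOn.sup (continuousOn_const.mul fun t ht => ?_) continuousOn_const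
    exact (h.hasDerivWithinAt_cumul hc hβ hB hL hM ht.1 n).continuousWithinAt.mono
      Set.Icc_subset_Ici_self
  · have h0 : (0 : ℝ) ∈ Set.Icc 0 T := ⟨le_rfl, ht.1.trans ht.2⟩
    have h1 := hGb t ht 0 h0 n
    rw [sub_zero, abs_of_nonneg ht.1] at h1
    have h2 := abs_sub_abs_le_abs_sub (cumul (deviation c l m p t) n)
      (cumul (deviation c l m p 0) n)
    have h3 := abs_posPart_le (x := cumul (deviation c l m p t) n) hσ
    have h4 : G n * t ≤ G n * T := by
      rcases ht.1.eq_or_lt with rfl | ht0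
      · have h5 := hGb T ⟨h0.2, le_rfl⟩ 0 h0 n
        rw [sub_zero, abs_of_nonneg h0.2] at h5
        rw [mul_zero]
        exact (abs_nonneg _).trans h5
      · exact mul_le_mul_of_nonneg_left ht.2
          (nonneg_of_mul_nonneg_left ((abs_nonneg _).trans h1) ht0)
    rw [Real.norm_eq_abs]
    linarith

/-- Kato's inequality for a discrete operator with nonnegative off-diagonal entries: neighbours may
be replaced by their positive parts, and a source of favourable sign may be dropped. -/
theorem posPart_flux_le {a b e₀ e₁ e₂ σ r d' : ℝ} (ha : 0 ≤ a) (hb : 0 ≤ b)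
    (hd : d' = a * e₀ + b * e₂ - (a + b) * e₁ - r) (hr : 0 ≤ σ * r) :
    (if 0 < σ * e₁ then σ * d' else if σ * e₁ < 0 then 0 else max (σ * d') 0)
      ≤ a * max (σ * e₀) 0 + b * max (σ * e₂) 0 - (a + b) * max (σ * e₁) 0 := by
  have h0 := mul_le_mul_of_nonneg_left (le_max_left (σ * e₀) 0) ha
  have h2 := mul_le_mul_of_nonneg_left (le_max_left (σ * e₂) 0) hb
  have h0' := mul_nonneg ha (le_max_right (σ * e₀) 0)
  have h2' := mul_nonneg hb (le_max_right (σ * e₂) 0)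
  have hd' : σ * d' = a * (σ * e₀) + b * (σ * e₂) - (a + b) * (σ * e₁) - σ * r := by
    rw [hd]; ring
  split_ifs with h h'
  · rw [max_eq_left h.le]; linarith
  · rw [max_eq_right h'.le]; linarith
  · have he : σ * e₁ = 0 := le_antisymm (not_lt.1 h) (not_lt.1 h')
    rw [he] at hd' ⊢
    rw [max_self]
    exact max_le (by linarith) (by linarith)

/-- The equation for the distribution functions is linear with a source measuring the failure of
detailed balance; when σ and L + M - (l + m) have compatible signs, the source only lowers the
positive parts of σ D_n. -/
theorem hasDerivWithinAt_excess (hc : 0 < c) (hβ : ∀ n, 0 < β n) (hB : ∀ n, β n ≤ B)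
    {C : ℝ} (hC : 0 ≤ C)
    (hdiff : ∀ n, Real.exp (-c) * β (n + 1) - β n < -C ∧ Real.exp (-c) * β (n - 1) - β n < -C)
    {Cl Cm σ : ℝ} (hσ : |σ| ≤ 1) (h : IsSolution c α β Cl Cm L₀ M₀ p₀ L M p) (hL : Continuous L)
    (hM : Continuous M) (hp : ∀ t, 0 ≤ t → IsProbVector (p t)) {t : ℝ} (ht : 0 ≤ t) :
    ∃ e, HasDerivWithinAt (excess c l m p σ) e (Set.Ici t) t ∧
      (0 ≤ σ * (L t + M t - (l + m)) →
        e ≤ -(C * min (Real.exp (c * L t)) (Real.exp (-c * M t))) * excess c l m p σ t) := by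
  set D := fun u => cumul (deviation c l m p u) with hD
  set d' : ℤ → ℝ := fun n =>
    rateDown c β (M t) (n + 1) * p t (n + 1) - rateUp c β (L t) n * p t n with hd'
  have hsub : Set.Ici t ⊆ Set.Ici 0 := Set.Ici_subset_Ici.2 ht
  have hder : ∀ n, HasDerivWithinAt (fun u => max (σ * D u n) 0)
      (if 0 < σ * D t n then σ * d' n else if σ * D t n < 0 then 0 else max (σ * d' n) 0)
      (Set.Ici t) t := fun n =>
    hasDerivWithinAt_max (((h.hasDerivWithinAt_cumul hc hβ hB hL hM ht n).mono hsub).const_mul σ)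
      (hasDerivWithinAt_const _ _ _)
  refine ⟨∑' n, if 0 < σ * D t n then σ * d' n else if σ * D t n < 0 then 0 else max (σ * d' n) 0,
    ?_, fun hS => ?_⟩
  · obtain ⟨G, hG, hGb⟩ := h.exists_cumul_lipschitz (l := l) (m := m) hc hβ hB hL hM (t + 1)
    have hmem : ∀ᶠ u in 𝓝[≥] t, u ∈ Set.Icc t (t + 1) :=
      Icc_mem_nhdsGE (lt_add_one t)
    exact hasDerivWithinAt_tsum_of_lipschitz hG
      (hmem.mono fun u hu => summable_posPart hc hσ h (ht.trans hu.1) (hp u (ht.trans hu.1)))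
      (summable_posPart hc hσ h ht (hp t ht))
      (hmem.mono fun u hu n => (abs_posPart_sub_le hσ).trans
        (hGb u ⟨ht.trans hu.1, hu.2⟩ t ⟨ht, (lt_add_one t).le⟩ n)) hder
  · have hmemB := memB_deviation (l := l) (m := m) hc h ht
    have hsum0 := hasSum_deviation (l := l) (m := m) hc (hp t ht)
    obtain ⟨hfl, hle⟩ := tsum_flux_le hc hβ hB hC hdiff
      (e := fun n => max (σ * D t n) 0) (fun n => le_max_right _ _)
      (fun f hf => summable_mul_of_abs_le_cumul hc hmemB hsum0 hf fun n => abs_posPart_le hσ)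
      (L t) (M t)
    refine le_trans (Summable.tsum_le_tsum (fun n => ?_) ?_ hfl) hle
    · refine posPart_flux_le (rateUp_pos hβ _ _).le (rateDown_pos hβ _ _).le
        (r := rateUp c β (L t) n * discreteGaussian c ((l + m) / 2) n
          - rateDown c β (M t) (n + 1) * discreteGaussian c ((l + m) / 2) (n + 1)) ?_ ?_
      · have h1 := cumul_sub_cumul hc hmemB n
        have h2 := cumul_sub_cumul hc hmemB (n + 1)
        rw [add_sub_cancel_right] at h2
        have h3 : p t n = D t n - D t (n - 1) + discreteGaussian c ((l + m) / 2) n := by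
          rw [hD]; simp only [h1, deviation]; ring
        have h4 : p t (n + 1) = D t (n + 1) - D t n + discreteGaussian c ((l + m) / 2) (n + 1) := by
          rw [hD]; simp only [h2, deviation]; ring
        simp only [hd', h3, h4]
        ring
      · have hbal := rateUp_mul_discreteGaussian c β l m n
        rw [rateUp_eq c β l, rateDown_eq c β m] at hbal
        rw [rateUp_eq c β (L t), rateDown_eq c β (M t)]
        have hpos := mul_pos (rateUp_pos (c := c) hβ 0 n)
          (discreteGaussian_pos hc ((l + m) / 2) n)
        -- Balance at (l, m) rewrites the source as a positive number times e^{cL} - e^{-cM +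
        -- c(l+m)}, whose sign is that of L + M - (l + m) for every n.
        have e1 : Real.exp (-c * M t) * rateDown c β 0 (n + 1)
            * discreteGaussian c ((l + m) / 2) (n + 1)
            = Real.exp (-c * M t + c * (l + m)) * (rateUp c β 0 n
              * discreteGaussian c ((l + m) / 2) n) := by
          have : Real.exp (-c * M t + c * (l + m))
              = Real.exp (-c * M t) * Real.exp (c * m) * Real.exp (c * l) := by
            rw [← Real.exp_add, ← Real.exp_add]; congr 1; ring
          have h1 : Real.exp (c * m) * Real.exp (-c * m) = 1 := by
            rw [← Real.exp_add]; simp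
          rw [this]
          linear_combination (-Real.exp (-c * M t) * Real.exp (c * m)) * hbal
            - Real.exp (-c * M t) * rateDown c β 0 (n + 1)
              * discreteGaussian c ((l + m) / 2) (n + 1) * h1
        rw [e1, mul_assoc, ← sub_mul, ← mul_assoc]
        refine mul_nonneg ?_ hpos.le
        rcases lt_trichotomy σ 0 with hσ0 | rfl | hσ0
        · have : L t + M t - (l + m) ≤ 0 := nonpos_of_mul_nonneg_right hS hσ0
          refine mul_nonneg_of_nonpos_of_nonpos hσ0.le (sub_nonpos.2 (Real.exp_le_exp.2 ?_))
          nlinarith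
        · simp
        · have : 0 ≤ L t + M t - (l + m) := nonneg_of_mul_nonneg_right hS hσ0
          refine mul_nonneg hσ0.le (sub_nonneg.2 (Real.exp_le_exp.2 ?_))
          nlinarith
    · have s1 := ((h.memB t ht).summable_mul hc (expBounded_rateUp hc hβ hB (L t)))
      have s2 := (hasSum_shift_add
        ((h.memB t ht).summable_mul hc (expBounded_rateDown hc hβ hB (M t))).hasSum).summable
      refine Summable.of_norm_bounded (s2.sub s1).abs fun n => ?_
      have hle : |σ * d' n| ≤ |d' n| := by
        rw [abs_mul]; exact mul_le_of_le_one_left (abs_nonneg _) hσ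
      rw [Real.norm_eq_abs]
      split_ifs
      · exact hle
      · rw [abs_zero]; exact abs_nonneg _
      · exact abs_posPart_le hσ

/-- The larger one of the two one-sided deviations of the distribution functions. -/
noncomputable def imbalance (c l m : ℝ) (p : ℝ → ℤ → ℝ) (t : ℝ) : ℝ :=
  max (excess c l m p 1 t) (excess c l m p (-1) t)

theorem imbalance_nonneg (t : ℝ) : 0 ≤ imbalance c l m p t :=
  (excess_nonneg 1 t).trans (le_max_left _ _)

/-- Positive minus negative parts restore the signed sum, which conservation of K ties to L + M. So
the sign of the source in the dissipation estimate is known once it is known which excess is larger.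
-/
theorem excess_sub_excess (hc : 0 < c) (hβ : ∀ n, 0 < β n) (hB : ∀ n, β n ≤ B)
    (h : IsSolution c α β C₀ C₀ L₀ M₀ p₀ L M p) (hL : Continuous L) (hM : Continuous M)
    (hK : invariantK l m (discreteGaussian c ((l + m) / 2)) = invariantK L₀ M₀ p₀)
    {t : ℝ} (ht : 0 ≤ t) (hp : IsProbVector (p t)) :
    excess c l m p 1 t - excess c l m p (-1) t = L t + M t - (l + m) := by
  rw [← h.tsum_cumul_deviation hc hβ hB hL hM hK ht hp, excess, excess,
    ← (summable_posPart hc (by simp) h ht hp).tsum_sub (summable_posPart hc (by simp) h ht hp)]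
  refine tsum_congr fun n => ?_
  rcases le_total 0 (cumul (deviation c l m p t) n) with h0 | h0
  · rw [max_eq_left (by linarith), max_eq_right (by linarith)]; ring
  · rw [max_eq_right (by linarith), max_eq_left (by linarith)]; ring

theorem abs_deviation_le (hc : 0 < c) {Cl Cm : ℝ}
    (h : IsSolution c α β Cl Cm L₀ M₀ p₀ L M p) {t : ℝ} (ht : 0 ≤ t) (hp : IsProbVector (p t))
    (n : ℤ) : |deviation c l m p t n| ≤ 4 * imbalance c l m p t := by
  have key : ∀ k, |cumul (deviation c l m p t) k| ≤ 2 * imbalance c l m p t := by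
    intro k
    have h1 := (summable_posPart (σ := 1) (l := l) (m := m) hc (by simp) h ht hp).le_tsum k
      fun _ _ => le_max_right _ _
    have h2 := (summable_posPart (σ := -1) (l := l) (m := m) hc (by simp) h ht hp).le_tsum k
      fun _ _ => le_max_right _ _
    have h3 : excess c l m p 1 t ≤ imbalance c l m p t := le_max_left _ _
    have h4 : excess c l m p (-1) t ≤ imbalance c l m p t := le_max_right _ _
    have h0 := imbalance_nonneg (c := c) (l := l) (m := m) (p := p) t
    unfold excess at h3 h4
    refine abs_le.2 ⟨?_, ?_⟩
    · linarith [le_max_left (-1 * cumul (deviation c l m p t) k) 0]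
    · linarith [le_max_left (1 * cumul (deviation c l m p t) k) 0]
  rw [← cumul_sub_cumul hc (memB_deviation (l := l) (m := m) hc h ht) n]
  linarith [abs_sub (cumul (deviation c l m p t) n) (cumul (deviation c l m p t) (n - 1)),
    key n, key (n - 1)]

theorem hasDerivWithinAt_imbalance (hc : 0 < c) (hβ : ∀ n, 0 < β n) (hB : ∀ n, β n ≤ B)
    {C : ℝ} (hC : 0 ≤ C)
    (hdiff : ∀ n, Real.exp (-c) * β (n + 1) - β n < -C ∧ Real.exp (-c) * β (n - 1) - β n < -C)
    (h : IsSolution c α β C₀ C₀ L₀ M₀ p₀ L M p) (hL : Continuous L)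
    (hM : Continuous M) (hp : ∀ t, 0 ≤ t → IsProbVector (p t))
    (hK : invariantK l m (discreteGaussian c ((l + m) / 2)) = invariantK L₀ M₀ p₀)
    {t : ℝ} (ht : 0 ≤ t) :
    ∃ e, HasDerivWithinAt (imbalance c l m p) e (Set.Ici t) t ∧
      e ≤ -(C * min (Real.exp (c * L t)) (Real.exp (-c * M t))) * imbalance c l m p t := by
  obtain ⟨e₁, h₁, h₁'⟩ := hasDerivWithinAt_excess (l := l) (m := m) (σ := 1) hc hβ hB hC hdiff
    (by simp) h hL hM hp ht
  obtain ⟨e₂, h₂, h₂'⟩ := hasDerivWithinAt_excess (l := l) (m := m) (σ := -1) hc hβ hB hC hdiff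
    (by simp) h hL hM hp ht
  have hS := excess_sub_excess hc hβ hB h hL hM hK ht (hp t ht)
  refine ⟨_, hasDerivWithinAt_max h₁ h₂, ?_⟩
  unfold imbalance
  -- The larger excess is always the one whose sign condition holds; at a tie L + M = l + m and both
  -- conditions hold.
  split_ifs with h12 h21
  · rw [max_eq_left h12.le]
    exact h₁' (by linarith)
  · rw [max_eq_right h21.le]
    exact h₂' (by linarith)
  · have heq : excess c l m p 1 t = excess c l m p (-1) t := le_antisymm (not_lt.1 h12) (not_lt.1 h21)
    have e1 := h₁' (by linarith)
    have e2 := h₂' (by linarith)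
    rw [heq] at e1 ⊢
    rw [max_self]
    exact max_le e1 e2

/-- Exponential decay of the imbalance. -/
theorem imbalance_le (hc : 0 < c) (hβ : ∀ n, 0 < β n) (hB : ∀ n, β n ≤ B)
    {C : ℝ} (hC : 0 ≤ C)
    (hdiff : ∀ n, Real.exp (-c) * β (n + 1) - β n < -C ∧ Real.exp (-c) * β (n - 1) - β n < -C)
    (h : IsSolution c α β C₀ C₀ L₀ M₀ p₀ L M p) (hL : Continuous L)
    (hM : Continuous M) (hp : ∀ t, 0 ≤ t → IsProbVector (p t))
    (hK : invariantK l m (discreteGaussian c ((l + m) / 2)) = invariantK L₀ M₀ p₀)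
    {κ : ℝ} (hκ : ∀ t, 0 ≤ t → κ ≤ C * min (Real.exp (c * L t)) (Real.exp (-c * M t)))
    {t : ℝ} (ht : 0 ≤ t) :
    imbalance c l m p t ≤ imbalance c l m p 0 * Real.exp (-(κ * t)) := by
  choose! e he he' using fun t (ht : 0 ≤ t) =>
    hasDerivWithinAt_imbalance (l := l) (m := m) hc hβ hB hC hdiff h hL hM hp hK ht
  have hmono := le_of_right_deriv_nonpos (f := fun s => imbalance c l m p s * Real.exp (κ * s))
    (f' := fun s => e s * Real.exp (κ * s) + imbalance c l m p s * (Real.exp (κ * s) * κ)) ht ?_ ?_ ?_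
  · rw [mul_zero, Real.exp_zero, mul_one] at hmono
    rw [Real.exp_neg, ← div_eq_mul_inv, le_div_iff₀ (Real.exp_pos _)]
    exact hmono
  · refine ContinuousOn.mul (ContinuousOn.sup ?_ ?_) (Continuous.continuousOn (by fun_prop))
    · exact continuousOn_excess hc hβ hB (by simp) h hL hM hp t
    · exact continuousOn_excess hc hβ hB (by simp) h hL hM hp t
  · intro s hs
    have h1 : HasDerivAt (fun s => Real.exp (κ * s)) (Real.exp (κ * s) * κ) s := by
      simpa using ((hasDerivAt_id s).const_mul κ).exp
    exact (he s hs.1).mul h1.hasDerivWithinAt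
  · intro s hs
    have h1 := he' s hs.1
    have h2 := mul_le_mul_of_nonneg_right (hκ s hs.1)
      (imbalance_nonneg (c := c) (l := l) (m := m) (p := p) s)
    have h3 : e s + imbalance c l m p s * κ ≤ 0 := by linarith
    have := mul_nonpos_of_nonpos_of_nonneg h3 (Real.exp_pos (κ * s)).le
    linarith

end NonlinearWalk

/-! ### Comparison principles and Lyapunov functions. -/

namespace NonlinearWalk

variable {c α B X : ℝ} {β : ℤ → ℝ} {L M : ℝ → ℝ}
variable {C₀ L₀ M₀ l m : ℝ} {p₀ : ℤ → ℝ} {p : ℝ → ℤ → ℝ}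

theorem le_of_deriv_neg_at_level {f f' : ℝ → ℝ} {R : ℝ}
    (hd : ∀ t, 0 ≤ t → HasDerivWithinAt f (f' t) (Set.Ici 0) t) (h0 : f 0 ≤ R)
    (h : ∀ t, 0 ≤ t → f t = R → f' t < 0) {t : ℝ} (ht : 0 ≤ t) : f t ≤ R :=
  image_le_of_deriv_right_lt_deriv_boundary' (a := 0) (b := t) (B := fun _ => R)
    (B' := fun _ => 0)
    (fun s hs => (hd s hs.1).continuousWithinAt.mono Set.Icc_subset_Ici_self)
    (fun s hs => (hd s hs.1).mono (Set.Ici_subset_Ici.2 hs.1)) h0 continuousOn_const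
    (fun s _ => hasDerivWithinAt_const s (Set.Ici s) R) (fun s hs => h s hs.1) ⟨ht, le_rfl⟩

/-- Once the source stays below g₀ + kε/2, multiplication by e^{kt} shows that u exceeds g₀/k + ε/2
by at most an exponentially small term. -/
theorem eventually_le_of_relax {k g₀ ε : ℝ} (hk : 0 < k) {u g : ℝ → ℝ}
    (hd : ∀ t, 0 ≤ t → HasDerivWithinAt u (-k * u t + g t) (Set.Ici 0) t)
    (hg : Tendsto g atTop (𝓝 g₀)) (hε : 0 < ε) : ∀ᶠ t in atTop, u t ≤ g₀ / k + ε := by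
  have hev : ∀ᶠ t in atTop, g t ≤ g₀ + k * (ε / 2) :=
    (hg.eventually_lt_const (by linarith [mul_pos hk (half_pos hε)])).mono fun t h => h.le
  obtain ⟨T, hT⟩ := eventually_atTop.1 (hev.and (eventually_ge_atTop 0))
  have hT0 : 0 ≤ T := (hT T le_rfl).2
  have key : ∀ t, T ≤ t →
      u t ≤ g₀ / k + ε / 2 + (u T - g₀ / k - ε / 2) * Real.exp (k * T) * Real.exp (-(k * t)) := by
    intro t ht
    have hmono := le_of_right_deriv_nonpos
      (f := fun s => (u s - (g₀ / k + ε / 2)) * Real.exp (k * s))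
      (f' := fun s => (-k * u s + g s) * Real.exp (k * s)
        + (u s - (g₀ / k + ε / 2)) * (Real.exp (k * s) * k)) ht ?_ ?_ ?_
    · rw [Real.exp_neg, ← div_eq_mul_inv, ← sub_le_iff_le_add', le_div_iff₀ (Real.exp_pos _)]
      refine hmono.trans (le_of_eq ?_)
      ring
    · refine ContinuousOn.mul (ContinuousOn.sub (fun s hs => ?_) continuousOn_const)
        (Continuous.continuousOn (by fun_prop))
      exact (hd s (hT0.trans hs.1)).continuousWithinAt.mono fun y hy => hT0.trans hy.1
    · intro s hs
      have h1 : HasDerivAt (fun s => Real.exp (k * s)) (Real.exp (k * s) * k) s := by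
        simpa using ((hasDerivAt_id s).const_mul k).exp
      exact (((hd s (hT0.trans hs.1)).mono
        (Set.Ici_subset_Ici.2 (hT0.trans hs.1))).sub_const _).mul h1.hasDerivWithinAt
    · intro s hs
      have h1 := (hT s hs.1).1
      have h2 : k * (g₀ / k) = g₀ := mul_div_cancel₀ _ hk.ne'
      have h3 : (-k * u s + g s) * Real.exp (k * s)
          + (u s - (g₀ / k + ε / 2)) * (Real.exp (k * s) * k)
          = (g s - g₀ - k * (ε / 2)) * Real.exp (k * s) := by
        linear_combination (-Real.exp (k * s)) * h2
      rw [h3]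
      exact mul_nonpos_of_nonpos_of_nonneg (by linarith) (Real.exp_pos _).le
  have hlim : Tendsto (fun t => g₀ / k + ε / 2
      + (u T - g₀ / k - ε / 2) * Real.exp (k * T) * Real.exp (-(k * t))) atTop
      (𝓝 (g₀ / k + ε / 2)) := by
    have h1 : Tendsto (fun t => Real.exp (-(k * t))) atTop (𝓝 0) :=
      Real.tendsto_exp_neg_atTop_nhds_zero.comp (tendsto_id.const_mul_atTop hk)
    simpa using (h1.const_mul ((u T - g₀ / k - ε / 2) * Real.exp (k * T))).const_add
      (g₀ / k + ε / 2)
  filter_upwards [hlim.eventually_lt_const (show g₀ / k + ε / 2 < g₀ / k + ε by linarith),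
    eventually_ge_atTop T] with t h1 h2
  exact (key t h2).trans h1.le

/-- Solutions of the relaxation equation with a convergent source converge. -/
theorem tendsto_of_relax {k g₀ : ℝ} (hk : 0 < k) {u g : ℝ → ℝ}
    (hd : ∀ t, 0 ≤ t → HasDerivWithinAt u (-k * u t + g t) (Set.Ici 0) t)
    (hg : Tendsto g atTop (𝓝 g₀)) : Tendsto u atTop (𝓝 (g₀ / k)) := by
  refine Metric.tendsto_nhds.2 fun ε hε => ?_
  have h1 := eventually_le_of_relax hk hd hg (half_pos hε)
  have h2 := eventually_le_of_relax hk (u := fun t => -u t) (g := fun t => -g t)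
    (fun t ht => (hd t ht).neg.congr_deriv (by ring)) hg.neg (half_pos hε)
  filter_upwards [h1, h2] with t h1 h2
  rw [Real.dist_eq, abs_lt]
  rw [neg_div] at h2
  constructor <;> linarith

theorem exists_cubic_bound {b a : ℝ} (hb : 0 < b) (ha : 0 ≤ a) :
    ∃ K : ℝ, ∀ z : ℝ, 0 ≤ z → a * z + z ^ 2 ≤ K + b * z ^ 3 := by
  set w := max 1 ((1 + a) / b) with hw
  have hw1 : 1 ≤ w := le_max_left _ _
  refine ⟨a * w + w ^ 2, fun z hz => ?_⟩
  rcases le_total z w with h | h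
  · have : 0 ≤ b * z ^ 3 := by positivity
    nlinarith [mul_le_mul_of_nonneg_left h ha]
  · have h1 : (1 + a) / b ≤ z := (le_max_right _ _).trans h
    rw [div_le_iff₀ hb] at h1
    have h2 : 1 ≤ z := hw1.trans h
    have h3 : a * z ≤ a * z ^ 2 := mul_le_mul_of_nonneg_left (by nlinarith) ha
    have h4 := mul_le_mul_of_nonneg_right h1 (sq_nonneg z)
    have h5 : 0 ≤ a * w + w ^ 2 := by positivity
    nlinarith

/-- The generator applied to `e^{-2cn}`. -/
theorem exists_generator_exp_neg_le (hc : 0 < c) {b : ℝ} (hb : 0 < b) (hβb : ∀ n, b ≤ β n)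
    (hB : ∀ n, β n ≤ B) {ρ : ℝ} (hρ : 0 < ρ) :
    ∃ K : ℝ, ∀ l m : ℝ, ρ * Real.exp (-c * m) ≤ Real.exp (c * l) → ∀ n : ℤ,
      rateUp c β l n * (Real.exp (-2 * c * ((n + 1 : ℤ) : ℝ)) - Real.exp (-2 * c * (n : ℝ)))
        + rateDown c β m n * (Real.exp (-2 * c * ((n - 1 : ℤ) : ℝ)) - Real.exp (-2 * c * (n : ℝ)))
      ≤ Real.exp (-c * m) * (K - Real.exp (-2 * c * (n : ℝ))) := by
  have hB0 : 0 ≤ B := hb.le.trans ((hβb 0).trans (hB 0))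
  have h1 : Real.exp (-2 * c) < 1 := by rw [Real.exp_lt_one_iff]; linarith
  have h2 : 1 < Real.exp (2 * c) := Real.one_lt_exp_iff.2 (by linarith)
  -- With z = e^{-cn} the test function is z². An upward jump contributes -z³ and a downward one +z,
  -- up to constants, so the cubic term absorbs both z and the z² wanted on the right. The
  -- hypothesis on ρ compares the two prefactors.
  obtain ⟨K, hK⟩ := exists_cubic_bound (b := ρ * b * (1 - Real.exp (-2 * c)))
    (a := B * (Real.exp (2 * c) - 1)) (mul_pos (by positivity) (by linarith))
    (mul_nonneg hB0 (by linarith))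
  refine ⟨K, fun l m hlm n => ?_⟩
  set z := Real.exp (-c * n) with hz
  have hz0 : 0 < z := Real.exp_pos _
  have e0 : Real.exp (-2 * c * (n : ℝ)) = z ^ 2 := by
    rw [hz, ← Real.exp_nat_mul]; congr 1; push_cast; ring
  have e1 : Real.exp (-2 * c * ((n + 1 : ℤ) : ℝ)) = z ^ 2 * Real.exp (-2 * c) := by
    rw [← e0, ← Real.exp_add]; congr 1; push_cast; ring
  have e2 : Real.exp (-2 * c * ((n - 1 : ℤ) : ℝ)) = z ^ 2 * Real.exp (2 * c) := by
    rw [← e0, ← Real.exp_add]; congr 1; push_cast; ring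
  have e3 : rateUp c β l n = β n * Real.exp (c * l) * z := by
    rw [rateUp, hz, mul_assoc, ← Real.exp_add]; congr 2; ring
  have e4 : rateDown c β m n * z = β (n - 1) * Real.exp (-c * m) := by
    rw [rateDown, hz, mul_assoc, ← Real.exp_add]; congr 2; ring
  have hy := Real.exp_pos (-c * m)
  have hx := Real.exp_pos (c * l)
  have e5 : rateDown c β m n * (z ^ 2 * Real.exp (2 * c) - z ^ 2)
      = β (n - 1) * Real.exp (-c * m) * z * (Real.exp (2 * c) - 1) := by
    rw [← e4]; ring
  have e6 : rateUp c β l n * (z ^ 2 * Real.exp (-2 * c) - z ^ 2)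
      = -(β n * Real.exp (c * l) * ((1 - Real.exp (-2 * c)) * z ^ 3)) := by
    rw [e3]; ring
  rw [e0, e1, e2, e5, e6]
  have f1 : b * (ρ * Real.exp (-c * m)) * ((1 - Real.exp (-2 * c)) * z ^ 3)
      ≤ β n * Real.exp (c * l) * ((1 - Real.exp (-2 * c)) * z ^ 3) := by
    have : 0 ≤ (1 - Real.exp (-2 * c)) * z ^ 3 := mul_nonneg (by linarith) (by positivity)
    have h0 := hβb n
    have h0' : 0 ≤ β n := hb.le.trans h0
    gcongr
  have f2 : β (n - 1) * Real.exp (-c * m) * z * (Real.exp (2 * c) - 1)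
      ≤ B * Real.exp (-c * m) * z * (Real.exp (2 * c) - 1) := by
    have : 0 ≤ Real.exp (2 * c) - 1 := by linarith
    have := hB (n - 1)
    gcongr
  have f3 := mul_le_mul_of_nonneg_left (hK z hz0.le) hy.le
  nlinarith

/-- The generator applied to `e^{2cn}`. -/
theorem exists_generator_exp_le (hc : 0 < c) {b : ℝ} (hb : 0 < b) (hβb : ∀ n, b ≤ β n)
    (hB : ∀ n, β n ≤ B) {ρ : ℝ} (hρ : 0 < ρ) :
    ∃ K : ℝ, ∀ l m : ℝ, ρ * Real.exp (c * l) ≤ Real.exp (-c * m) → ∀ n : ℤ,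
      rateUp c β l n * (Real.exp (2 * c * ((n + 1 : ℤ) : ℝ)) - Real.exp (2 * c * (n : ℝ)))
        + rateDown c β m n * (Real.exp (2 * c * ((n - 1 : ℤ) : ℝ)) - Real.exp (2 * c * (n : ℝ)))
      ≤ Real.exp (c * l) * (K - Real.exp (2 * c * (n : ℝ))) := by
  have hB0 : 0 ≤ B := hb.le.trans ((hβb 0).trans (hB 0))
  -- Reflection n ↦ -n exchanges up and down jumps, with (l, m) replaced by (-m, -l); the edge
  -- between n and n + 1 goes to that between -n - 1 and -n.
  obtain ⟨K, hK⟩ := exists_generator_exp_neg_le (β := fun n => β (-n - 1)) hc hb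
    (fun n => hβb _) (fun n => hB _) hρ
  refine ⟨K, fun l m hlm n => ?_⟩
  have h := hK (-m) (-l) (by simpa using hlm) (-n)
  have e1 : rateUp c (fun n => β (-n - 1)) (-m) (-n) = rateDown c β m n := by
    simp only [rateUp, rateDown]
    push_cast
    congr 2 <;> ring_nf
  have e2 : rateDown c (fun n => β (-n - 1)) (-l) (-n) = rateUp c β l n := by
    simp only [rateUp, rateDown]
    push_cast
    congr 2 <;> ring_nf
  have e3 : ∀ k : ℤ, -2 * c * ((-k : ℤ) : ℝ) = 2 * c * k := fun k => by push_cast; ring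
  have e4 : -n + 1 = -(n - 1) := by ring
  have e5 : -n - 1 = -(n + 1) := by ring
  rw [e1, e2, e4, e5] at h
  simp only [e3] at h
  have e6 : -c * -l = c * l := by ring
  rw [e6] at h
  linarith

/-- A Lyapunov function bounds its moment. -/
theorem IsSolution.moment_le (hc : 0 < c) (hβ : ∀ n, 0 < β n) (hB : ∀ n, β n ≤ B)
    {Cl Cm : ℝ} (h : IsSolution c α β Cl Cm L₀ M₀ p₀ L M p) (hL : Continuous L)
    (hM : Continuous M) (hp : ∀ t, 0 ≤ t → IsProbVector (p t)) {f : ℤ → ℝ} (hf : ExpBounded f)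
    {K : ℝ} {y : ℝ → ℝ} (hy : ∀ t, 0 ≤ t → 0 < y t)
    (hgen : ∀ t, 0 ≤ t → ∀ n, rateUp c β (L t) n * (f (n + 1) - f n)
        + rateDown c β (M t) n * (f (n - 1) - f n) ≤ y t * (K - f n)) {t : ℝ} (ht : 0 ≤ t) :
    ∑' n, f n * p t n ≤ max (∑' n, f n * p 0 n) K + 1 := by
  -- At the level max(·, K) + 1 the moment exceeds K, so its derivative is strictly negative; the
  -- summand 1 secures strictness.
  refine le_of_deriv_neg_at_level (f := fun t => ∑' n, f n * p t n)
    (fun s hs => h.hasDerivWithinAt_moment hc hβ hB hL hM hf hs)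
    ((le_max_left _ _).trans (lt_add_one _).le) (fun s hs hlev => ?_) ht
  have s1 := (h.memB s hs).summable_mul hc hf
  have s2 := (((hp s hs).2.mul_left K).sub s1.hasSum).mul_left (y s)
  have s3 : Summable fun n => (rateUp c β (L s) n * (f (n + 1) - f n)
      + rateDown c β (M s) n * (f (n - 1) - f n)) * p s n :=
    (h.memB s hs).summable_mul hc (((expBounded_rateUp hc hβ hB _).mul
      (hf.shift_add.sub hf)).add ((expBounded_rateDown hc hβ hB _).mul (hf.shift_sub.sub hf)))
  refine (hasSum_le ?_ s3.hasSum s2).trans_lt ?_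
  · intro n
    have := mul_le_mul_of_nonneg_right (hgen s hs n) ((hp s hs).1 n)
    linarith
  · rw [hlev]
    have := le_max_right (∑' n, f n * p 0 n) K
    exact mul_neg_of_pos_of_neg (hy s hs) (by linarith)

end NonlinearWalk

/-! ### Convergence to the fixed point. -/

namespace NonlinearWalk

variable {c α B X : ℝ} {β : ℤ → ℝ} {L M : ℝ → ℝ}
variable {C₀ L₀ M₀ l m : ℝ} {p₀ : ℤ → ℝ} {p : ℝ → ℤ → ℝ}

theorem summable_exp_neg_mul_abs_int (hc : 0 < c) :
    Summable fun n : ℤ => Real.exp (-(c * |(n : ℝ)|)) := by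
  have h : Summable fun n : ℕ => Real.exp ((n : ℝ) * -c) :=
    Real.summable_exp_nat_mul_iff.2 (by linarith)
  have e : ∀ n : ℕ, Real.exp ((n : ℝ) * -c) = Real.exp (-(c * |((n : ℤ) : ℝ)|)) := fun n => by
    rw [Int.cast_natCast, Nat.abs_cast]; congr 1; ring
  refine Summable.of_nat_of_neg (h.congr e) (h.congr fun n => ?_)
  rw [e]; push_cast; rw [abs_neg]

theorem abs_sub_le_imbalance (hc : 0 < c) (hβ : ∀ n, 0 < β n) (hB : ∀ n, β n ≤ B)
    (h : IsSolution c α β C₀ C₀ L₀ M₀ p₀ L M p) (hL : Continuous L) (hM : Continuous M)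
    (hK : invariantK l m (discreteGaussian c ((l + m) / 2)) = invariantK L₀ M₀ p₀)
    {t : ℝ} (ht : 0 ≤ t) (hp : IsProbVector (p t)) :
    |L t + M t - (l + m)| ≤ imbalance c l m p t := by
  rw [← excess_sub_excess hc hβ hB h hL hM hK ht hp]
  have h1 := excess_nonneg (c := c) (l := l) (m := m) (p := p) 1 t
  have h2 := excess_nonneg (c := c) (l := l) (m := m) (p := p) (-1) t
  have h3 : excess c l m p 1 t ≤ imbalance c l m p t := le_max_left _ _
  have h4 : excess c l m p (-1) t ≤ imbalance c l m p t := le_max_right _ _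
  exact abs_le.2 ⟨by linarith, by linarith⟩

/-- Exponential moments are bounded uniformly in time if `L + M` is bounded. -/
theorem IsSolution.exists_exp_moment_bound (hc : 0 < c) (hβ : ∀ n, 0 < β n) (hB : ∀ n, β n ≤ B)
    {b : ℝ} (hb : 0 < b) (hβb : ∀ n, b ≤ β n)
    {Cl Cm : ℝ} (h : IsSolution c α β Cl Cm L₀ M₀ p₀ L M p) (hL : Continuous L)
    (hM : Continuous M) (hp : ∀ t, 0 ≤ t → IsProbVector (p t)) {S : ℝ}
    (hS : ∀ t, 0 ≤ t → |L t + M t| ≤ S) :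
    ∃ R : ℝ, ∀ t, 0 ≤ t → ∀ n : ℤ, Real.exp (2 * c * |(n : ℝ)|) * p t n ≤ R := by
  -- The bound |L + M| ≤ S makes e^{cL} and e^{-cM} comparable up to the factor e^{cS}, in both
  -- directions.
  obtain ⟨K₁, h₁⟩ := exists_generator_exp_neg_le hc hb hβb hB (Real.exp_pos (-(c * S)))
  obtain ⟨K₂, h₂⟩ := exists_generator_exp_le hc hb hβb hB (Real.exp_pos (-(c * S)))
  have f₁ := expBounded_exp (-2 * c)
  have f₂ := expBounded_exp (2 * c)
  have key₁ := fun t (ht : 0 ≤ t) => h.moment_le (K := K₁) (y := fun t => Real.exp (-c * M t)) hc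
    hβ hB hL hM hp f₁ (fun _ _ => Real.exp_pos _) (fun s hs n => h₁ (L s) (M s) (by
      rw [← Real.exp_add]
      have := (abs_le.1 (hS s hs)).1
      exact Real.exp_le_exp.2 (by nlinarith)) n) ht
  have key₂ := fun t (ht : 0 ≤ t) => h.moment_le (K := K₂) (y := fun t => Real.exp (c * L t)) hc
    hβ hB hL hM hp f₂ (fun _ _ => Real.exp_pos _) (fun s hs n => h₂ (L s) (M s) (by
      rw [← Real.exp_add]
      have := (abs_le.1 (hS s hs)).2
      exact Real.exp_le_exp.2 (by nlinarith)) n) ht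
  refine ⟨_, fun t ht n => le_trans ?_ (add_le_add (key₁ t ht) (key₂ t ht))⟩
  have hp0 := (hp t ht).1
  have s1 := ((h.memB t ht).summable_mul hc f₁).le_tsum n
    fun k _ => mul_nonneg (Real.exp_pos _).le (hp0 k)
  have s2 := ((h.memB t ht).summable_mul hc f₂).le_tsum n
    fun k _ => mul_nonneg (Real.exp_pos _).le (hp0 k)
  refine le_trans ?_ (add_le_add s1 s2)
  rw [← add_mul]
  refine mul_le_mul_of_nonneg_right ?_ (hp0 n)
  rcases abs_choice (n : ℝ) with h | h <;> rw [h]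
  · linarith [Real.exp_pos (-2 * c * (n : ℝ))]
  · have : 2 * c * -(n : ℝ) = -2 * c * n := by ring
    rw [this]
    linarith [Real.exp_pos (2 * c * (n : ℝ))]

/-- Convergence of the solution to the fixed point with the same value of the conserved
quantity. -/
theorem IsSolution.tendsto_fixedPoint (hc : 0 < c) (hC₀ : 0 < C₀) (hβ : ∀ n, 0 < β n)
    (hB : ∀ n, β n ≤ B) (hcond : ConvergenceCondition c β)
    (h : IsSolution c α β C₀ C₀ L₀ M₀ p₀ L M p) (hL : Continuous L)
    (hM : Continuous M) (hp : ∀ t, 0 ≤ t → IsProbVector (p t))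
    (hfix : IsFixedPoint c β C₀ C₀ l m (discreteGaussian c ((l + m) / 2)))
    (hK : invariantK l m (discreteGaussian c ((l + m) / 2)) = invariantK L₀ M₀ p₀) :
    Tendsto L atTop (𝓝 l) ∧ Tendsto M atTop (𝓝 m) ∧
      ∀ n, Tendsto (fun t => p t n) atTop (𝓝 (discreteGaussian c ((l + m) / 2) n)) := by
  obtain ⟨⟨b, hb, hβb⟩, C, hC, hdiff⟩ := hcond
  have hdecay := fun κ hκ t (ht : 0 ≤ t) =>
    imbalance_le (l := l) (m := m) (κ := κ) hc hβ hB hC.le hdiff h hL hM hp hK hκ ht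
  set F := imbalance c l m p with hF
  -- First pass with rate 0: monotonicity alone already bounds L + M. The positive rate needs the
  -- bounds derived from this.
  have hF0 : ∀ t, 0 ≤ t → F t ≤ F 0 := fun t ht => by
    have := hdecay 0 (fun t _ => mul_nonneg hC.le
      (le_min (Real.exp_pos _).le (Real.exp_pos _).le)) t ht
    simpa using this
  have hSF := fun t (ht : 0 ≤ t) => abs_sub_le_imbalance hc hβ hB h hL hM hK ht (hp t ht)
  have hS : ∀ t, 0 ≤ t → |L t + M t| ≤ |l + m| + F 0 := fun t ht => by
    have h1 := abs_sub_abs_le_abs_sub (L t + M t) (l + m)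
    have := hSF t ht
    have := hF0 t ht
    linarith
  obtain ⟨R, hR⟩ := h.exists_exp_moment_bound hc hβ hB hb hβb hL hM hp hS
  -- The moment of order 2c against the growth e^{c|n|} of the rate leaves e^{-c|n|}: a summable
  -- majorant uniform in time.
  have hterm : ∀ t, 0 ≤ t → ∀ n,
      rateUp c β 0 n * p t n ≤ B * R * Real.exp (-(c * |(n : ℝ)|)) := by
    intro t ht n
    have h1 := rateUp_zero_le hc hβ hB n
    have h2 : p t n ≤ R * Real.exp (-(2 * c * |(n : ℝ)|)) := by
      rw [Real.exp_neg, ← div_eq_mul_inv, le_div_iff₀ (Real.exp_pos _), mul_comm]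
      exact hR t ht n
    have hB0 : 0 < B := (hβ 0).trans_le (hB 0)
    calc rateUp c β 0 n * p t n
        ≤ B * Real.exp (c * |(n : ℝ)|) * (R * Real.exp (-(2 * c * |(n : ℝ)|))) :=
          mul_le_mul h1 h2 ((hp t ht).1 n) (by positivity)
      _ = B * R * (Real.exp (c * |(n : ℝ)|) * Real.exp (-(2 * c * |(n : ℝ)|))) := by ring
      _ = _ := by rw [← Real.exp_add]; congr 2; ring
  have hsumm := (summable_exp_neg_mul_abs_int hc).mul_left (B * R)
  set A := fun t => ∑' n, rateUp c β 0 n * p t n with hA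
  set Ab := ∑' n : ℤ, B * R * Real.exp (-(c * |(n : ℝ)|)) with hAb
  have hAle : ∀ t, 0 ≤ t → A t ≤ Ab := fun t ht =>
    ((h.memB t ht).summable_mul hc (expBounded_rateUp hc hβ hB 0)).tsum_le_tsum (hterm t ht) hsumm
  set u := fun t => Real.exp (-(c * L t)) with hu
  have hud : ∀ t, 0 ≤ t → HasDerivWithinAt u (-(c * C₀) * u t + c * A t) (Set.Ici 0) t := by
    intro t ht
    refine (((h.deriv_L t ht).const_mul c).neg.exp).congr_deriv ?_
    rw [tsum_mul_rateUp]
    have h1 : Real.exp (-(c * L t)) * Real.exp (c * L t) = 1 := by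
      rw [← Real.exp_add]; simp
    simp only [hu, hA]
    linear_combination (c * ∑' n, rateUp c β 0 n * p t n) * h1
  -- Above Ab / C₀ the relaxation term outweighs the source, so e^{-cL} cannot cross `U`; this
  -- bounds L below.
  set U := max (u 0) (Ab / C₀) + 1 with hU
  have hule : ∀ t, 0 ≤ t → u t ≤ U := fun t ht =>
    le_of_deriv_neg_at_level hud ((le_max_left _ _).trans (lt_add_one _).le) (fun s hs hlev => by
      rw [hlev]
      have h1 : Ab / C₀ < U := (le_max_right _ _).trans_lt (lt_add_one _)
      rw [div_lt_iff₀ hC₀] at h1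
      have h2 := hAle s hs
      have : -(c * C₀) * U + c * A s = -(c * (U * C₀ - A s)) := by ring
      rw [this, neg_lt_zero]
      exact mul_pos hc (by linarith)) ht
  have hU0 : 0 < U := (Real.exp_pos _).trans_le (hule 0 le_rfl)
  have hx : ∀ t, 0 ≤ t → U⁻¹ ≤ Real.exp (c * L t) := fun t ht => by
    have := hule t ht
    rw [hu] at this
    simp only [Real.exp_neg] at this
    exact inv_le_of_inv_le₀ (Real.exp_pos _) this
  have hy : ∀ t, 0 ≤ t →
      U⁻¹ * Real.exp (-(c * (|l + m| + F 0))) ≤ Real.exp (-c * M t) := fun t ht => by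
    have h1 : Real.exp (-c * M t) = Real.exp (c * L t) * Real.exp (-(c * (L t + M t))) := by
      rw [← Real.exp_add]; congr 1; ring
    rw [h1]
    refine mul_le_mul (hx t ht) (Real.exp_le_exp.2 ?_) (Real.exp_pos _).le (Real.exp_pos _).le
    have := (abs_le.1 (hS t ht)).2
    nlinarith
  -- Second pass, now with a positive rate: e^{cL} is bounded below, and e^{-cM} = e^{cL}
  -- e^{-c(L+M)} is too.
  set κ := C * min U⁻¹ (U⁻¹ * Real.exp (-(c * (|l + m| + F 0)))) with hκ
  have hκ0 : 0 < κ := mul_pos hC (lt_min (inv_pos.2 hU0) (mul_pos (inv_pos.2 hU0) (Real.exp_pos _)))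
  have hFlim : Tendsto F atTop (𝓝 0) := by
    have h1 : Tendsto (fun t => F 0 * Real.exp (-(κ * t))) atTop (𝓝 0) := by
      simpa using (Real.tendsto_exp_neg_atTop_nhds_zero.comp
        (tendsto_id.const_mul_atTop hκ0)).const_mul (F 0)
    refine squeeze_zero' (Eventually.of_forall fun t => imbalance_nonneg t) ?_ h1
    filter_upwards [eventually_ge_atTop 0] with t ht
    exact hdecay κ (fun s hs => mul_le_mul_of_nonneg_left (min_le_min (hx s hs) (hy s hs)) hC.le)
      t ht
  have hplim : ∀ n, Tendsto (fun t => p t n) atTop (𝓝 (discreteGaussian c ((l + m) / 2) n)) := by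
    intro n
    refine tendsto_iff_norm_sub_tendsto_zero.2 (squeeze_zero' (Eventually.of_forall fun t =>
      norm_nonneg _) ?_ (by simpa using hFlim.const_mul 4))
    filter_upwards [eventually_ge_atTop 0] with t ht
    exact abs_deviation_le hc h ht (hp t ht) n
  have hSlim : Tendsto (fun t => L t + M t) atTop (𝓝 (l + m)) := by
    refine tendsto_iff_norm_sub_tendsto_zero.2 (squeeze_zero' (Eventually.of_forall fun t =>
      norm_nonneg _) ?_ hFlim)
    filter_upwards [eventually_ge_atTop 0] with t ht
    exact hSF t ht
  have hAlim : Tendsto A atTop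
      (𝓝 (∑' n, rateUp c β 0 n * discreteGaussian c ((l + m) / 2) n)) := by
    refine tendsto_tsum_of_dominated_convergence hsumm (fun n => (hplim n).const_mul _) ?_
    filter_upwards [eventually_ge_atTop 0] with t ht
    intro n
    rw [Real.norm_eq_abs, abs_of_nonneg (mul_nonneg (rateUp_pos hβ _ _).le ((hp t ht).1 n))]
    exact hterm t ht n
  -- The imbalance controls p and L + M only. L itself comes from the relaxation equation for
  -- e^{-cL}, whose source now converges; the limit is identified by the fixed-point equation.
  have hulim := tendsto_of_relax (mul_pos hc hC₀) hud (hAlim.const_mul c)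
  have hustar : c * ∑' n, rateUp c β 0 n * discreteGaussian c ((l + m) / 2) n
      = c * C₀ * Real.exp (-(c * l)) := by
    have h1 := hfix.sum_up.tsum_eq
    rw [tsum_mul_rateUp] at h1
    have h2 : Real.exp (-(c * l)) * Real.exp (c * l) = 1 := by
      rw [← Real.exp_add]; simp
    linear_combination (-(c * ∑' n, rateUp c β 0 n * discreteGaussian c ((l + m) / 2) n)) * h2
      + c * Real.exp (-(c * l)) * h1
  rw [hustar, mul_div_cancel_left₀ _ (mul_pos hc hC₀).ne'] at hulim
  have hLlim : Tendsto L atTop (𝓝 l) := by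
    have h1 := ((Real.continuousAt_log (Real.exp_pos (-(c * l))).ne').tendsto.comp
      hulim).const_mul (-c⁻¹)
    refine (h1.congr fun t => ?_).trans_eq ?_
    · simp only [hu, Function.comp, Real.log_exp]
      field_simp
    · rw [Real.log_exp]
      congr 1
      field_simp
  refine ⟨hLlim, ?_, hplim⟩
  have h1 := hSlim.sub hLlim
  simpa using h1

end NonlinearWalk

/-! ### Convergence of joint laws and the stationary walk. -/

namespace NonlinearWalk

variable {c α B X : ℝ} {β : ℤ → ℝ} {L M : ℝ → ℝ}

theorem holdProb_shift (h : ℝ) (n : ℤ) (t s : ℝ) :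
    holdProb c β L M n (t + h) (s + h)
      = holdProb c β (fun u => L (u + h)) (fun u => M (u + h)) n t s := by
  unfold holdProb
  rw [← intervalIntegral.integral_comp_add_right
    (fun u => rateUp c β (L u) n + rateDown c β (M u) n) h]

theorem jumpTerm_shift (h : ℝ) (k : ℕ) (m : ℤ) (t : ℝ) (n : ℤ) (s : ℝ) :
    jumpTerm c β L M k m (t + h) n (s + h)
      = jumpTerm c β (fun u => L (u + h)) (fun u => M (u + h)) k m t n s := by
  induction k generalizing n s with
  | zero => simp only [jumpTerm, holdProb_shift]
  | succ k ih =>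
    simp only [jumpTerm]
    rw [← intervalIntegral.integral_comp_add_right _ h]
    refine intervalIntegral.integral_congr fun u _ => ?_
    simp only [ih, holdProb_shift]

theorem transitionProb_shift (h : ℝ) (n : ℤ) (s : ℝ) (m : ℤ) (t : ℝ) :
    transitionProb c β L M n (s + h) m (t + h)
      = transitionProb c β (fun u => L (u + h)) (fun u => M (u + h)) n s m t :=
  tsum_congr fun k => jumpTerm_shift h k m t n s

theorem tendsto_of_eventually_abs_sub_le {f : ℝ → ℝ} {a K : ℝ}
    (h : ∀ ρ, 0 < ρ → ∀ᶠ τ in atTop, |f τ - a| ≤ K * ρ) : Tendsto f atTop (𝓝 a) := by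
  refine Metric.tendsto_nhds.2 fun ε hε => ?_
  filter_upwards [h (ε / (|K| + 1)) (by positivity)] with τ hτ
  rw [Real.dist_eq]
  refine hτ.trans_lt ?_
  rw [mul_div_assoc', div_lt_iff₀ (by positivity)]
  nlinarith [le_abs_self K]

/-- The kernels of the shifted walk converge to those of the walk with the limiting rates. -/
theorem tendsto_transitionProb_shift (hc : 0 < c) (hβ : ∀ n, 0 < β n) (hB : ∀ n, β n ≤ B)
    (hL : Continuous L) (hM : Continuous M) {l m : ℝ} (hLl : Tendsto L atTop (𝓝 l))
    (hMm : Tendsto M atTop (𝓝 m)) (n k : ℤ) {t s : ℝ} (ht : 0 ≤ t) (hts : t ≤ s) :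
    Tendsto (fun τ => transitionProb c β L M n (s + τ) k (t + τ)) atTop
      (𝓝 (transitionProb c β (fun _ => l) (fun _ => m) n s k t)) := by
  set X := Real.exp (c * (l + 1)) + Real.exp (-c * (m - 1)) with hX
  have hXl : Real.exp (c * (l + 1)) ≤ X := le_add_of_nonneg_right (Real.exp_pos _).le
  have hXm : Real.exp (-c * (m - 1)) ≤ X := le_add_of_nonneg_left (Real.exp_pos _).le
  have hbound : ∀ L' M' : ℝ → ℝ, (∀ u ∈ Set.Icc t s, |L' u - l| ≤ 1 ∧ |M' u - m| ≤ 1) →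
      RateBound c X t s L' M' := by
    intro L' M' h u hu
    obtain ⟨h1, h2⟩ := h u hu
    rw [abs_le] at h1 h2
    refine ⟨(Real.exp_le_exp.2 ?_).trans hXl, (Real.exp_le_exp.2 ?_).trans hXm⟩ <;> nlinarith
  set κ := 2 * growth c (0 - c) B X + 1 with hκ
  have hκ0 : 0 < κ := by
    have := mul_nonneg (offDiagConst_nonneg (c := c) (α := 0 - c) hβ hB)
      (show 0 ≤ X by positivity)
    rw [hκ, growth]
    linarith
  set R := weight c 0 k * Real.exp (growth c 0 B X * (s - t)) with hR
  refine tendsto_of_eventually_abs_sub_le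
    (K := 2 * (coefConst c 0 B X * R / κ) * Real.exp (κ * s) / weight c (0 - c) n) fun ρ hρ => ?_
  -- The cap at 1 keeps the shifted coefficients in the range where `X` bounds the exponentials, so
  -- the constants of the stability estimate do not depend on ρ.
  set δ := min ρ 1 with hδ
  have hδ0 : 0 < δ := lt_min hρ one_pos
  have hev := ((Metric.tendsto_nhds.1 hLl δ hδ0).and (Metric.tendsto_nhds.1 hMm δ hδ0))
  obtain ⟨T, hT⟩ := eventually_atTop.1 hev
  filter_upwards [eventually_ge_atTop T] with τ hτ
  rw [transitionProb_shift]
  have hclose : ∀ u ∈ Set.Icc t s, |L (u + τ) - l| < δ ∧ |M (u + τ) - m| < δ := fun u hu =>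
    hT (u + τ) (by linarith [hu.1])
  have hLτ : Continuous fun u => L (u + τ) := by fun_prop
  have hMτ : Continuous fun u => M (u + τ) := by fun_prop
  have hX1 : RateBound c X t s (fun u => L (u + τ)) (fun u => M (u + τ)) :=
    hbound _ _ fun u hu => ⟨(hclose u hu).1.le.trans (min_le_right _ _),
      (hclose u hu).2.le.trans (min_le_right _ _)⟩
  have hX2 : RateBound c X t s (fun _ => l) (fun _ => m) := hbound _ _ fun u hu => by simp
  have hexp : ∀ u ∈ Set.Icc t s, δ ≤ ρ * Real.exp (κ * u) := fun u hu =>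
    (min_le_left _ _).trans (le_mul_of_one_le_right hρ.le
      (Real.one_le_exp (mul_nonneg hκ0.le (ht.trans hu.1))))
  have h := forward_stability (ρ := ρ) (κ := κ) hc hβ hB hX1 hX2
    (isForward_transitionProb hβ hB hLτ hMτ k t)
    (isForward_transitionProb hβ hB continuous_const continuous_const k t)
    (by funext j; rw [transitionProb_self, transitionProb_self])
    (weightBound_transitionProb hβ hB hLτ hMτ hX1 k)
    (weightBound_transitionProb hβ hB continuous_const continuous_const hX2 k)
    (fun u hu => ⟨(hclose u hu).1.le.trans (hexp u hu), (hclose u hu).2.le.trans (hexp u hu)⟩)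
    hκ0 (by rw [hκ]; linarith) (s := s) ⟨hts, le_rfl⟩ n
  rw [div_mul_eq_mul_div, le_div_iff₀ (weight_pos _ _ _)]
  refine h.trans (le_of_eq ?_)
  ring

/-- Convergence of all singletons of a countable space implies setwise convergence. -/
theorem tendsto_measureReal_of_singleton {S ι : Type*} [Countable S] [Nonempty S]
    [MeasurableSpace S] [MeasurableSingletonClass S] {f : Filter ι} {μ : ι → Measure S}
    {ν : Measure S} [∀ i, IsProbabilityMeasure (μ i)] [IsProbabilityMeasure ν]
    (h : ∀ x, Tendsto (fun i => (μ i).real {x}) f (𝓝 (ν.real {x}))) (A : Set S) :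
    Tendsto (fun i => (μ i).real A) f (𝓝 (ν.real A)) := by
  classical
  have hms : ∀ A : Set S, MeasurableSet A := fun A => A.to_countable.measurableSet
  -- Almost all of the ν-mass of A sits on a finite subset, where convergence is known. The matching
  -- upper bound is this lower bound for the complement.
  have lower : ∀ (A : Set S) (a : ℝ), a < ν.real A → ∀ᶠ i in f, a < (μ i).real A := by
    intro A a ha
    obtain ⟨F, _, hF⟩ := exists_finset_measure_compl_lt ν
      (ε := ENNReal.ofReal (ν.real A - a)) (ENNReal.ofReal_pos.2 (sub_pos.2 ha))
    have hF' : ν.real (F : Set S)ᶜ < ν.real A - a := by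
      rw [Measure.real]
      exact (ENNReal.lt_ofReal_iff_toReal_lt (measure_ne_top _ _)).1 hF
    set G := F.filter (· ∈ A) with hG
    have hGA : (G : Set S) ⊆ A := fun x hx => (Finset.mem_filter.1 hx).2
    have hcover : A ⊆ (G : Set S) ∪ (F : Set S)ᶜ := fun x hx => by
      by_cases hxF : x ∈ F
      · exact Or.inl (Finset.mem_filter.2 ⟨hxF, hx⟩)
      · exact Or.inr hxF
    have h1 : a < ν.real (G : Set S) := by
      have := (measureReal_mono (μ := ν) hcover).trans (measureReal_union_le _ _)
      linarith
    have h2 : Tendsto (fun i => (μ i).real (G : Set S)) f (𝓝 (ν.real (G : Set S))) := by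
      simp only [← sum_measureReal_singleton]
      exact tendsto_finsetSum _ fun x _ => h x
    filter_upwards [h2.eventually_const_lt h1] with i hi
    exact hi.trans_le (measureReal_mono hGA)
  refine tendsto_order.2 ⟨lower A, fun a ha => ?_⟩
  have h1 := probReal_compl_eq_one_sub (μ := ν) (hms A)
  filter_upwards [lower Aᶜ (1 - a) (by linarith)] with i hi
  have h2 := probReal_compl_eq_one_sub (μ := μ i) (hms A)
  linarith

theorem HasMarkovianFDD.tendsto_singleton {P Q : Measure (ℝ≥0 → ℤ)} {q : ℝ → ℤ → ℝ}
    {κ κ' : ℤ → ℝ → ℤ → ℝ → ℝ} {π : ℤ → ℝ} (hP : HasMarkovianFDD P q κ)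
    (hQ : HasMarkovianFDD Q (fun _ => π) κ')
    (hq : ∀ n, Tendsto (fun t => q t n) atTop (𝓝 (π n)))
    (hκ : ∀ n k t s, 0 ≤ t → t ≤ s →
      Tendsto (fun τ => κ n (s + τ) k (t + τ)) atTop (𝓝 (κ' n s k t)))
    (k : ℕ) (t : Fin k → ℝ≥0) (ht : Monotone t) (n : Fin k → ℤ) :
    Tendsto (fun τ : ℝ≥0 => P.real {ω | ∀ i, ω (t i + τ) = n i}) atTop
      (𝓝 (Q.real {ω | ∀ i, ω (t i) = n i})) := by
  have := hP.isProbabilityMeasure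
  have := hQ.isProbabilityMeasure
  cases k with
  | zero =>
    have h1 : ∀ τ : ℝ≥0, {ω : ℝ≥0 → ℤ | ∀ i : Fin 0, ω (t i + τ) = n i} = Set.univ := fun τ =>
      Set.eq_univ_of_forall fun ω i => i.elim0
    have h2 : {ω : ℝ≥0 → ℤ | ∀ i : Fin 0, ω (t i) = n i} = Set.univ :=
      Set.eq_univ_of_forall fun ω i => i.elim0
    simp only [h1, h2, probReal_univ]
    exact tendsto_const_nhds
  | succ k =>
    have hP' := fun τ : ℝ≥0 => hP.fdd k (fun i => t i + τ) (fun i j h => add_le_add_left (ht h) τ) n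
    simp only [hP', hQ.fdd k t ht n, NNReal.coe_add]
    have hcoe : Tendsto (fun τ : ℝ≥0 => (τ : ℝ)) atTop atTop := NNReal.tendsto_coe_atTop.2 tendsto_id
    refine Tendsto.mul ?_ (tendsto_finsetProd _ fun i _ => ?_)
    · exact (hq (n 0)).comp (tendsto_atTop_add_const_left _ _ hcoe)
    · exact (hκ _ _ _ _ (t i.castSucc).2 (ht (Fin.castSucc_le_succ i))).comp hcoe

theorem fddTendsto_of_tendsto {P Q : Measure (ℝ≥0 → ℤ)} {q : ℝ → ℤ → ℝ}
    {κ κ' : ℤ → ℝ → ℤ → ℝ → ℝ} {π : ℤ → ℝ} (hP : HasMarkovianFDD P q κ)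
    (hQ : HasMarkovianFDD Q (fun _ => π) κ')
    (hq : ∀ n, Tendsto (fun t => q t n) atTop (𝓝 (π n)))
    (hκ : ∀ n k t s, 0 ≤ t → t ≤ s →
      Tendsto (fun τ => κ n (s + τ) k (t + τ)) atTop (𝓝 (κ' n s k t))) : FDDTendsto P Q := by
  intro k t ht A
  have := hP.isProbabilityMeasure
  have := hQ.isProbabilityMeasure
  have hmP : ∀ τ : ℝ≥0, Measurable fun (ω : ℝ≥0 → ℤ) (i : Fin k) => ω (t i + τ) := fun τ =>
    measurable_pi_lambda _ fun i => measurable_pi_apply _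
  have hmQ : Measurable fun (ω : ℝ≥0 → ℤ) (i : Fin k) => ω (t i) :=
    measurable_pi_lambda _ fun i => measurable_pi_apply _
  have : ∀ τ : ℝ≥0, IsProbabilityMeasure (P.map fun (ω : ℝ≥0 → ℤ) (i : Fin k) => ω (t i + τ)) :=
    fun τ => Measure.isProbabilityMeasure_map (hmP τ).aemeasurable
  have : IsProbabilityMeasure (Q.map fun (ω : ℝ≥0 → ℤ) (i : Fin k) => ω (t i)) :=
    Measure.isProbabilityMeasure_map hmQ.aemeasurable
  have hA : ∀ A : Set (Fin k → ℤ), MeasurableSet A := fun A => A.to_countable.measurableSet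
  have h := tendsto_measureReal_of_singleton
    (μ := fun τ : ℝ≥0 => P.map fun (ω : ℝ≥0 → ℤ) (i : Fin k) => ω (t i + τ))
    (ν := Q.map fun (ω : ℝ≥0 → ℤ) (i : Fin k) => ω (t i)) (f := atTop) (fun x => ?_) A
  · simp only [map_measureReal_apply (hmP _) (hA A), map_measureReal_apply hmQ (hA A)] at h
    exact h
  · simp only [map_measureReal_apply (hmP _) (hA {x}), map_measureReal_apply hmQ (hA {x})]
    have h1 := hP.tendsto_singleton hQ hq hκ k t ht x
    have e1 : ∀ τ : ℝ≥0, (fun (ω : ℝ≥0 → ℤ) (i : Fin k) => ω (t i + τ)) ⁻¹' {x}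
        = {ω | ∀ i, ω (t i + τ) = x i} := fun τ => by
      ext ω; exact funext_iff
    have e2 : (fun (ω : ℝ≥0 → ℤ) (i : Fin k) => ω (t i)) ⁻¹' {x}
        = {ω | ∀ i, ω (t i) = x i} := by
      ext ω; exact funext_iff
    simp only [e1, e2]
    exact h1

/-- The finite-dimensional distributions determine the law of the process. -/
theorem HasMarkovianFDD.unique {P P' : Measure (ℝ≥0 → ℤ)} {q : ℝ → ℤ → ℝ}
    {κ : ℤ → ℝ → ℤ → ℝ → ℝ} (hP : HasMarkovianFDD P q κ) (hP' : HasMarkovianFDD P' q κ) :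
    P = P' := by
  have := hP.isProbabilityMeasure
  have := hP'.isProbabilityMeasure
  have hprob : ∀ I : Finset ℝ≥0,
      IsProbabilityMeasure (P'.map (I.restrict (π := fun _ => ℤ))) := fun I =>
    Measure.isProbabilityMeasure_map (Finset.measurable_restrict I).aemeasurable
  have h' : IsProjectiveLimit (α := fun _ : ℝ≥0 => ℤ) P'
      fun I => P'.map (I.restrict (π := fun _ => ℤ)) := fun I => rfl
  refine IsProjectiveLimit.unique (α := fun _ : ℝ≥0 => ℤ) (fun I => ?_) h'
  refine Measure.ext_of_singleton fun x => ?_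
  rw [Measure.map_apply (Finset.measurable_restrict I) (measurableSet_singleton x),
    Measure.map_apply (Finset.measurable_restrict I) (measurableSet_singleton x)]
  rcases hk : I.card with _ | k
  · obtain rfl := Finset.card_eq_zero.1 hk
    have : (Finset.restrict (π := fun _ => ℤ) ∅) ⁻¹' {x} = Set.univ :=
      Set.eq_univ_of_forall fun ω => funext fun i => absurd i.2 (Finset.notMem_empty _)
    rw [this, measure_univ, measure_univ]
  · set t : Fin (k + 1) → ℝ≥0 := fun i => I.orderEmbOfFin hk i with ht
    have hmem : ∀ i, t i ∈ I := fun i => Finset.orderEmbOfFin_mem I hk i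
    have hset : (I.restrict (π := fun _ => ℤ)) ⁻¹' {x}
        = {ω : ℝ≥0 → ℤ | ∀ i, ω (t i) = x ⟨t i, hmem i⟩} := by
      ext ω
      constructor
      · intro h i
        exact congrFun (Set.mem_singleton_iff.1 h) ⟨t i, hmem i⟩
      · intro h
        refine Set.mem_singleton_iff.2 (funext fun ⟨u, hu⟩ => ?_)
        have : u ∈ Set.range (I.orderEmbOfFin hk) := by
          rw [Finset.range_orderEmbOfFin]; exact hu
        obtain ⟨i, rfl⟩ := this
        exact h i
    have h1 := hP.fdd k t (I.orderEmbOfFin hk).monotone fun i => x ⟨t i, hmem i⟩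
    have h2 := hP'.fdd k t (I.orderEmbOfFin hk).monotone fun i => x ⟨t i, hmem i⟩
    rw [hset, ← ENNReal.toReal_eq_toReal_iff' (measure_ne_top _ _) (measure_ne_top _ _)]
    exact h1.trans h2.symm

/-- The shifted process has the same one-time law and the same kernels, and the finite-dimensional
distributions determine the measure. -/
theorem HasMarkovianFDD.isStationary {Q : Measure (ℝ≥0 → ℤ)} {π : ℤ → ℝ}
    {κ : ℤ → ℝ → ℤ → ℝ → ℝ} (hQ : HasMarkovianFDD Q (fun _ => π) κ)
    (hκ : ∀ n s k t h, κ n (s + h) k (t + h) = κ n s k t) : IsStationary Q := by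
  intro h
  have hm : Measurable fun (ω : ℝ≥0 → ℤ) (t : ℝ≥0) => ω (t + h) :=
    measurable_pi_lambda _ fun t => measurable_pi_apply _
  have := hQ.isProbabilityMeasure
  refine HasMarkovianFDD.unique ⟨Measure.isProbabilityMeasure_map hm.aemeasurable,
    fun k t ht n => ?_⟩ hQ
  have hms : MeasurableSet {ω : ℝ≥0 → ℤ | ∀ i, ω (t i) = n i} := by
    rw [Set.ofPred_forall]
    refine MeasurableSet.iInter fun i => ?_
    exact (measurable_pi_apply (X := fun _ : ℝ≥0 => ℤ) (t i)) (measurableSet_singleton (n i))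
  rw [map_measureReal_apply hm hms]
  refine (hQ.fdd k (fun i => t i + h) (fun i j hij => add_le_add_left (ht hij) h) n).trans ?_
  simp only [NNReal.coe_add, hκ]

/-- Existence of the stationary walk with the limiting rates. -/
theorem exists_isStationaryWalk (hc : 0 < c) (hβ : ∀ n, 0 < β n) (hB : ∀ n, β n ≤ B) (l m : ℝ) :
    ∃ Q, IsStationaryWalk c β l m Q := by
  set π := discreteGaussian c ((l + m) / 2) with hπ
  have hL : Continuous fun _ : ℝ => l := continuous_const
  have hM : Continuous fun _ : ℝ => m := continuous_const
  have hπB : MemB c 0 π := memB_discreteGaussian hc 0 _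
  -- By detailed balance the constant curve π solves the forward equations; uniqueness makes it the
  -- flow of π, so π is invariant under the kernels.
  have hfor : IsForward c β (fun _ => l) (fun _ => m) 0 fun _ => π := fun s _ n =>
    (hasDerivWithinAt_const s _ (π n)).congr_deriv (kolmogorovRHS_discreteGaussian c β l m n).symm
  have hflow : ∀ t, 0 ≤ t → ∀ n,
      HasSum (fun k => π k * transitionProb c β (fun _ => l) (fun _ => m) n t k 0) (π n) := by
    intro t ht n
    have h1 := hfor.eq_flow (R := normB c 0 π) hc hβ hB hL hM
      (fun s _ n => hπB.abs_mul_weight_le n) ht (fun n => (discreteGaussian_pos hc _ n).le) hπB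
    have h2 := (summable_flow hβ hB hL hM hπB n ht).hasSum
    have h3 : π n = flow c β (fun _ => l) (fun _ => m) π 0 t n := congrFun h1 n
    rw [h3]
    exact h2
  obtain ⟨Q, hQ⟩ := exists_hasMarkovianFDD (isStochasticSemigroup_transitionProb hc hβ hB hL hM)
    (isProbVector_discreteGaussian hc _) hflow
  exact ⟨Q, hQ, hQ.isStationary fun n s k t h => transitionProb_shift h n s k t⟩

end NonlinearWalk

theorem theorem5 (c α Cl Cm : ℝ) (hc : 0 < c) (hCl : 0 < Cl) (hCm : 0 < Cm)
    (β : ℤ → ℝ) (hβpos : ∀ n, 0 < β n) (hβbdd : BddAbove (Set.range β))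
    (L0 M0 : ℝ) (p0 : ℤ → ℝ) (hp0 : NonlinearWalk.IsProbVector p0)
    (hp0B : NonlinearWalk.MemB c α p0) :
    ∃ (L M : ℝ → ℝ) (p : ℝ → ℤ → ℝ),
      NonlinearWalk.IsSolution c α β Cl Cm L0 M0 p0 L M p ∧
      (∀ (L' M' : ℝ → ℝ) (p' : ℝ → ℤ → ℝ),
        NonlinearWalk.IsSolution c α β Cl Cm L0 M0 p0 L' M' p' →
          ∀ t, 0 ≤ t → L' t = L t ∧ M' t = M t ∧ p' t = p t) ∧
      (∀ n s m t, 0 ≤ t → t ≤ s →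
        Summable fun k => NonlinearWalk.jumpTerm c β L M k m t n s) ∧
      NonlinearWalk.IsStochasticSemigroup (NonlinearWalk.transitionProb c β L M) ∧
      ∃ P : Measure (ℝ≥0 → ℤ),
        NonlinearWalk.HasMarkovianFDD P p (NonlinearWalk.transitionProb c β L M) ∧
        (∀ (t : ℝ≥0) (n : ℤ), P.real {ω | ω t = n} = p t n) ∧
        (NonlinearWalk.ConvergenceCondition c β → Cl = Cm →
          ∃ Ls Ms : ℝ,
            NonlinearWalk.IsFixedPoint c β Cl Cm Ls Ms
              (NonlinearWalk.discreteGaussian c ((Ls + Ms) / 2)) ∧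
            NonlinearWalk.invariantK Ls Ms
                (NonlinearWalk.discreteGaussian c ((Ls + Ms) / 2)) =
              NonlinearWalk.invariantK L0 M0 p0 ∧
            ∃ Q : Measure (ℝ≥0 → ℤ),
              NonlinearWalk.IsStationaryWalk c β Ls Ms Q ∧
              NonlinearWalk.FDDTendsto P Q) := by
  open NonlinearWalk in
  obtain ⟨B, hB⟩ : ∃ B, ∀ n, β n ≤ B := by
    obtain ⟨B, hB⟩ := hβbdd
    exact ⟨B, fun n => hB ⟨n, rfl⟩⟩
  obtain ⟨L, M, hL, hM, hsol, huniq⟩ :=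
    exists_unique_solution hc hCl hCm hβpos hB hp0.1 hp0B L0 M0
  have hstoch := isStochasticSemigroup_transitionProb hc hβpos hB hL hM
  obtain ⟨P, hP⟩ := exists_hasMarkovianFDD (q := flow c β L M p0 0) hstoch hp0 fun t ht n =>
    (summable_flow hβpos hB hL hM hp0B n ht).hasSum
  refine ⟨L, M, flow c β L M p0 0, hsol, huniq,
    fun n s m t _ hts => summable_jumpTerm hβpos hB hL hM m n hts, hstoch, P, hP, ?_, ?_⟩
  · intro t n
    -- The index 0 stands for a single time, and the product of kernels is then empty.
    have h := hP.fdd 0 (fun _ => t) monotone_const fun _ => n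
    simpa using h
  · rintro hcond rfl
    -- The conserved quantity of the initial data selects the fixed point used as the limit.
    obtain ⟨l, m, hfix, hK⟩ := exists_isFixedPoint hc hβpos hB hCl (invariantK L0 M0 p0)
    have hprob : ∀ t, 0 ≤ t → IsProbVector (flow c β L M p0 0 t) := by
      intro t ht
      obtain ⟨X, _, hX⟩ := exists_rateBound hL hM c 0 t
      refine ⟨fun n => flow_nonneg hβpos hp0.1 ht n,
        (isForward_flow hβpos hB hL hM hp0B 0).hasSum_mass hc hβpos hB hX
          (weightBound_flow hβpos hB hL hM hp0.1 hp0B hX) ht ?_⟩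
      rw [hsol.init_p]
      exact hp0.2
    obtain ⟨hLl, hMm, hp⟩ := hsol.tendsto_fixedPoint hc hCl hβpos hB hcond hL hM hprob hfix hK
    obtain ⟨Q, hQ⟩ := exists_isStationaryWalk hc hβpos hB l m
    exact ⟨l, m, hfix, hK, Q, hQ, fddTendsto_of_tendsto hP hQ.fdd hp fun n k t s ht hts =>
      tendsto_transitionProb_shift hc hβpos hB hL hM hLl hMm n k ht hts⟩
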